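/- Fix a finite alphabet $\Sigma$. For a length $n \in \mathbb{N}$, a \emph{strategy} is a function $\sigma$ that assigns to every history $h \in \Sigma^{<n}$ a probability distribution $\sigma(h,\cdot)$ on $\Sigma$. Two strategies $\sigma$ (ours) and $\tau$ (the adversary's) generate a random play $\pi = \pi_0\dots\pi_{n-1} \in \Sigma^n$: $\pi_i$ is drawn from $\sigma(\pi_0\dots\pi_{i-1},\cdot)$ if $i$ is even and from $\tau(\pi_0\dots\pi_{i-1},\cdot)$ if $i$ is odd. Write $P_{\sigma,\tau}$ for the resulting distribution. A \emph{decision algorithm} $\mathcal{X}$ is a deterministic algorithm that halts on every word $w\in\Sigma^*$; $L(\mathcal{X})$ is the set of words it accepts, and $|\mathcal{X}|$ is the size of its code. For a polynomial $p$, let $\mathrm{PSA}_p$ be the class of decision algorithms $\mathcal{X}$ that use space at most $p(|\mathcal{X}|+|w|)$ on every $w \in \Sigma^*$. An \emph{RCI instance} is $\mathcal{C} = (\mathcal{H},\mathcal{S},n,\epsilon,\rho)$ with decision algorithms $\mathcal{H},\mathcal{S}$, $n\in\mathbb{N}$ and $\epsilon,\rho\in[0,1]\cap\mathbb{Q}$;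 its size $|\mathcal{C}|$ is the size of its encoding, with $n$ in unary and $\epsilon,\rho$ in binary. Let $I = L(\mathcal{H})\cap\Sigma^n$ and $A = I\cap L(\mathcal{S})$. A strategy $\sigma$ is \emph{improvising} for $\mathcal{C}$ if for every adversary $\tau$: $P_{\sigma,\tau}(I)=1$, $P_{\sigma,\tau}(A)\ge 1-\epsilon$, and $P_{\sigma,\tau}(\pi)\le\rho$ for all $\pi\in I$. $\mathcal{C}$ is \emph{realizable} if it has an improvising strategy. An \emph{improviser} for $\mathcal{C}$ is a probabilistic algorithm (using fair coin tosses) with finite expected running time on every $h\in\Sigma^{\le n}$ such that, for some improvising strategy $\sigma$, its output distribution on each $h\in\Sigma^{<n}$ is exactly $\sigma(h,\cdot)$. Let $\mathrm{RCI}(\mathrm{PSA}_p,\mathrm{PSA}_p)$ be the class of RCI instances with $\mathcal{H},\mathcal{S}\in\mathrm{PSA}_p$. \textbf{Theorem.} There is a deterministic algorithm $S$ that is a polynomial-space improvisation scheme for $\mathrm{RCI}(\mathrm{PSA}_p,\mathrm{PSA}_p)$ for every polynomial $p$. That is, for every $p$: (1) for every $\mathcal{C}\in\mathrm{RCI}(\mathrm{PSA}_p,\mathrm{PSA}_p)$,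 if $\mathcal{C}$ is realizable then $S(\mathcal{C})$ is (the code of) an improviser for $\mathcal{C}$, and otherwise $S(\mathcal{C})=\bot$; (2) there is a polynomial $r$ such that $S$ uses space at most $r(|\mathcal{C}|)$ on every $\mathcal{C}\in\mathrm{RCI}(\mathrm{PSA}_p,\mathrm{PSA}_p)$; (3) there is a polynomial $q$ such that for every $\mathcal{C}\in\mathrm{RCI}(\mathrm{PSA}_p,\mathrm{PSA}_p)$ with $S(\mathcal{C})=G\neq\bot$, every run of $G$ on every $h\in\Sigma^{\le n}$ uses space at most $q(|\mathcal{C}|)$ (so in particular its expected space is at most $q(|\mathcal{C}|)$). Here algorithms are programs of the WHILE language over binary trees (with a fair-coin instruction), and space is the largest number of nodes of the tree in the program's store during the run. -/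

import Mathlib

/-! Reactive control improvisation over a fixed finite alphabet `Fin k`, and polynomial-space
improvisation schemes.  Algorithms are programs of the WHILE language over binary trees, with an
additional instruction that tosses a fair coin. -/

namespace Improv

/-! ### The machine model -/

/-- The data of the machine: binary trees (S-expressions over the single atom `nil`). -/
inductive Val : Type where
  | nil : Val
  | cons : Val → Val → Val

/-- Size of a datum: the number of nodes (leaves included).  No sharing is taken into account, so
this is, up to a constant factor, the number of bits needed to write the tree down. -/
def Val.size : Val → ℕ
  | .nil => 1
  | .cons a b => a.size + b.size + 1

/-- First component, with `hd nil = nil`. -/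
def Val.hd : Val → Val
  | .nil => .nil
  | .cons a _ => a

/-- Second component, with `tl nil = nil`. -/
def Val.tl : Val → Val
  | .nil => .nil
  | .cons _ b => b

/-- Expressions over the store `X`. -/
inductive Expr : Type where
  | var : Expr
  | nil : Expr
  | cons : Expr → Expr → Expr
  | hd : Expr → Expr
  | tl : Expr → Expr

/-- The value of an expression when the store is `x`. -/
def Expr.eval : Expr → Val → Val
  | .var, x => x
  | .nil, _ => .nil
  | .cons a b, x => .cons (a.eval x) (b.eval x)
  | .hd e, x => (e.eval x).hd
  | .tl e, x => (e.eval x).tl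

/-- Programs.  A program works on one store `X` holding a tree.
* `assign e` is `X := e`;
* `flip` tosses a fair coin `b` and performs `X := cons b X`;
* `seq p q` is `p; q`;
* `cond e p q` is `if e ≠ nil then p else q`;
* `loop e p` is `while e ≠ nil do p`. -/
inductive Prog : Type where
  | assign : Expr → Prog
  | flip : Prog
  | seq : Prog → Prog → Prog
  | cond : Expr → Prog → Prog → Prog
  | loop : Expr → Prog → Prog

/-- A program is deterministic if it contains no coin toss. -/
def Prog.Deterministic : Prog → Prop
  | .assign _ => True
  | .flip => False
  | .seq p q => p.Deterministic ∧ q.Deterministic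
  | .cond _ p q => p.Deterministic ∧ q.Deterministic
  | .loop _ p => p.Deterministic

/-- A bit as a datum. -/
def Val.bit : Bool → Val
  | false => .nil
  | true => .cons .nil .nil

/-- Configurations: the pieces of program that remain to be executed, and the store. -/
structure Cfg : Type where
  ctrl : List Prog
  store : Val

/-- One step of computation.  Every step has two possible successors, given by the outcome `b` of a
coin toss; they differ only at the instruction `flip`.  A configuration whose control is empty is
halted, and stays as it is. -/
def step (b : Bool) : Cfg → Cfg
  | ⟨[], x⟩ => ⟨[], x⟩
  | ⟨.assign e :: K, x⟩ => ⟨K, e.eval x⟩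
  | ⟨.flip :: K, x⟩ => ⟨K, .cons (Val.bit b) x⟩
  | ⟨.seq p q :: K, x⟩ => ⟨p :: q :: K, x⟩
  | ⟨.cond e p q :: K, x⟩ =>
      match e.eval x with
      | .nil => ⟨q :: K, x⟩
      | .cons _ _ => ⟨p :: K, x⟩
  | ⟨.loop e p :: K, x⟩ =>
      match e.eval x with
      | .nil => ⟨K, x⟩
      | .cons _ _ => ⟨p :: .loop e p :: K, x⟩

/-- The configuration reached from `c` after `ω.length` steps, with coin tosses `ω`. -/
def run : List Bool → Cfg → Cfg
  | [], c => c
  | b :: ω, c => run ω (step b c)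

/-- The initial configuration of the program `P` on input `x`. -/
def init (P : Prog) (x : Val) : Cfg := ⟨[P], x⟩

/-- On input `x` there is a run of `P` that halts with output `y`.  (A deterministic program has
only one run on `x`, so then this says that `P` computes `y` from `x`.) -/
def Outputs (P : Prog) (x y : Val) : Prop := ∃ ω : List Bool, run ω (init P x) = ⟨[], y⟩

/-- On input `x` the program `P` uses space at most `s`: at every moment of every run the contents
of the store have size at most `s`.  (As with the finite control of a Turing machine, the position
in the program is not counted.) -/
def SpaceLE (P : Prog) (x : Val) (s : ℕ) : Prop :=
  ∀ ω : List Bool, (run ω (init P x)).store.size ≤ s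

open Classical in
/-- The probability that the configuration reached from `c` after `t` steps lies in `E`, when the
coin tosses are fair and independent. -/
noncomputable def prob (E : Set Cfg) : ℕ → Cfg → ℝ
  | 0, c => if c ∈ E then 1 else 0
  | t + 1, c => (prob E t (step false c) + prob E t (step true c)) / 2

/-- The expected number of steps of `P` on input `x` is finite: the series
`∑ t, Pr[P has not halted after t steps]`, whose sum is the expectation, converges. -/
def FiniteExpectedTime (P : Prog) (x : Val) : Prop :=
  Summable fun t : ℕ => prob {c | c.ctrl ≠ []} t (init P x)

/-- On input `x` the program `P` halts with output `y` with probability exactly `r`. -/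
def OutputsWithProb (P : Prog) (x y : Val) (r : ℝ) : Prop :=
  Filter.Tendsto (fun t : ℕ => prob {c | c = ⟨[], y⟩} t (init P x)) Filter.atTop (nhds r)

/-! ### Encodings -/

/-- Lists as right-nested trees. -/
def Val.ofList : List Val → Val
  | [] => .nil
  | a :: l => .cons a (Val.ofList l)

/-- Natural numbers in unary. -/
def Val.unary : ℕ → Val
  | 0 => .nil
  | n + 1 => .cons .nil (Val.unary n)

/-- Natural numbers in binary, least significant bit first. -/
def Val.binary (n : ℕ) : Val := Val.ofList ((Nat.bits n).map Val.bit)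

/-- Words over the alphabet `Fin k`. -/
def encWord {k : ℕ} (w : List (Fin k)) : Val :=
  Val.ofList (w.map fun u : Fin k => Val.unary (u : ℕ))

/-- The code of an expression. -/
def Expr.enc : Expr → Val
  | .var => .cons (Val.unary 0) .nil
  | .nil => .cons (Val.unary 1) .nil
  | .cons a b => .cons (Val.unary 2) (.cons a.enc b.enc)
  | .hd e => .cons (Val.unary 3) e.enc
  | .tl e => .cons (Val.unary 4) e.enc

/-- The code of a program.  It is never `nil`. -/
def Prog.enc : Prog → Val
  | .assign e => .cons (Val.unary 0) e.enc
  | .flip => .cons (Val.unary 1) .nil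
  | .seq p q => .cons (Val.unary 2) (.cons p.enc q.enc)
  | .cond e p q => .cons (Val.unary 3) (.cons e.enc (.cons p.enc q.enc))
  | .loop e p => .cons (Val.unary 4) (.cons e.enc p.enc)

/-- The size of a program: the size of its code. -/
def Prog.size (P : Prog) : ℕ := P.enc.size

/-! ### Synthesis games -/

/-- `σ` is a strategy for plays of length `n`: after every history of length less than `n` it gives
a probability distribution on the alphabet.  (Its values on longer words play no role.) -/
def IsStrategy {k : ℕ} (n : ℕ) (σ : List (Fin k) → Fin k → ℝ) : Prop :=
  ∀ h : List (Fin k), h.length < n → (∀ u, 0 ≤ σ h u) ∧ ∑ u, σ h u = 1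

/-- The probability `P_{σ,τ}(π)` of the play `π`: the symbol at position `i` is drawn from `σ` for
even `i` and from the adversary `τ` for odd `i`, given the symbols before it. -/
noncomputable def playProb {k n : ℕ} (σ τ : List (Fin k) → Fin k → ℝ) (π : Fin n → Fin k) : ℝ :=
  ∏ i : Fin n, (if Even (i : ℕ) then σ else τ) ((List.ofFn π).take i) (π i)

open Classical in
/-- The probability `P_{σ,τ}(X)` of a set `X` of plays. -/
noncomputable def setProb {k n : ℕ} (σ τ : List (Fin k) → Fin k → ℝ)
    (X : Set (Fin n → Fin k)) : ℝ :=
  ∑ π : Fin n → Fin k, if π ∈ X then playProb σ τ π else 0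

/-! ### Reactive control improvisation -/

/-- The language over `Fin k` of a decision algorithm: the words on which it halts with an output
other than `nil`. -/
def language (k : ℕ) (P : Prog) : Set (List (Fin k)) :=
  {w | ∃ y : Val, y ≠ .nil ∧ Outputs P (encWord w) y}

/-- The decision algorithms over the alphabet `Fin k` that run in space `p`: deterministic programs
that halt on every word `w`, using space at most `p (size of the program + |w|)`. -/
def PSA (k : ℕ) (p : Polynomial ℕ) : Set Prog :=
  {P | P.Deterministic ∧ ∀ w : List (Fin k),
    (∃ y : Val, Outputs P (encWord w) y) ∧
    SpaceLE P (encWord w) (p.eval (P.size + w.length))}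

/-- An RCI instance: a hard and a soft specification (given as algorithms), the length `n` of
plays, and rational parameters `ε, ρ ∈ [0, 1]`. -/
structure Inst : Type where
  hard : Prog
  soft : Prog
  n : ℕ
  ε : ℚ
  ρ : ℚ
  ε_nonneg : 0 ≤ ε
  ε_le_one : ε ≤ 1
  ρ_nonneg : 0 ≤ ρ
  ρ_le_one : ρ ≤ 1

/-- An RCI instance as an input: `n` in unary, `ε` and `ρ` as fractions in lowest terms, in
binary. -/
def Inst.enc (C : Inst) : Val :=
  Val.ofList [C.hard.enc, C.soft.enc, Val.unary C.n,
    Val.binary C.ε.num.toNat, Val.binary C.ε.den, Val.binary C.ρ.num.toNat, Val.binary C.ρ.den]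

/-- The size `|C|` of an RCI instance. -/
def Inst.size (C : Inst) : ℕ := C.enc.size

/-- The class of RCI instances with hard specification in `HSpec` and soft one in `SSpec`. -/
def RCI (HSpec SSpec : Set Prog) : Set Inst := {C | C.hard ∈ HSpec ∧ C.soft ∈ SSpec}

/-- The set `I` of improvisations. -/
def Inst.I (k : ℕ) (C : Inst) : Set (Fin C.n → Fin k) := {π | List.ofFn π ∈ language k C.hard}

/-- The set `A` of admissible improvisations. -/
def Inst.A (k : ℕ) (C : Inst) : Set (Fin C.n → Fin k) :=
  {π | π ∈ C.I k ∧ List.ofFn π ∈ language k C.soft}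

/-- `σ` is an improvising strategy for `C`: against every adversary `τ`, the hard constraint, the
soft constraint and the randomness requirement hold. -/
def IsImprovising {k : ℕ} (C : Inst) (σ : List (Fin k) → Fin k → ℝ) : Prop :=
  IsStrategy C.n σ ∧
  ∀ τ : List (Fin k) → Fin k → ℝ, IsStrategy C.n τ →
    setProb σ τ (C.I k) = 1 ∧
    1 - (C.ε : ℝ) ≤ setProb σ τ (C.A k) ∧
    ∀ π ∈ C.I k, playProb σ τ π ≤ (C.ρ : ℝ)

/-- `C` is realizable: there is an improvising strategy. -/
def Inst.Realizable (k : ℕ) (C : Inst) : Prop :=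
  ∃ σ : List (Fin k) → Fin k → ℝ, IsImprovising C σ

/-- The probabilistic program `G` is an improviser for `C`: on all histories its expected running
time is finite, and it implements an improvising strategy `σ`, i.e. its output distribution on a
history `h` after which the game goes on is `σ h`. -/
def IsImproviser (k : ℕ) (G : Prog) (C : Inst) : Prop :=
  (∀ h : List (Fin k), h.length ≤ C.n → FiniteExpectedTime G (encWord h)) ∧
  ∃ σ : List (Fin k) → Fin k → ℝ, IsImprovising C σ ∧
    ∀ h : List (Fin k), h.length < C.n →
      ∀ u : Fin k, OutputsWithProb G (encWord h) (Val.unary u) (σ h u)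

/-- The program `S` is a polynomial-space improvisation scheme for the class `Cls`.  The output `nil`
stands for `⊥`; any other output of `S` is the code of an improviser. -/
structure IsPolySpaceScheme (k : ℕ) (S : Prog) (Cls : Set Inst) : Prop where
  /-- The scheme is a deterministic algorithm. -/
  deterministic : S.Deterministic
  /-- Correctness, realizable instances. -/
  correct_realizable : ∀ C ∈ Cls, C.Realizable k →
    ∃ G : Prog, Outputs S C.enc G.enc ∧ IsImproviser k G C
  /-- Correctness, unrealizable instances. -/
  correct_unrealizable : ∀ C ∈ Cls, ¬ C.Realizable k → Outputs S C.enc .nil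
  /-- Scheme efficiency. -/
  scheme_space : ∃ p : Polynomial ℕ, ∀ C ∈ Cls, SpaceLE S C.enc (p.eval C.size)
  /-- Improviser efficiency: the bound holds on every run of the improviser, and so in particular
  for the expected space. -/
  improviser_space : ∃ q : Polynomial ℕ, ∀ C ∈ Cls, ∀ G : Prog, Outputs S C.enc G.enc →
    ∀ h : List (Fin k), h.length ≤ C.n → SpaceLE G (encWord h) (q.eval C.size)

end Improv

namespace Improv

/-! ### Deterministic runs with a bound on the store -/

/-! Write ρ = N/D in lowest terms and scale probabilities by D, so that every play in I may carry
weight at most N. Give a complete play the value N if it lies in I (respectively in A) and 0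
otherwise, and extend values backwards over histories by sums at our turns and minima at the
adversary's (`gameVal`). With V_I and V_A the two values of the empty history, the instance is
realizable iff D ≤ V_I and (1 - ε) D ≤ V_A; `Inst.Feasible` is this condition with denominators
cleared.

Necessity (`reachProb_le`, `IsImprovising.feasible`): against an adversary that always moves to a
child of least value, the randomness bound on single plays adds up to P(I) ≤ V_I / D, and likewise
P(A) ≤ V_A / D. The two minimizing adversaries may differ.

Sufficiency: one strategy has to meet both bounds. Start with the integer weight D at the empty
history. At our turn split the weight of the history greedily over its children, first up to their
A-values and then, with what is left, up to their I-values (`alloc`); at the adversary's turn every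
child inherits the whole weight. The strategy plays in proportion to weights. The weight of a
history never exceeds its I-value (`mass_le`), which gives the hard constraint and the bound ρ.
Since the A-capacities are filled first, the part of the weight that ends in A is at least the
minimum of the weight and the A-value (`reachProb_strategy`), which gives the soft constraint.

Values and weights are integers with polynomially many digits. They are computed by recursions of
polynomial depth, and a recursion takes space depth times the space of one call, although its tree
may be exponentially large (`RecTree.ev`). Functional programs `F` are compiled to the WHILE
language, and `Ev` tracks their space. Membership in the two languages is decided by a
self-interpreter (`interp_ev`). It contains no space bound: the decision programs halt by
assumption, and p enters only the analysis. This is why one scheme serves every p.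

The scheme tests feasibility and, if it holds, outputs a fixed program into which the instance has
been written as a constant. On a history, that program recomputes the weights of the continuations
and samples one of them exactly by rejection: it tosses as many coins as the total weight has digits
and starts afresh if the resulting number is not below the total. Every attempt runs from the same
store, so the space stays bounded even though the number of attempts is not (`attempt_safeFor`).
Output probability and expected time come from one-step equations for a single attempt
(`outputProb_attempt`, `timeUpTo_attempt`). -/

theorem Val.one_le_size (x : Val) : 1 ≤ x.size := by
  cases x <;> simp [Val.size]

theorem Val.size_hd_le (x : Val) : x.hd.size ≤ x.size := by
  cases x <;> simp [Val.hd, Val.size]; omega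

theorem Val.size_tl_le (x : Val) : x.tl.size ≤ x.size := by
  cases x <;> simp [Val.tl, Val.size]; omega

/-- A run that does not depend on coin tosses, with stores of size at most `s` before its end. -/
inductive Path (s : ℕ) : Cfg → Cfg → Prop
  | refl (c : Cfg) : Path s c c
  | head {c c₁ c' : Cfg} : c.store.size ≤ s → (∀ b, step b c = c₁) → Path s c₁ c' → Path s c c'

theorem Path.trans {s : ℕ} {c₁ c₂ c₃ : Cfg} (h : Path s c₁ c₂) (h' : Path s c₂ c₃) :
    Path s c₁ c₃ := by
  induction h with
  | refl => exact h'
  | head a b _ ih => exact .head a b (ih h')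

theorem Path.mono {s t : ℕ} {c c' : Cfg} (h : Path s c c') (hst : s ≤ t) : Path t c c' := by
  induction h with
  | refl => exact .refl _
  | head a b _ ih => exact .head (a.trans hst) b ih

theorem Path.single {s : ℕ} {c c' : Cfg} (h : c.store.size ≤ s) (h' : ∀ b, step b c = c') :
    Path s c c' := .head h h' (.refl _)

theorem run_nil_ctrl (ω : List Bool) (y : Val) : run ω ⟨[], y⟩ = ⟨[], y⟩ := by
  induction ω with
  | nil => rfl
  | cons b ω ih => simpa [run, step] using ih

theorem run_append (ω ω' : List Bool) (c : Cfg) : run (ω ++ ω') c = run ω' (run ω c) := by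
  induction ω generalizing c with
  | nil => rfl
  | cons b ω ih => simpa [run] using ih _

theorem Path.exists_length {s : ℕ} {c c' : Cfg} (h : Path s c c') :
    ∃ t, ∀ ω : List Bool, ω.length = t → run ω c = c' := by
  induction h with
  | refl c => exact ⟨0, fun ω h => by rw [List.length_eq_zero_iff.1 h]; rfl⟩
  | head _ b _ ih =>
    obtain ⟨t, ht⟩ := ih
    refine ⟨t + 1, fun ω hω => ?_⟩
    match ω, hω with
    | d :: ω, hω => simpa [run, b d] using ht ω (by simpa using hω)

/-- A halted configuration is stationary, so runs of different lengths can be padded and compared.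
This identifies an arbitrary output of the scheme with the one found by simulation. -/
theorem Path.run_unique {s : ℕ} {c : Cfg} {y : Val} (h : Path s c ⟨[], y⟩) {ω : List Bool} {z : Val}
    (hz : run ω c = ⟨[], z⟩) : z = y := by
  obtain ⟨t, ht⟩ := h.exists_length
  have h1 : run (ω ++ List.replicate t false) c = ⟨[], z⟩ := by
    rw [run_append, hz, run_nil_ctrl]
  have h2 : run (List.take t (ω ++ List.replicate t false)
      ++ List.drop t (ω ++ List.replicate t false)) c = ⟨[], y⟩ := by
    rw [run_append, ht _ (by simp), run_nil_ctrl]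
  rw [List.take_append_drop, h1] at h2
  simpa using h2

/-- All stores in the first `t` steps from `c` have size at most `s`. -/
def SafeFor (s t : ℕ) (c : Cfg) : Prop :=
  ∀ ω : List Bool, ω.length ≤ t → (run ω c).store.size ≤ s

theorem SafeFor.mono {s t t' : ℕ} {c : Cfg} (h : SafeFor s t c) (ht : t' ≤ t) : SafeFor s t' c :=
  fun ω hω => h ω (hω.trans ht)

theorem SafeFor.halted {s t : ℕ} {y : Val} (h : y.size ≤ s) : SafeFor s t ⟨[], y⟩ :=
  fun ω _ => by rw [run_nil_ctrl]; exact h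

/-- Going back over an actual step gains one unit of t. This gain permits induction on t for a loop
that may run forever; for finite pieces of a run `SafeFor.step'` is enough. -/
theorem SafeFor.step {s t : ℕ} {c : Cfg} (h : c.store.size ≤ s) (hs : ∀ b, SafeFor s t (step b c)) :
    SafeFor s (t + 1) c := by
  intro ω hω
  match ω, hω with
  | [], _ => exact h
  | b :: ω, hω => exact hs b ω (by simpa using hω)

theorem SafeFor.step' {s t : ℕ} {c : Cfg} (h : c.store.size ≤ s)
    (hs : ∀ b, SafeFor s t (Improv.step b c)) : SafeFor s t c :=
  (SafeFor.step h hs).mono (Nat.le_succ t)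

theorem Path.safeFor {s t : ℕ} {c c' : Cfg} (h : Path s c c') (h' : SafeFor s t c') :
    SafeFor s t c := by
  induction h with
  | refl => exact h'
  | head a b _ ih => exact .step' a fun d => by rw [b d]; exact ih h'

theorem Path.outputs {s : ℕ} {P : Prog} {x y : Val} (h : Path s (init P x) ⟨[], y⟩) :
    Outputs P x y := by
  obtain ⟨t, ht⟩ := h.exists_length
  exact ⟨List.replicate t false, ht _ (by simp)⟩

theorem Path.spaceLE {s : ℕ} {P : Prog} {x y : Val} (h : Path s (init P x) ⟨[], y⟩)
    (hy : y.size ≤ s) : SpaceLE P x s := fun ω =>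
  h.safeFor (SafeFor.halted (t := ω.length) hy) ω le_rfl

/-! ### A combinator language -/

/-- Functional programs; `comp f g` is `f` after `g`, and `iter f` repeats `f` as long as the first
component of its argument is not `nil`. -/
inductive F : Type where
  | var : F
  | nil : F
  | cons : F → F → F
  | hd : F → F
  | tl : F → F
  | ite : F → F → F → F
  | comp : F → F → F
  | iter : F → F

/-- The compiled program acts on the first component of the store and keeps the second. -/
def F.toProg : F → Prog
  | .var => .assign .var
  | .nil => .assign (.cons .nil (.tl .var))
  | .cons f g =>
    .seq (.assign (.cons (.hd .var) .var)) (.seq f.toProg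
      (.seq (.assign (.cons (.hd (.tl .var)) (.cons (.hd .var) (.tl (.tl .var)))))
        (.seq g.toProg
          (.assign (.cons (.cons (.hd (.tl .var)) (.hd .var)) (.tl (.tl .var)))))))
  | .hd f => .seq f.toProg (.assign (.cons (.hd (.hd .var)) (.tl .var)))
  | .tl f => .seq f.toProg (.assign (.cons (.tl (.hd .var)) (.tl .var)))
  | .ite c f g =>
    .seq (.assign (.cons (.hd .var) .var)) (.seq c.toProg
      (.cond (.hd .var) (.seq (.assign (.tl .var)) f.toProg) (.seq (.assign (.tl .var)) g.toProg)))
  | .comp f g => .seq g.toProg f.toProg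
  | .iter f => .loop (.hd (.hd .var)) f.toProg

theorem F.deterministic_toProg (f : F) : f.toProg.Deterministic := by
  induction f <;> simp_all [F.toProg, Prog.Deterministic]

/-- `Ev f x y s`: the program `f` maps `x` to `y` in space `s`. -/
inductive Ev : F → Val → Val → ℕ → Prop
  | var {x : Val} {s : ℕ} : x.size ≤ s → Ev .var x x s
  | nil {x : Val} {s : ℕ} : x.size ≤ s → Ev .nil x .nil s
  | cons {f g : F} {x a b : Val} {s t u : ℕ} : Ev f x a s → Ev g x b t → s + t + x.size + 1 ≤ u →
      Ev (.cons f g) x (.cons a b) u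
  | hd {f : F} {x a : Val} {s : ℕ} : Ev f x a s → Ev (.hd f) x a.hd s
  | tl {f : F} {x a : Val} {s : ℕ} : Ev f x a s → Ev (.tl f) x a.tl s
  | ite_true {c f g : F} {x a y : Val} {s t u : ℕ} : Ev c x a s → a ≠ .nil → Ev f x y t →
      s + t + x.size + 1 ≤ u → Ev (.ite c f g) x y u
  | ite_false {c f g : F} {x y : Val} {s t u : ℕ} : Ev c x .nil s → Ev g x y t →
      s + t + x.size + 1 ≤ u → Ev (.ite c f g) x y u
  | comp {f g : F} {x y z : Val} {s t u : ℕ} : Ev g x y s → Ev f y z t → s ≤ u → t ≤ u →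
      Ev (.comp f g) x z u
  | iter_done {f : F} {x : Val} {s : ℕ} : x.hd = .nil → x.size ≤ s → Ev (.iter f) x x s
  | iter_step {f : F} {x y z : Val} {s t u : ℕ} : x.hd ≠ .nil → Ev f x y s → Ev (.iter f) y z t →
      s ≤ u → t ≤ u → Ev (.iter f) x z u

theorem Ev.mono {f : F} {x y : Val} {s t : ℕ} (h : Ev f x y s) (hst : s ≤ t) : Ev f x y t := by
  induction h generalizing t with
  | var h => exact .var (h.trans hst)
  | nil h => exact .nil (h.trans hst)
  | cons h₁ h₂ h => exact .cons h₁ h₂ (h.trans hst)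
  | hd _ ih => exact .hd (ih hst)
  | tl _ ih => exact .tl (ih hst)
  | ite_true h₁ h₂ h₃ h => exact .ite_true h₁ h₂ h₃ (h.trans hst)
  | ite_false h₁ h₃ h => exact .ite_false h₁ h₃ (h.trans hst)
  | comp h₁ h₂ h₃ h₄ => exact .comp h₁ h₂ (h₃.trans hst) (h₄.trans hst)
  | iter_done h₁ h => exact .iter_done h₁ (h.trans hst)
  | iter_step h h₁ h₂ h₃ h₄ => exact .iter_step h h₁ h₂ (h₃.trans hst) (h₄.trans hst)

theorem Ev.size_le {f : F} {x y : Val} {s : ℕ} (h : Ev f x y s) : x.size ≤ s ∧ y.size ≤ s := by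
  induction h with
  | var h => exact ⟨h, h⟩
  | @nil x s h => exact ⟨h, x.one_le_size.trans h⟩
  | cons => simp only [Val.size]; omega
  | @hd f x a s h ih => exact ⟨ih.1, a.size_hd_le.trans ih.2⟩
  | @tl f x a s h ih => exact ⟨ih.1, a.size_tl_le.trans ih.2⟩
  | iter_done => omega
  | _ => omega

/-- The second component of the store is a stack. The compiled `cons` and `ite` park the argument or
the first result there while a part is running, and the sums in their `Ev` rules pay for that.
Composition and iteration park nothing, so a maximum suffices for them. -/
theorem Ev.path {f : F} {x y : Val} {s : ℕ} (h : Ev f x y s) (r : Val) (K : List Prog) :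
    Path (s + r.size + 1) ⟨f.toProg :: K, .cons x r⟩ ⟨K, .cons y r⟩ := by
  induction h generalizing r K with
  | var h => exact .single (by simp only [Val.size]; omega) fun b => rfl
  | nil h => exact .single (by simp only [Val.size]; omega) fun b => rfl
  | @cons f g x a b s t u h₁ h₂ h ih₁ ih₂ =>
    have e₁ := h₁.size_le
    have e₂ := h₂.size_le
    have p₁ := (ih₁ (.cons x r) ((.seq (.assign (.cons (.hd (.tl .var)) (.cons (.hd .var)
      (.tl (.tl .var))))) (.seq g.toProg
          (.assign (.cons (.cons (.hd (.tl .var)) (.hd .var)) (.tl (.tl .var))))))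
            :: K)).mono (t := u + r.size + 1) (by simp only [Val.size]; omega)
    have p₂ := (ih₂ (.cons a r) ((.assign (.cons (.cons (.hd (.tl .var)) (.hd .var))
      (.tl (.tl .var)))) :: K)).mono (t := u + r.size + 1) (by simp only [Val.size]; omega)
    refine .head (by simp only [Val.size]; omega) (fun _ => rfl) ?_
    refine .head (by simp only [Val.size]; omega) (fun _ => rfl) ?_
    refine .head (by simp only [Expr.eval, Val.hd, Val.size]; omega) (fun _ => rfl) ?_
    refine p₁.trans ?_
    refine .head (by simp only [Val.size]; omega) (fun _ => rfl) ?_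
    refine .head (by simp only [Val.size]; omega) (fun _ => rfl) ?_
    refine .head (by simp only [Expr.eval, Val.hd, Val.tl, Val.size]; omega) (fun _ => rfl) ?_
    refine p₂.trans ?_
    exact .single (by simp only [Val.size]; omega) (fun _ => rfl)
  | @hd f x a s h ih =>
    have e := h.size_le
    refine .head (by simp only [Val.size]; omega) (fun _ => rfl) ((ih r _).trans ?_)
    exact .single (by simp only [Val.size]; omega) (fun _ => rfl)
  | @tl f x a s h ih =>
    have e := h.size_le
    refine .head (by simp only [Val.size]; omega) (fun _ => rfl) ((ih r _).trans ?_)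
    exact .single (by simp only [Val.size]; omega) (fun _ => rfl)
  | @ite_true c f g x a y s t u h₁ ha h₂ h ih₁ ih₂ =>
    have e₁ := h₁.size_le
    have e₂ := h₂.size_le
    refine .head (by simp only [Val.size]; omega) (fun _ => rfl) ?_
    refine .head (by simp only [Val.size]; omega) (fun _ => rfl) ?_
    refine .head (by simp only [Expr.eval, Val.hd, Val.size]; omega) (fun _ => rfl) ?_
    refine ((ih₁ (.cons x r) _).mono (by simp only [Val.size]; omega)).trans ?_
    cases a with
    | nil => exact absurd rfl ha
    | cons a₁ a₂ =>
      refine .head (by simp only [Val.size] at *; omega) (fun _ => rfl) ?_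
      refine .head (by simp only [Val.size] at *; omega) (fun _ => rfl) ?_
      refine .head (by simp only [Val.size] at *; omega) (fun _ => rfl) ?_
      exact (ih₂ r K).mono (by omega)
  | @ite_false c f g x y s t u h₁ h₂ h ih₁ ih₂ =>
    have e₁ := h₁.size_le
    have e₂ := h₂.size_le
    refine .head (by simp only [Val.size]; omega) (fun _ => rfl) ?_
    refine .head (by simp only [Val.size]; omega) (fun _ => rfl) ?_
    refine .head (by simp only [Expr.eval, Val.hd, Val.size]; omega) (fun _ => rfl) ?_
    refine ((ih₁ (.cons x r) _).mono (by simp only [Val.size]; omega)).trans ?_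
    refine .head (by simp only [Val.size] at *; omega) (fun _ => rfl) ?_
    refine .head (by simp only [Val.size] at *; omega) (fun _ => rfl) ?_
    refine .head (by simp only [Val.size] at *; omega) (fun _ => rfl) ?_
    exact (ih₂ r K).mono (by omega)
  | @comp f g x y z s t u h₁ h₂ h₃ h₄ ih₁ ih₂ =>
    have e₁ := h₁.size_le
    refine .head (by simp only [Val.size]; omega) (fun _ => rfl) ?_
    exact ((ih₁ r _).mono (by omega)).trans ((ih₂ r K).mono (by omega))
  | @iter_done f x s h h' =>
    refine .single (by simp only [Val.size]; omega) (fun _ => ?_)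
    simp [F.toProg, step, Expr.eval, Val.hd] at h ⊢
    rw [h]
  | @iter_step f x y z s t u h h₁ h₂ h₃ h₄ ih₁ ih₂ =>
    have e₁ := h₁.size_le
    have key : ∀ b, step b ⟨(F.iter f).toProg :: K, .cons x r⟩ =
        ⟨f.toProg :: (F.iter f).toProg :: K, .cons x r⟩ := by
      intro b
      cases hx : x.hd with
      | nil => exact absurd hx h
      | cons a₁ a₂ => simp [F.toProg, step, Expr.eval, Val.hd] at hx ⊢; rw [hx]
    refine .head (by simp only [Val.size]; omega) key ?_
    exact ((ih₁ r _).mono (by omega)).trans ((ih₂ r K).mono (by omega))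

/-! ### Loop-free programs -/

/-- The value of a program without `iter`. -/
def F.eval : F → Val → Val
  | .var, x => x
  | .nil, _ => .nil
  | .cons f g, x => .cons (f.eval x) (g.eval x)
  | .hd f, x => (f.eval x).hd
  | .tl f, x => (f.eval x).tl
  | .ite c f g, x => match c.eval x with
    | .nil => g.eval x
    | .cons _ _ => f.eval x
  | .comp f g, x => f.eval (g.eval x)
  | .iter _, x => x

/-- There is no `iter` in the program. -/
def F.loopFree : F → Bool
  | .var => true
  | .nil => true
  | .cons f g => f.loopFree && g.loopFree
  | .hd f => f.loopFree
  | .tl f => f.loopFree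
  | .ite c f g => c.loopFree && f.loopFree && g.loopFree
  | .comp f g => f.loopFree && g.loopFree
  | .iter _ => false

/-- The factor by which the space used by a loop-free program exceeds the size of its argument. -/
def F.cost : F → ℕ
  | .var => 1
  | .nil => 1
  | .cons f g => f.cost + g.cost + 2
  | .hd f => f.cost
  | .tl f => f.cost
  | .ite c f g => c.cost + f.cost + g.cost + 2
  | .comp f g => g.cost + f.cost * g.cost
  | .iter _ => 1

/-- Without iteration, sizes grow at most by a constant factor. In a composition the factors
multiply, because the inner value may already be `g.cost` times as large as the argument. -/
theorem Ev.of_loopFree {f : F} (hf : f.loopFree = true) (x : Val) :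
    Ev f x (f.eval x) (f.cost * x.size) := by
  induction f generalizing x with
  | var => exact .var (by simp [F.cost])
  | nil => exact .nil (by simp [F.cost])
  | cons f g ihf ihg =>
    simp only [F.loopFree, Bool.and_eq_true] at hf
    have := x.one_le_size
    refine .cons (ihf hf.1 x) (ihg hf.2 x) ?_
    simp only [F.cost]; nlinarith
  | hd f ih => exact .hd (ih hf x)
  | tl f ih => exact .tl (ih hf x)
  | ite c f g ihc ihf ihg =>
    simp only [F.loopFree, Bool.and_eq_true] at hf
    have := x.one_le_size
    have hc := ihc hf.1.1 x
    simp only [F.eval]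
    cases h : c.eval x with
    | nil =>
      rw [h] at hc
      refine .ite_false hc (ihg hf.2 x) ?_
      simp only [F.cost]; nlinarith
    | cons a b =>
      refine .ite_true hc (by simp [h]) (ihf hf.1.2 x) ?_
      simp only [F.cost]; nlinarith
  | comp f g ihf ihg =>
    simp only [F.loopFree, Bool.and_eq_true] at hf
    have h := (ihg hf.2 x).size_le.2
    have := x.one_le_size
    refine .comp (ihg hf.2 x) (ihf hf.1 _) ?_ ?_
    · simp only [F.cost]; nlinarith
    · calc f.cost * (g.eval x).size ≤ f.cost * (g.cost * x.size) := Nat.mul_le_mul_left _ h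
        _ ≤ _ := by simp only [F.cost]; nlinarith
  | iter f => simp [F.loopFree] at hf

/-- `bind g a k` evaluates `g` on `a` and puts the result in front of the argument for `k`. -/
def F.bind (g a k : F) : F := .comp k (.cons (.comp g a) .var)

/-- Since the argument stays behind the new result, a chain of `F.bind` builds a list of
intermediate results that later stages address by position. -/
theorem Ev.bind {g a k : F} {x v y : Val} {s t : ℕ} (ha : a.loopFree = true)
    (hg : Ev g (a.eval x) v s) (hk : Ev k (.cons v x) y t) :
    Ev (F.bind g a k) x y (s + t + (a.cost + 2) * x.size + 1) := by
  have h := x.one_le_size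
  refine .comp (.cons (u := s + (a.cost + 2) * x.size + 1)
    (.comp (u := s + a.cost * x.size) (Ev.of_loopFree ha x) hg (by omega) (by omega))
    (.var le_rfl) ?_) hk ?_ ?_
  · nlinarith
  · omega
  · omega


/-! ### Binary recursion -/

/-- The datum standing for truth. -/
abbrev Val.one : Val := .cons .nil .nil

/-- The constant program with value `Val.one`. -/
abbrev F.one : F := .cons .nil .nil

/-- One step of the stack machine for `F.recur`.  The argument is a list of tasks and a list of
values; a task is either to evaluate an argument, or to combine the two topmost values. -/
def F.recBody (base b l r comb : F) : F :=
  .ite (.hd (.hd (.hd .var)))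
    (.cons (.tl (.hd .var)) (.cons (.comp comb (.cons (.tl (.hd (.hd .var)))
      (.cons (.hd (.tl (.tl .var))) (.hd (.tl .var))))) (.tl (.tl (.tl .var)))))
    (.ite (.comp base (.tl (.hd (.hd .var))))
      (.cons (.tl (.hd .var)) (.cons (.comp b (.tl (.hd (.hd .var)))) (.tl .var)))
      (.cons (.cons (.cons .nil (.comp l (.tl (.hd (.hd .var)))))
        (.cons (.cons .nil (.comp r (.tl (.hd (.hd .var)))))
          (.cons (.cons .one (.tl (.hd (.hd .var)))) (.tl (.hd .var))))) (.tl .var)))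

/-- The recursive function `D` with `D x = b x` if `base x ≠ nil`, and
`D x = comb (x, (D (l x), D (r x)))` otherwise. -/
def F.recur (base b l r comb : F) : F :=
  .hd (.tl (.comp (.iter (F.recBody base b l r comb))
    (.cons (.cons (.cons .nil .var) .nil) .nil)))

/-- The recursion of `F.recur` from `x` has depth at most `d` and value `v`, and the functions it
calls use space at most `s`. -/
inductive RecTree (base b l r comb : F) (s : ℕ) : ℕ → Val → Val → Prop
  | leaf {d : ℕ} {x v : Val} : base.eval x ≠ .nil → Ev b x v s → RecTree base b l r comb s d x v
  | node {d : ℕ} {x vl vr v : Val} : base.eval x = .nil →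
      RecTree base b l r comb s d (l.eval x) vl → RecTree base b l r comb s d (r.eval x) vr →
      Ev comb (.cons x (.cons vl vr)) v s → RecTree base b l r comb s (d + 1) x v

variable {base b l r comb : F}

theorem RecTree.size_le {s d : ℕ} {x v : Val} (h : RecTree base b l r comb s d x v) :
    x.size ≤ s ∧ v.size ≤ s := by
  cases h with
  | leaf _ h => exact h.size_le
  | node _ _ _ h => have := h.size_le; simp only [Val.size] at this; omega

theorem RecTree.mono {s s' d d' : ℕ} {x v : Val} (h : RecTree base b l r comb s d x v)
    (hs : s ≤ s') (hd : d ≤ d') : RecTree base b l r comb s' d' x v := by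
  induction h generalizing d' with
  | leaf h₁ h₂ => exact .leaf h₁ (h₂.mono hs)
  | node h₁ _ _ h₂ ih₁ ih₂ =>
    obtain ⟨e, rfl⟩ : ∃ e, d' = e + 1 := ⟨d' - 1, by omega⟩
    exact .node h₁ (ih₁ (by omega)) (ih₂ (by omega)) (h₂.mono hs)

/-- The space factor of `F.recur`. -/
def recCost (base l r : F) : ℕ := base.cost + l.cost + r.cost + 50

theorem Ev.recBody_comb {x vl vr v T V : Val} {s : ℕ}
    (h : Ev comb (.cons x (.cons vl vr)) v s) :
    Ev (F.recBody base b l r comb) (.cons (.cons (.cons .one x) T) (.cons vr (.cons vl V)))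
      (.cons T (.cons v V))
      (s + recCost base l r * (Val.cons (.cons (.cons .one x) T) (.cons vr (.cons vl V))).size) := by
  have h1 := h.size_le.2
  generalize hst : Val.cons (.cons (.cons .one x) T) (.cons vr (.cons vl V)) = st
  have e₀ := Ev.of_loopFree (f := .hd (.hd (.hd .var))) rfl st
  have e₁ := Ev.of_loopFree (f := .tl (.hd .var)) rfl st
  have e₂ := Ev.of_loopFree (f := .cons (.tl (.hd (.hd .var)))
      (.cons (.hd (.tl (.tl .var))) (.hd (.tl .var)))) rfl st
  have e₃ := Ev.of_loopFree (f := .tl (.tl (.tl .var))) rfl st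
  have hp := st.one_le_size
  subst hst
  refine .ite_true e₀ (by simp [F.eval, Val.hd]) (.cons e₁ (.cons (.comp e₂ h
    (Nat.le_add_left _ s) (Nat.le_add_right _ _)) e₃ le_rfl) le_rfl) ?_
  simp only [F.cost, recCost] at *
  nlinarith

theorem Ev.recBody_leaf {x v T V : Val} {s : ℕ} (hb : base.loopFree = true)
    (hx : base.eval x ≠ .nil) (h : Ev b x v s) :
    Ev (F.recBody base b l r comb) (.cons (.cons (.cons .nil x) T) V) (.cons T (.cons v V))
      (s + recCost base l r * (Val.cons (.cons (.cons .nil x) T) V).size) := by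
  have h1 := h.size_le.2
  generalize hst : Val.cons (.cons (.cons .nil x) T) V = st
  have e₀ := Ev.of_loopFree (f := .hd (.hd (.hd .var))) rfl st
  have e₁ := Ev.of_loopFree (f := .comp base (.tl (.hd (.hd .var))))
    (by simp [F.loopFree, hb]) st
  have e₂ := Ev.of_loopFree (f := .tl (.hd .var)) rfl st
  have e₃ := Ev.of_loopFree (f := .tl (.hd (.hd .var))) rfl st
  have e₄ := Ev.of_loopFree (f := .tl .var) rfl st
  have hp := st.one_le_size
  subst hst
  refine .ite_false e₀ (.ite_true e₁ hx (.cons e₂ (.cons (.comp e₃ h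
    (Nat.le_add_left _ s) (Nat.le_add_right _ _)) e₄ le_rfl) le_rfl) le_rfl) ?_
  simp only [F.cost, recCost] at *
  nlinarith

theorem Ev.recBody_node {x T V : Val} (hb : base.loopFree = true) (hl : l.loopFree = true)
    (hr : r.loopFree = true) (hx : base.eval x = .nil) :
    Ev (F.recBody base b l r comb) (.cons (.cons (.cons .nil x) T) V)
      (.cons (.cons (.cons .nil (l.eval x)) (.cons (.cons .nil (r.eval x))
        (.cons (.cons .one x) T))) V)
      (recCost base l r * (Val.cons (.cons (.cons .nil x) T) V).size) := by
  generalize hst : Val.cons (.cons (.cons .nil x) T) V = st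
  have e₀ := Ev.of_loopFree (f := .hd (.hd (.hd .var))) rfl st
  have e₁ := Ev.of_loopFree (f := .comp base (.tl (.hd (.hd .var))))
    (by simp [F.loopFree, hb]) st
  have e₂ := Ev.of_loopFree (f := (.cons (.cons (.cons .nil (.comp l (.tl (.hd (.hd .var)))))
        (.cons (.cons .nil (.comp r (.tl (.hd (.hd .var)))))
          (.cons (.cons .one (.tl (.hd (.hd .var)))) (.tl (.hd .var))))) (.tl .var)))
    (by simp [F.loopFree, hl, hr]) st
  have hp := st.one_le_size
  subst hst
  simp only [F.eval, Val.hd, Val.tl] at e₁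
  rw [hx] at e₁
  refine .ite_false e₀ (.ite_false e₁ e₂ le_rfl) ?_
  simp only [F.cost, recCost] at *
  nlinarith

/-- Depth-first exploration keeps only boundedly many tasks and values of size at most s per level
on the two stacks; `16 * (d + 1) * s` covers them with slack. The continuation `hy` is an arbitrary
finished run, so that the runs for the two subtasks and for their combination can be chained. -/
theorem RecTree.ev_iter {s d : ℕ} {x v : Val} (h : RecTree base b l r comb s d x v)
    (hb : base.loopFree = true) (hl : l.loopFree = true) (hr : r.loopFree = true)
    {T V y : Val} {u : ℕ}
    (hu : (recCost base l r + 1) * (T.size + V.size + 16 * (d + 1) * s) ≤ u)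
    (hy : Ev (.iter (F.recBody base b l r comb)) (.cons T (.cons v V)) y u) :
    Ev (.iter (F.recBody base b l r comb)) (.cons (.cons (.cons .nil x) T) V) y u := by
  induction h generalizing T V with
  | @leaf d x v h₁ h₂ =>
    refine .iter_step (by simp [Val.hd]) (h₂.recBody_leaf hb h₁) hy ?_ le_rfl
    refine le_trans ?_ hu
    have e := h₂.size_le
    have := x.one_le_size
    have hle : (Val.cons (.cons (.cons .nil x) T) V).size ≤ T.size + V.size + 16 * (d + 1) * s := by
      simp only [Val.size]; nlinarith
    have hle2 : s ≤ T.size + V.size + 16 * (d + 1) * s := by nlinarith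
    nlinarith
  | @node d x vl vr v h₁ t₁ t₂ h₂ ih₁ ih₂ =>
    have e := h₂.size_le
    have e₁ := t₁.size_le
    have e₂ := t₂.size_le
    have := x.one_le_size
    have hs : (x.size + vl.size + vr.size) ≤ s := by simp only [Val.size] at e; omega
    have hle : (Val.cons (.cons (.cons .nil x) T) V).size
        ≤ T.size + V.size + 16 * (d + 1 + 1) * s := by
      simp only [Val.size]; nlinarith
    have hle2 : s ≤ T.size + V.size + 16 * (d + 1 + 1) * s := by nlinarith
    refine .iter_step (by simp [Val.hd]) (Ev.recBody_node hb hl hr h₁) ?_ ?_ le_rfl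
    -- The left task continues with the right one, which continues with the combination. By then
    -- `vr` lies on top of `vl`.
    · refine ih₁ (le_trans (Nat.mul_le_mul_left _ ?_) hu) (ih₂ (le_trans (Nat.mul_le_mul_left _ ?_)
        hu) (.iter_step (by simp [Val.hd]) h₂.recBody_comb hy ?_ le_rfl))
      · simp only [Val.size]; nlinarith
      · simp only [Val.size]; nlinarith
      · refine le_trans ?_ hu
        have hle3 : (Val.cons (.cons (.cons .one x) T) (.cons vr (.cons vl V))).size
            ≤ T.size + V.size + 16 * (d + 1 + 1) * s := by
          simp only [Val.size]; nlinarith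
        nlinarith
    · refine le_trans ?_ hu
      nlinarith

/-- The source of all polynomial space bounds for game values: the cost is proportional to depth
times the space of one call, whatever the number of nodes of the tree. -/
theorem RecTree.ev {s d : ℕ} {x v : Val} (h : RecTree base b l r comb s d x v)
    (hb : base.loopFree = true) (hl : l.loopFree = true) (hr : r.loopFree = true) :
    Ev (F.recur base b l r comb) x v (18 * (recCost base l r + 1) * ((d + 1) * s)) := by
  have e := h.size_le
  have := x.one_le_size
  have := v.one_le_size
  have e₁ := Ev.of_loopFree (f := (.cons (.cons (.cons .nil .var) .nil) .nil)) rfl x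
  have hs : s ≤ (d + 1) * s := by nlinarith
  have hq : 18 * (50 + 1) * s ≤ 18 * (recCost base l r + 1) * ((d + 1) * s) :=
    Nat.mul_le_mul (Nat.mul_le_mul_left _ (by simp only [recCost]; omega)) hs
  refine .hd (.tl (.comp e₁ (h.ev_iter hb hl hr ?_ (.iter_done rfl ?_)) ?_ le_rfl))
  · simp only [F.eval, Val.size]
    rw [mul_comm 18, mul_assoc _ 18, mul_assoc 16]
    refine Nat.mul_le_mul_left _ ?_
    generalize (d + 1) * s = m at *
    omega
  · simp only [F.eval, Val.size]; omega
  · simp only [F.cost]; omega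


/-! ### Polynomially bounded space -/

/-- `g` is a polynomial function. -/
@[fun_prop]
def PB (g : ℕ → ℕ) : Prop := ∃ p : Polynomial ℕ, ∀ n, p.eval n = g n

@[fun_prop] theorem PB.id : PB (fun n => n) := ⟨.X, by simp⟩
@[fun_prop] theorem PB.const (c : ℕ) : PB (fun _ => c) := ⟨.C c, by simp⟩
@[fun_prop] theorem PB.comp {f g : ℕ → ℕ} (hf : PB f) (hg : PB g) : PB (fun n => f (g n)) := by
  obtain ⟨p, hp⟩ := hf
  obtain ⟨q, hq⟩ := hg
  exact ⟨p.comp q, by simp [Polynomial.eval_comp, hp, hq]⟩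
@[fun_prop] theorem PB.add {f g : ℕ → ℕ} (hf : PB f) (hg : PB g) : PB (fun n => f n + g n) := by
  obtain ⟨p, hp⟩ := hf
  obtain ⟨q, hq⟩ := hg
  exact ⟨p + q, by simp [hp, hq]⟩
@[fun_prop] theorem PB.mul {f g : ℕ → ℕ} (hf : PB f) (hg : PB g) : PB (fun n => f n * g n) := by
  obtain ⟨p, hp⟩ := hf
  obtain ⟨q, hq⟩ := hg
  exact ⟨p * q, by simp [hp, hq]⟩

theorem Polynomial.eval_mono_nat (p : Polynomial ℕ) {a b : ℕ} (h : a ≤ b) :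
    p.eval a ≤ p.eval b := by
  rw [Polynomial.eval_eq_sum_range, Polynomial.eval_eq_sum_range]
  exact Finset.sum_le_sum fun i _ => Nat.mul_le_mul_left _ (Nat.pow_le_pow_left h i)

/-- Natural coefficients force monotonicity. This uses that `PB` asks for equality with a polynomial
and not only for an upper bound. -/
theorem PB.mono {f : ℕ → ℕ} (hf : PB f) {a b : ℕ} (h : a ≤ b) : f a ≤ f b := by
  obtain ⟨p, hp⟩ := hf
  rw [← hp, ← hp]
  exact Polynomial.eval_mono_nat p h

/-! ### Binary numbers -/

/-- `1` for a datum that stands for truth, `0` for `nil`. -/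
def Val.truth : Val → ℕ
  | .nil => 0
  | .cons _ _ => 1

/-- The number with the given list of binary digits, least significant digit first. -/
def Val.bval : Val → ℕ
  | .nil => 0
  | .cons b t => b.truth + 2 * t.bval

/-- A datum that is a bit. -/
def Val.IsBit (b : Val) : Prop := b = .nil ∨ b = .one

/-- Lists of at most `L` bits. -/
def Val.IsBin : ℕ → Val → Prop
  | _, .nil => True
  | 0, .cons _ _ => False
  | L + 1, .cons b t => b.IsBit ∧ t.IsBin L

theorem Val.IsBin.nil (L : ℕ) : Val.IsBin L .nil := by cases L <;> trivial

theorem Val.IsBin.eq_nil {a : Val} (h : a.IsBin 0) : a = .nil := by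
  cases a with
  | nil => rfl
  | cons => exact h.elim

theorem Val.IsBit.size_le {b : Val} (h : b.IsBit) : b.size ≤ 3 := by
  rcases h with rfl | rfl <;> simp [Val.size]

theorem Val.IsBit.nil : Val.IsBit .nil := Or.inl rfl

theorem Val.IsBin.size_le {L : ℕ} {a : Val} (h : a.IsBin L) : a.size ≤ 4 * L + 1 := by
  induction L generalizing a with
  | zero => rw [h.eq_nil]; simp [Val.size]
  | succ L ih =>
    cases a with
    | nil => simp [Val.size]
    | cons b t => have := ih h.2; have := h.1.size_le; simp only [Val.size]; omega

theorem Val.IsBin.mono {L L' : ℕ} {a : Val} (h : a.IsBin L) (hL : L ≤ L') : a.IsBin L' := by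
  induction L' generalizing a L with
  | zero => obtain rfl : L = 0 := by omega
            exact h
  | succ L' ih =>
    cases a with
    | nil => trivial
    | cons b t =>
      cases L with
      | zero => exact h.elim
      | succ L => exact ⟨h.1, ih h.2 (by omega)⟩

theorem Val.IsBin.tl {L : ℕ} {a : Val} (h : a.IsBin (L + 1)) : a.tl.IsBin L := by
  cases a with
  | nil => exact .nil L
  | cons b t => exact h.2

theorem Val.IsBin.hd {L : ℕ} {a : Val} (h : a.IsBin L) : a.hd.IsBit := by
  cases a with
  | nil => exact .nil
  | cons b t => cases L with
    | zero => exact h.elim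
    | succ L => exact h.1

theorem Val.bval_eq (a : Val) : a.bval = a.hd.truth + 2 * a.tl.bval := by
  cases a <;> simp [Val.bval, Val.hd, Val.tl, Val.truth]

theorem Val.IsBin.bval_lt {L : ℕ} {a : Val} (h : a.IsBin L) : a.bval < 2 ^ L := by
  induction L generalizing a with
  | zero => rw [h.eq_nil]; simp [Val.bval]
  | succ L ih =>
    have h1 := ih h.tl
    have h2 : a.hd.truth ≤ 1 := by cases a.hd <;> simp [Val.truth]
    rw [Val.bval_eq, pow_succ]
    omega

/-- Addition with carry: on `(c, (a, b))` the sum of the bit `c` and the binary numbers `a`, `b`. -/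
def F.addBase : F := .ite (.hd (.tl .var)) .nil (.ite (.tl (.tl .var)) .nil .one)

/-- The sum digit. -/
def F.addSum : F :=
  .ite (.hd .var)
    (.ite (.hd (.hd (.tl .var))) (.hd (.tl (.tl .var))) (.ite (.hd (.tl (.tl .var))) .nil .one))
    (.ite (.hd (.hd (.tl .var))) (.ite (.hd (.tl (.tl .var))) .nil .one) (.hd (.tl (.tl .var))))

/-- The new carry. -/
def F.addCarry : F :=
  .ite (.hd .var) (.ite (.hd (.hd (.tl .var))) .one (.hd (.tl (.tl .var))))
    (.ite (.hd (.hd (.tl .var))) (.hd (.tl (.tl .var))) .nil)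

/-- The recursive argument of addition. -/
def F.addRec : F :=
  .cons F.addCarry (.cons (.tl (.hd (.tl .var))) (.tl (.tl (.tl .var))))

/-- The program for addition with carry. -/
def F.add : F :=
  .recur F.addBase (.cons (.hd .var) .nil) .nil F.addRec
    (.cons (.comp F.addSum (.hd .var)) (.tl (.tl .var)))

theorem add_digits {c a b : Val} (hc : c.IsBit) (ha : a.hd.IsBit) (hb : b.hd.IsBit) :
    (F.addSum.eval (.cons c (.cons a b))).IsBit ∧ (F.addCarry.eval (.cons c (.cons a b))).IsBit ∧
    (F.addSum.eval (.cons c (.cons a b))).truth + 2 * (F.addCarry.eval (.cons c (.cons a b))).truth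
      = c.truth + a.hd.truth + b.hd.truth := by
  rcases hc with rfl | rfl <;> rcases ha with h₁ | h₁ <;> rcases hb with h₂ | h₂ <;>
  simp [F.addSum, F.addCarry, F.eval, Val.hd, Val.tl, Val.truth, Val.IsBit] <;>
  simp [Val.hd] at h₁ h₂ <;> simp [h₁, h₂]

/-- Digitwise addition recurses once only. The left branch of the binary scheme is sent to `nil`,
which is a leaf, and its value is ignored. Digit lists are not normalized, so the length bound
always grows by one. -/
theorem add_tree {S : ℕ} (L : ℕ) {c a b : Val} (hc : c.IsBit) (ha : a.IsBin L) (hb : b.IsBin L)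
    (hS : 1000 * (L + 1) ≤ S) :
    ∃ v, RecTree F.addBase (.cons (.hd .var) .nil) .nil F.addRec
      (.cons (.comp F.addSum (.hd .var)) (.tl (.tl .var))) S L (.cons c (.cons a b)) v ∧
      v.IsBin (L + 1) ∧ v.bval = c.truth + a.bval + b.bval := by
  induction L generalizing c a b with
  | zero =>
    rw [ha.eq_nil, hb.eq_nil]
    refine ⟨.cons c .nil, .leaf (by simp [F.addBase, F.eval, Val.hd, Val.tl])
      ((Ev.of_loopFree rfl _).mono ?_), ⟨hc, .nil _⟩, by simp [Val.bval]⟩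
    have hsc := hc.size_le
    simp only [F.cost, Val.size]
    omega
  | succ L ih =>
    have hsa := ha.size_le
    have hsb := hb.size_le
    have hsc := hc.size_le
    by_cases h0 : F.addBase.eval (.cons c (.cons a b)) = .nil
    · obtain ⟨d₁, d₂, d₃⟩ := add_digits hc ha.hd hb.hd
      obtain ⟨v, hv, hvL, hval⟩ := ih d₂ ha.tl hb.tl (by omega)
      have hvs := hvL.size_le
      refine ⟨.cons (F.addSum.eval (.cons c (.cons a b))) v, .node (vl := .cons .nil .nil) h0
        (.leaf (by simp [F.addBase, F.eval, Val.hd, Val.tl])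
          ((Ev.of_loopFree rfl _).mono ?_)) hv ((Ev.of_loopFree rfl _).mono ?_),
        ⟨d₁, hvL⟩, ?_⟩
      · simp only [F.eval, F.cost, Val.size]
        omega
      · simp only [F.cost, F.addSum, Val.size]
        omega
      · rw [a.bval_eq, b.bval_eq, Val.bval, hval]
        omega
    · obtain ⟨rfl, rfl⟩ : a = .nil ∧ b = .nil := by
        cases a <;> cases b <;> simp [F.addBase, F.eval, Val.hd, Val.tl] at h0 ⊢
      refine ⟨.cons c .nil, .leaf h0 ((Ev.of_loopFree rfl _).mono ?_), ⟨hc, .nil _⟩,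
        by simp [Val.bval]⟩
      simp only [F.cost, Val.size]
      omega

theorem add_ev : ∃ s, PB s ∧ ∀ (L : ℕ) (a b : Val), a.IsBin L → b.IsBin L →
    ∃ v, Ev F.add (.cons .nil (.cons a b)) v (s L) ∧ v.IsBin (L + 1) ∧
      v.bval = a.bval + b.bval := by
  refine ⟨fun L => 18 * (recCost F.addBase .nil F.addRec + 1) * ((L + 1) * (1000 * (L + 1))),
    by fun_prop, fun L a b ha hb => ?_⟩
  obtain ⟨v, hv, h⟩ := add_tree L .nil ha hb le_rfl
  exact ⟨v, hv.ev rfl rfl rfl, by simpa [Val.truth] using h⟩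

/-! ### Subtraction, comparison and multiplication of binary numbers -/

/-- The difference digit. -/
def F.subDigit : F := F.addSum

/-- The new borrow. -/
def F.subBorrow : F :=
  .ite (.hd .var) (.ite (.hd (.hd (.tl .var))) (.hd (.tl (.tl .var))) .one)
    (.ite (.hd (.hd (.tl .var))) .nil (.hd (.tl (.tl .var))))

/-- The recursive argument of subtraction. -/
def F.subRec : F :=
  .cons F.subBorrow (.cons (.tl (.hd (.tl .var))) (.tl (.tl (.tl .var))))

/-- The combination function of subtraction. -/
def F.subComb : F :=
  .cons (.hd (.tl (.tl .var))) (.cons (.comp F.subDigit (.hd .var)) (.tl (.tl (.tl .var))))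

/-- Subtraction with borrow: on `(c, (a, b))` the final borrow, and the difference `a - b - c`. -/
def F.sub : F := .recur F.addBase (.cons (.hd .var) .nil) .nil F.subRec F.subComb

theorem sub_digits {c a b : Val} (hc : c.IsBit) (ha : a.hd.IsBit) (hb : b.hd.IsBit) :
    (F.subDigit.eval (.cons c (.cons a b))).IsBit ∧
    (F.subBorrow.eval (.cons c (.cons a b))).IsBit ∧
    a.hd.truth + 2 * (F.subBorrow.eval (.cons c (.cons a b))).truth
      = c.truth + b.hd.truth + (F.subDigit.eval (.cons c (.cons a b))).truth := by
  rcases hc with rfl | rfl <;> rcases ha with h₁ | h₁ <;> rcases hb with h₂ | h₂ <;>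
  simp [F.subDigit, F.addSum, F.subBorrow, F.eval, Val.hd, Val.tl, Val.truth, Val.IsBit] <;>
  simp [Val.hd] at h₁ h₂ <;> simp [h₁, h₂]

/-- `f` tells whether the difference of `m` and `n` is negative, and `d` is this difference if it is
not. -/
def IsDiff (L m n : ℕ) (f d : Val) : Prop :=
  f.IsBit ∧ d.IsBin L ∧ (f = .nil → m = n + d.bval) ∧ (f ≠ .nil → m < n)

/-- The borrow out of the last digit is known only at the bottom of the recursion. It is handed back
up in front of the digits, where it decides the comparison. -/
theorem sub_tree {S : ℕ} (L : ℕ) {c a b : Val} (hc : c.IsBit) (ha : a.IsBin L) (hb : b.IsBin L)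
    (hS : 1000 * (L + 1) ≤ S) :
    ∃ f d, RecTree F.addBase (.cons (.hd .var) .nil) .nil F.subRec F.subComb S L
      (.cons c (.cons a b)) (.cons f d) ∧ IsDiff L a.bval (b.bval + c.truth) f d := by
  have base : ∀ L, IsDiff L (Val.bval .nil) (Val.bval .nil + c.truth) c .nil := fun L => by
    refine ⟨hc, .nil _, ?_, ?_⟩ <;> rcases hc with rfl | rfl <;> simp [Val.bval, Val.truth]
  induction L generalizing c a b with
  | zero =>
    rw [ha.eq_nil, hb.eq_nil]
    refine ⟨c, .nil, .leaf (by simp [F.addBase, F.eval, Val.hd, Val.tl])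
      ((Ev.of_loopFree rfl _).mono ?_), base _⟩
    have hsc := hc.size_le
    simp only [F.cost, Val.size]
    omega
  | succ L ih =>
    have hsa := ha.size_le
    have hsb := hb.size_le
    have hsc := hc.size_le
    by_cases h0 : F.addBase.eval (.cons c (.cons a b)) = .nil
    · obtain ⟨d₁, d₂, d₃⟩ := sub_digits hc ha.hd hb.hd
      -- `base` depends on `c`, so the induction generalizes it as well and it has to be supplied
      -- for the new borrow.
      obtain ⟨f, d, hv, hf, hd, h₁, h₂⟩ := ih d₂ ha.tl hb.tl (by omega) (fun L => by
        refine ⟨d₂, .nil _, ?_, ?_⟩ <;> rcases d₂ with h | h <;> simp [h, Val.bval, Val.truth])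
      have hfs := hf.size_le
      have hds := hd.size_le
      refine ⟨f, .cons (F.subDigit.eval (.cons c (.cons a b))) d,
        .node (vl := .cons .nil .nil) h0
        (.leaf (by simp [F.addBase, F.eval, Val.hd, Val.tl])
          ((Ev.of_loopFree rfl _).mono ?_)) hv ((Ev.of_loopFree rfl _).mono ?_),
        hf, ⟨d₁, hd⟩, ?_, ?_⟩
      · simp only [F.eval, F.cost, Val.size]
        omega
      · simp only [F.cost, F.subComb, F.subDigit, F.addSum, Val.size]
        omega
      · intro h
        have := h₁ h
        rw [a.bval_eq, b.bval_eq, Val.bval]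
        omega
      · intro h
        have := h₂ h
        have hle : (F.subDigit.eval (.cons c (.cons a b))).truth ≤ 1 := by
          rcases d₁ with h | h <;> rw [h] <;> simp [Val.truth]
        rw [a.bval_eq, b.bval_eq]
        omega
    · obtain ⟨rfl, rfl⟩ : a = .nil ∧ b = .nil := by
        cases a <;> cases b <;> simp [F.addBase, F.eval, Val.hd, Val.tl] at h0 ⊢
      refine ⟨c, .nil, .leaf h0 ((Ev.of_loopFree rfl _).mono ?_), base _⟩
      simp only [F.cost, Val.size]
      omega

theorem sub_ev : ∃ s, PB s ∧ ∀ (L : ℕ) (a b : Val), a.IsBin L → b.IsBin L →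
    ∃ f d, Ev F.sub (.cons .nil (.cons a b)) (.cons f d) (s L) ∧
      IsDiff L a.bval b.bval f d := by
  refine ⟨fun L => 18 * (recCost F.addBase .nil F.subRec + 1) * ((L + 1) * (1000 * (L + 1))),
    by fun_prop, fun L a b ha hb => ?_⟩
  obtain ⟨f, d, hv, h⟩ := sub_tree L .nil ha hb le_rfl
  exact ⟨f, d, hv.ev rfl rfl rfl, by simpa [Val.truth] using h⟩

/-- Truncated subtraction and minimum: on `(a, b)` the pair `(min a b, a - b)`. -/
def F.minSub : F :=
  .bind .sub (.cons .nil .var) (.ite (.hd (.hd .var)) (.cons (.hd (.tl .var)) .nil)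
    (.cons (.tl (.tl .var)) (.tl (.hd .var))))

/-- The final borrow of one subtraction selects both the minimum and the truncated difference. -/
theorem minSub_ev : ∃ s, PB s ∧ ∀ (L : ℕ) (a b : Val), a.IsBin L → b.IsBin L →
    ∃ m d, Ev F.minSub (.cons a b) (.cons m d) (s L) ∧ m.IsBin L ∧ d.IsBin L ∧
      m.bval = min a.bval b.bval ∧ d.bval = a.bval - b.bval := by
  obtain ⟨s, hs, h⟩ := sub_ev
  refine ⟨fun L => s L + 100 * (8 * L + 3 + s L) + 1000 * (8 * L + 3) + 1, by fun_prop,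
    fun L a b ha hb => ?_⟩
  obtain ⟨f, d, hv, h₁, h₂, h₃, h₄⟩ := h L a b ha hb
  have e := hv.size_le.2
  have hsa := ha.size_le
  have hsb := hb.size_le
  have hv' := Ev.bind (k := .ite (.hd (.hd .var)) (.cons (.hd (.tl .var)) .nil)
    (.cons (.tl (.tl .var)) (.tl (.hd .var)))) (a := .cons .nil .var) (x := .cons a b) rfl hv
    (Ev.of_loopFree rfl _)
  rcases h₁ with rfl | rfl
  · refine ⟨b, d, hv'.mono ?_, hb, h₂, ?_, ?_⟩
    · simp only [F.cost, Val.size] at *; omega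
    · rw [h₃ rfl]; simp
    · rw [h₃ rfl]; simp
  · have := h₄ (by simp)
    refine ⟨a, .nil, hv'.mono ?_, ha, .nil _, ?_, ?_⟩
    · simp only [F.cost, Val.size] at *; omega
    · rw [min_eq_left this.le]
    · simp only [Val.bval]; omega

/-- Multiplication: on `(a, b)` the product of `a` and `b`. -/
def F.mul : F :=
  .recur (.ite (.hd .var) .nil .one) .nil .nil (.cons (.tl (.hd .var)) (.tl .var))
    (.comp .add (.cons .nil (.cons (.ite (.hd (.hd (.hd .var))) (.tl (.hd .var)) .nil)
      (.cons .nil (.tl (.tl .var))))))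

theorem mul_ev : ∃ s, PB s ∧ ∀ (L : ℕ) (a b : Val), a.IsBin L → b.IsBin L →
    ∃ v, Ev F.mul (.cons a b) v (s L) ∧ v.IsBin (3 * L) ∧ v.bval = a.bval * b.bval := by
  obtain ⟨s, hs, h⟩ := add_ev
  refine ⟨fun L => 18 * (recCost (.ite (.hd .var) .nil .one) .nil
      (.cons (.tl (.hd .var)) (.tl .var)) + 1) * ((L + 1) * (s (3 * L) + 1000 * (8 * L + 20) +
        1000 * (12 * L + 20))),
    by fun_prop, fun L a b ha hb => ?_⟩
  -- Only the first factor is shortened, so its length M is separated from L. One level doubles the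
  -- partial product and adds `b` or 0, which costs two digits; M levels give L + 2M.
  suffices hm : ∀ M, M ≤ L → ∀ a : Val, a.IsBin M → ∃ v,
      RecTree (.ite (.hd .var) .nil .one) .nil .nil (.cons (.tl (.hd .var)) (.tl .var))
      (.comp .add (.cons .nil (.cons (.ite (.hd (.hd (.hd .var))) (.tl (.hd .var)) .nil)
      (.cons .nil (.tl (.tl .var)))))) (s (3 * L) + 1000 * (8 * L + 20) + 1000 * (12 * L + 20)) M
      (.cons a b) v ∧
      v.IsBin (L + 2 * M) ∧ v.bval = a.bval * b.bval by
    obtain ⟨v, hv, h₁, h₂⟩ := hm L le_rfl a ha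
    exact ⟨v, hv.ev rfl rfl rfl, h₁.mono (by omega), h₂⟩
  have hsb := hb.size_le
  intro M
  induction M with
  | zero =>
    intro _ a ha
    rw [ha.eq_nil]
    refine ⟨.nil, .leaf (by simp [F.eval, Val.hd]) (.nil ?_), .nil _, by simp [Val.bval]⟩
    simp only [Val.size]; omega
  | succ M ih =>
    intro hM a ha
    have hsa := ha.size_le
    cases a with
    | nil =>
      refine ⟨.nil, .leaf (by simp [F.eval, Val.hd]) (.nil ?_), .nil _, by simp [Val.bval]⟩
      simp only [Val.size]; omega
    | cons c t =>
      obtain ⟨v, hv, h₁, h₂⟩ := ih (by omega) t ha.2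
      have hvs := h₁.size_le
      have hw : ∃ w, Ev .add (.cons .nil (.cons (F.eval (.ite (.hd (.hd (.hd .var)))
          (.tl (.hd .var)) .nil) (.cons (.cons (.cons c t) b) (.cons .nil v))) (.cons .nil v))) w
          (s (L + 2 * M + 1)) ∧ w.IsBin (L + 2 * M + 1 + 1) ∧
          w.bval = (Val.cons c t).bval * b.bval := by
        rcases ha.1 with rfl | rfl
        · obtain ⟨w, hw, h₃, h₄⟩ := h (L + 2 * M + 1) .nil (.cons .nil v) (.nil _) ⟨.nil, h₁⟩
          refine ⟨w, hw, h₃, ?_⟩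
          rw [h₄]; simp [Val.bval, Val.truth, h₂]; ring
        · obtain ⟨w, hw, h₃, h₄⟩ := h (L + 2 * M + 1) b (.cons .nil v) (hb.mono (by omega))
            ⟨.nil, h₁⟩
          refine ⟨w, hw, h₃, ?_⟩
          rw [h₄]; simp [Val.bval, Val.truth, h₂]; ring
      obtain ⟨w, hw, h₃, h₄⟩ := hw
      have hs' : s (L + 2 * M + 1) ≤ s (3 * L) := hs.mono (by omega)
      refine ⟨w, .node (vl := .nil) rfl (.leaf (by simp [F.eval, Val.hd]) (.nil ?_)) hv
        (.comp ((Ev.of_loopFree rfl _)) hw ?_ (by omega)), h₃, h₄⟩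
      · simp only [F.eval, Val.size]; omega
      · simp only [F.cost, Val.size] at *; omega


/-! ### Evaluation of expressions -/

theorem Expr.size_eval_le (e : Expr) (x : Val) : (e.eval x).size ≤ e.enc.size * x.size := by
  have hx := x.one_le_size
  induction e with
  | var => simp only [Expr.eval, Expr.enc, Val.size]; nlinarith
  | nil => simp only [Expr.eval, Expr.enc, Val.size]; nlinarith
  | cons a b iha ihb => simp only [Expr.eval, Expr.enc, Val.size]; nlinarith
  | hd e ih =>
    have := (e.eval x).size_hd_le
    simp only [Expr.eval, Expr.enc, Val.size]; nlinarith
  | tl e ih =>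
    have := (e.eval x).size_tl_le
    simp only [Expr.eval, Expr.enc, Val.size]; nlinarith

/-- The test for atomic expressions. -/
def F.exprBase : F := .ite (.tl (.hd (.hd .var))) .nil .one

/-- The value of atomic expressions. -/
def F.exprAtom : F := .ite (.hd (.hd .var)) .nil (.tl .var)

/-- The first recursive argument in the evaluation of expressions. -/
def F.exprLeft : F :=
  .cons (.ite (.tl (.tl (.hd (.hd .var)))) (.tl (.hd .var)) (.hd (.tl (.hd .var)))) (.tl .var)

/-- The second recursive argument in the evaluation of expressions. -/
def F.exprRight : F :=
  .ite (.tl (.tl (.hd (.hd .var)))) .nil (.cons (.tl (.tl (.hd .var))) (.tl .var))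

/-- The value of a compound expression from those of its parts. -/
def F.exprComb : F :=
  .ite (.tl (.tl (.hd (.hd (.hd .var)))))
    (.ite (.tl (.tl (.tl (.hd (.hd (.hd .var)))))) (.tl (.hd (.tl .var))) (.hd (.hd (.tl .var))))
    (.tl .var)

/-- The program that evaluates an expression: on `(e, x)` the value of `e` in the store `x`. -/
def F.exprValue : F := .recur F.exprBase F.exprAtom F.exprLeft F.exprRight F.exprComb

/-- Constructor tags are unary and are told apart by taking tails. `hd` and `tl` have a single
subexpression; their second branch is the dummy argument `nil`, which counts as atomic. -/
theorem exprValue_tree {S : ℕ} (x : Val) (e : Expr) (hS : 10000 * (e.enc.size * x.size) ≤ S) :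
    RecTree F.exprBase F.exprAtom F.exprLeft F.exprRight F.exprComb S e.enc.size
      (.cons e.enc x) (e.eval x) := by
  have hx := x.one_le_size
  have leaf : ∀ (d : ℕ) (y : Val), 2 * y.size ≤ S / 100 → F.exprBase.eval y ≠ .nil →
      RecTree F.exprBase F.exprAtom F.exprLeft F.exprRight F.exprComb S d y (F.exprAtom.eval y) := by
    intro d y hy h
    refine .leaf h ((Ev.of_loopFree rfl y).mono ?_)
    simp only [F.exprAtom, F.cost]; omega
  have hle : ∀ e : Expr, e.enc.size + x.size ≤ e.enc.size * x.size + 1 := by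
    intro e
    have := e.enc.one_le_size
    nlinarith
  induction e with
  | var =>
    refine leaf _ _ ?_ (by simp [Expr.enc, F.exprBase, F.eval, Val.unary, Val.hd, Val.tl])
    simp only [Expr.enc, Val.unary, Val.size] at *; omega
  | nil =>
    refine leaf _ _ ?_ (by simp [Expr.enc, F.exprBase, F.eval, Val.unary, Val.hd, Val.tl])
    simp only [Expr.enc, Val.unary, Val.size] at *; omega
  | cons a b iha ihb =>
    have h₁ := a.size_eval_le x
    have h₂ := b.size_eval_le x
    have h₃ := hle a
    have h₄ := hle b
    have hs : (Expr.cons a b).enc.size = a.enc.size + b.enc.size + 7 := by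
      simp only [Expr.enc, Val.unary, Val.size]; omega
    rw [hs] at hS ⊢
    have hS' : 10000 * (a.enc.size * x.size) + 10000 * (b.enc.size * x.size) + 70000 * x.size ≤ S := by
      nlinarith
    refine .node (vl := a.eval x) (vr := b.eval x) rfl ((iha ?_).mono le_rfl ?_)
      ((ihb ?_).mono le_rfl ?_)
      ((Ev.of_loopFree (f := F.exprComb) rfl _).mono ?_)
    · omega
    · omega
    · omega
    · omega
    · simp only [F.exprComb, F.cost, Val.size]
      rw [hs]
      omega
  | hd e ih =>
    have h₁ := e.size_eval_le x
    have h₃ := hle e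
    have hs : (Expr.hd e).enc.size = e.enc.size + 8 := by
      simp only [Expr.enc, Val.unary, Val.size]; omega
    rw [hs] at hS ⊢
    have hS' : 10000 * (e.enc.size * x.size) + 80000 * x.size ≤ S := by nlinarith
    refine .node (vl := e.eval x) (vr := .nil) rfl ((ih ?_).mono le_rfl ?_)
      (leaf _ .nil ?_ (by simp [F.exprBase, F.eval, Val.hd, Val.tl]))
      ((Ev.of_loopFree (f := F.exprComb) rfl _).mono ?_)
    · omega
    · omega
    · simp only [Val.size]; omega
    · simp only [F.exprComb, F.cost, Val.size]
      rw [hs]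
      omega
  | tl e ih =>
    have h₁ := e.size_eval_le x
    have h₃ := hle e
    have hs : (Expr.tl e).enc.size = e.enc.size + 10 := by
      simp only [Expr.enc, Val.unary, Val.size]; omega
    rw [hs] at hS ⊢
    have hS' : 10000 * (e.enc.size * x.size) + 80000 * x.size ≤ S := by nlinarith
    refine .node (vl := e.eval x) (vr := .nil) rfl ((ih ?_).mono le_rfl ?_)
      (leaf _ .nil ?_ (by simp [F.exprBase, F.eval, Val.hd, Val.tl]))
      ((Ev.of_loopFree (f := F.exprComb) rfl _).mono ?_)
    · omega
    · omega
    · simp only [Val.size]; omega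
    · simp only [F.exprComb, F.cost, Val.size]
      rw [hs]
      omega

theorem exprValue_ev : ∃ s, PB s ∧ ∀ (Z : ℕ) (e : Expr) (x : Val), e.enc.size ≤ Z → x.size ≤ Z →
    Ev F.exprValue (.cons e.enc x) (e.eval x) (s Z) := by
  refine ⟨fun Z => 18 * (recCost F.exprBase F.exprLeft F.exprRight + 1) *
    ((Z + 1) * (10000 * (Z * Z))), by fun_prop, fun Z e x he hx => ?_⟩
  exact (((exprValue_tree x e (Nat.mul_le_mul_left _ (Nat.mul_le_mul he hx))).mono le_rfl he).ev
    rfl rfl rfl)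

/-! ### A self-interpreter for deterministic programs -/

/-- The size that the control can reach during the execution of a program. -/
def Prog.ctrlSize : Prog → ℕ
  | .assign e => (Prog.assign e).enc.size + 1
  | .flip => Prog.flip.enc.size + 1
  | .seq p q => (Prog.seq p q).enc.size + 1 + p.ctrlSize + q.ctrlSize
  | .cond e p q => (Prog.cond e p q).enc.size + 1 + p.ctrlSize + q.ctrlSize
  | .loop e p => (Prog.loop e p).enc.size + 1 + p.ctrlSize

/-- `ctrlSize` adds up the code sizes, plus one each, of all subprograms; nesting makes this at most
quadratic. -/
theorem Prog.ctrlSize_le (p : Prog) : p.ctrlSize ≤ p.enc.size * p.enc.size := by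
  induction p with
  | assign e =>
    have := e.enc.one_le_size
    simp only [Prog.ctrlSize, Prog.enc, Val.unary, Val.size]; nlinarith
  | flip => simp [Prog.ctrlSize, Prog.enc, Val.unary, Val.size]
  | seq p q ihp ihq =>
    simp only [Prog.ctrlSize, Prog.enc, Val.unary, Val.size]
    nlinarith [p.enc.one_le_size, q.enc.one_le_size,
      Nat.mul_le_mul p.enc.one_le_size q.enc.one_le_size]
  | cond e p q ihp ihq =>
    simp only [Prog.ctrlSize, Prog.enc, Val.unary, Val.size]
    have h1 := p.enc.one_le_size
    have h2 := q.enc.one_le_size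
    have h3 := e.enc.one_le_size
    generalize p.enc.size = a at *
    generalize q.enc.size = b at *
    generalize e.enc.size = c at *
    nlinarith [Nat.mul_le_mul h1 h2, Nat.mul_le_mul h1 h3, Nat.mul_le_mul h2 h3]
  | loop e p ih =>
    simp only [Prog.ctrlSize, Prog.enc, Val.unary, Val.size]
    have h1 := p.enc.one_le_size
    have h3 := e.enc.one_le_size
    generalize p.enc.size = a at *
    generalize e.enc.size = c at *
    nlinarith [Nat.mul_le_mul h1 h3]

theorem Prog.size_enc_lt_ctrlSize (p : Prog) : p.enc.size < p.ctrlSize := by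
  cases p <;> simp only [Prog.ctrlSize] <;> omega

/-- The code of a control. -/
def encCtrl (K : List Prog) : Val := Val.ofList (K.map Prog.enc)

/-- The size of the control will not exceed `B` during the execution of `K`. -/
def CtrlBound (B : ℕ) : List Prog → Prop
  | [] => 1 ≤ B
  | p :: K => (encCtrl K).size + p.ctrlSize ≤ B ∧ CtrlBound B K

theorem CtrlBound.size_le {B : ℕ} {K : List Prog} (h : CtrlBound B K) : (encCtrl K).size ≤ B := by
  cases K with
  | nil => exact h
  | cons p K =>
    have h1 := h.1
    have := p.size_enc_lt_ctrlSize
    simp only [encCtrl, List.map_cons, Val.ofList, Val.size] at *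
    omega

/-- A step replaces a piece of program by its parts, and the budget of the piece covers its own code
together with the budgets of the parts. The own code matters for a loop, which stays on the control
beneath its body. -/
theorem CtrlBound.step {B : ℕ} {b : Bool} {c : Cfg} (h : CtrlBound B c.ctrl) :
    CtrlBound B (Improv.step b c).ctrl := by
  obtain ⟨K, x⟩ := c
  cases K with
  | nil => exact h
  | cons p K =>
    obtain ⟨h₁, h₂⟩ := h
    have hK := h₂.size_le
    cases p with
    | assign e => exact h₂
    | flip => exact h₂
    | seq p q =>
      have := q.size_enc_lt_ctrlSize
      simp only [Prog.ctrlSize, Prog.enc, Val.size] at h₁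
      refine ⟨?_, ?_, h₂⟩
      · simp only [encCtrl, List.map_cons, Val.ofList, Val.size] at *; omega
      · omega
    | cond e p q =>
      simp only [Prog.ctrlSize] at h₁
      simp only [Improv.step]
      split
      · exact ⟨by omega, h₂⟩
      · exact ⟨by omega, h₂⟩
    | loop e p =>
      simp only [Improv.step]
      split
      · exact h₂
      · refine ⟨?_, h₁, h₂⟩
        simp only [Prog.ctrlSize] at h₁
        simp only [encCtrl, List.map_cons, Val.ofList, Val.size] at *; omega

/-- The code of a configuration. -/
def encCfg (c : Cfg) : Val := .cons (encCtrl c.ctrl) c.store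

/-- The expression to be evaluated in the next step of a configuration. -/
def F.interpExpr : F :=
  .ite (.hd (.hd (.hd .var)))
    (.ite (.tl (.tl (.hd (.hd (.hd .var))))) (.hd (.tl (.hd (.hd .var)))) (.cons .nil .nil))
    (.tl (.hd (.hd .var)))

/-- The next configuration; the value of the expression of `F.interpExpr` is in front. -/
def F.interpNext : F :=
  .ite (.hd (.hd (.hd (.tl .var))))
    (.ite (.tl (.hd (.hd (.hd (.tl .var)))))
      (.ite (.tl (.tl (.hd (.hd (.hd (.tl .var))))))
        (.ite (.tl (.tl (.tl (.hd (.hd (.hd (.tl .var)))))))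
          (.ite (.hd .var)
            (.cons (.cons (.tl (.tl (.hd (.hd (.tl .var))))) (.hd (.tl .var))) (.tl (.tl .var)))
            (.cons (.tl (.hd (.tl .var))) (.tl (.tl .var))))
          (.cons (.cons (.ite (.hd .var) (.hd (.tl (.tl (.hd (.hd (.tl .var))))))
            (.tl (.tl (.tl (.hd (.hd (.tl .var))))))) (.tl (.hd (.tl .var)))) (.tl (.tl .var))))
        (.cons (.cons (.hd (.tl (.hd (.hd (.tl .var))))) (.cons (.tl (.tl (.hd (.hd (.tl .var)))))
          (.tl (.hd (.tl .var))))) (.tl (.tl .var))))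
      (.tl .var))
    (.cons (.tl (.hd (.tl .var))) (.hd .var))

/-- One step of the interpreter. -/
def F.interpBody : F := .bind F.exprValue (.cons F.interpExpr (.tl .var)) F.interpNext

/-- The interpreter: on `(P, x)` the output of the program `P` on `x`. -/
def F.interp : F := .tl (.comp (.iter F.interpBody) (.cons (.cons (.hd .var) .nil) (.tl .var)))

theorem interpBody_ev : ∃ s, PB s ∧ ∀ (Z : ℕ) (p : Prog) (K : List Prog) (x : Val) (b : Bool),
    p.Deterministic → (encCfg ⟨p :: K, x⟩).size ≤ Z →
    Ev F.interpBody (encCfg ⟨p :: K, x⟩) (encCfg (step b ⟨p :: K, x⟩)) (s Z) := by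
  obtain ⟨s, hs, h⟩ := exprValue_ev
  refine ⟨fun Z => s Z + F.interpNext.cost * (s Z + Z + 1) +
    ((F.cons F.interpExpr (.tl .var)).cost + 2) * Z + 1, by fun_prop, ?_⟩
  intro Z p K x b hp hZ
  -- Every simulated step evaluates exactly one expression, so the space is counted once for all
  -- instructions.
  have key : ∀ e : Expr, e.enc.size ≤ Z →
      (F.cons F.interpExpr (.tl .var)).eval (encCfg ⟨p :: K, x⟩) = .cons e.enc x →
      F.interpNext.eval (.cons (e.eval x) (encCfg ⟨p :: K, x⟩)) = encCfg (step b ⟨p :: K, x⟩) →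
      Ev F.interpBody (encCfg ⟨p :: K, x⟩) (encCfg (step b ⟨p :: K, x⟩))
        (s Z + F.interpNext.cost * (s Z + Z + 1) +
          ((F.cons F.interpExpr (.tl .var)).cost + 2) * Z + 1) := by
    intro e he h₁ h₂
    have hx : x.size ≤ Z := by simp only [encCfg, Val.size] at hZ; omega
    have e₁ := h Z e x he hx
    have e₂ := e₁.size_le.2
    rw [← h₁] at e₁
    have e₃ := Ev.of_loopFree (f := F.interpNext) rfl (.cons (e.eval x) (encCfg ⟨p :: K, x⟩))
    rw [h₂] at e₃
    refine (Ev.bind rfl e₁ e₃).mono ?_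
    gcongr
    simp only [Val.size]
    omega
  cases p with
  | assign e =>
    refine key e ?_ rfl rfl
    simp only [encCfg, encCtrl, List.map_cons, Val.ofList, Prog.enc, Val.size] at hZ
    omega
  | flip => exact hp.elim
  | seq p q =>
    -- A sequence needs no expression; `F.interpExpr` then yields the code of the variable, and its
    -- value is ignored.
    refine key .var ?_ rfl rfl
    simp only [encCfg, encCtrl, List.map_cons, Val.ofList, Prog.enc, Val.size, Val.unary, Expr.enc]
      at hZ ⊢
    omega
  | cond e p q =>
    refine key e ?_ rfl ?_
    · simp only [encCfg, encCtrl, List.map_cons, Val.ofList, Prog.enc, Val.size] at hZ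
      omega
    · cases he : e.eval x <;> simp [encCfg, encCtrl, step, he, Val.ofList, Prog.enc, F.interpNext,
        F.eval, Val.hd, Val.tl, Val.unary]
  | loop e p =>
    refine key e ?_ rfl ?_
    · simp only [encCfg, encCtrl, List.map_cons, Val.ofList, Prog.enc, Val.size] at hZ
      omega
    · cases he : e.eval x <;> simp [encCfg, encCtrl, step, he, Val.ofList, Prog.enc, F.interpNext,
        F.eval, Val.hd, Val.tl, Val.unary]

theorem step_deterministic {b : Bool} {c : Cfg} (h : ∀ p ∈ c.ctrl, p.Deterministic) :
    ∀ p ∈ (step b c).ctrl, p.Deterministic := by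
  obtain ⟨K, x⟩ := c
  cases K with
  | nil => exact h
  | cons p K =>
    simp only [List.mem_cons, forall_eq_or_imp] at h
    obtain ⟨h₁, h₂⟩ := h
    cases p with
    | assign e => exact h₂
    | flip => exact h₂
    | seq p q =>
      simp only [step, List.mem_cons, forall_eq_or_imp]
      exact ⟨h₁.1, h₁.2, h₂⟩
    | cond e p q =>
      simp only [step]
      split <;> simp only [List.mem_cons, forall_eq_or_imp]
      · exact ⟨h₁.2, h₂⟩
      · exact ⟨h₁.1, h₂⟩
    | loop e p =>
      simp only [step]
      split
      · exact h₂
      · simp only [List.mem_cons, forall_eq_or_imp]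
        exact ⟨h₁, h₁, h₂⟩

/-- A simulated configuration consists of a store of size at most Z and a control of size at most Z²
+ 1, by the quadratic bound on `ctrlSize`. The interpreter itself has no clock and no space limit;
its termination comes from that of P. -/
theorem interp_ev : ∃ s, PB s ∧ ∀ (Z : ℕ) (P : Prog) (x y : Val), P.Deterministic →
    Outputs P x y → SpaceLE P x Z → P.enc.size ≤ Z → Ev F.interp (.cons P.enc x) y (s Z) := by
  obtain ⟨s, hs, h⟩ := interpBody_ev
  refine ⟨fun Z => s (Z * Z + Z + 2) + (Z * Z + Z + 2) + 100 * (Z + Z + 1), by fun_prop, ?_⟩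
  intro Z P x y hP ⟨ω, hω⟩ hsp hZ
  have main : ∀ (ω : List Bool) (c : Cfg), run ω c = ⟨[], y⟩ → (∀ p ∈ c.ctrl, p.Deterministic) →
      CtrlBound (Z * Z + 1) c.ctrl → (∀ ω', (run ω' c).store.size ≤ Z) →
      Ev (.iter F.interpBody) (encCfg c) (encCfg ⟨[], y⟩)
        (s (Z * Z + Z + 2) + (Z * Z + Z + 2)) := by
    intro ω
    induction ω with
    | nil =>
      intro c hc _ hB hst
      simp only [run] at hc
      subst hc
      have := hst []
      refine .iter_done rfl ?_
      simp only [run, encCfg, encCtrl, List.map_nil, Val.ofList, Val.size] at *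
      omega
    | cons b ω ih =>
      intro c hc hd hB hst
      obtain ⟨K, z⟩ := c
      have hz := hst []
      have hK := hB.size_le
      cases K with
      | nil =>
        rw [run_nil_ctrl] at hc
        rw [hc]
        refine .iter_done rfl ?_
        simp only [Cfg.mk.injEq] at hc
        simp only [run, encCfg, encCtrl, List.map_nil, Val.ofList, Val.size] at *
        rw [← hc.2]
        omega
      | cons p K =>
        refine .iter_step (by simp [encCfg, encCtrl, Val.ofList, Val.hd])
          (h (Z * Z + Z + 2) p K z b (hd p (by simp)) ?_) (ih _ hc (step_deterministic hd) hB.step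
          fun ω' => hst (b :: ω')) (Nat.le_add_right _ _) le_rfl
        simp only [run, encCfg, Val.size] at *
        omega
  have hx : x.size ≤ Z := hsp []
  have e₁ := main ω _ hω (by simpa [init] using hP) ⟨?_, ?_⟩ hsp
  · refine .tl (.comp (Ev.of_loopFree (f := .cons (.cons (.hd .var) .nil) (.tl .var)) rfl
      (.cons P.enc x)) e₁
      ?_ ?_)
    · simp only [F.cost, Val.size]; omega
    · beta_reduce; omega
  · have h1 := P.ctrlSize_le
    have h2 := Nat.mul_le_mul hZ hZ
    simp only [encCtrl, List.map_nil, Val.ofList, Val.size]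
    omega
  · simp [CtrlBound]


/-! ### Deterministic programs have one run -/

theorem step_eq_of_deterministic {c : Cfg} (h : ∀ p ∈ c.ctrl, p.Deterministic) (b b' : Bool) :
    step b c = step b' c := by
  obtain ⟨K, x⟩ := c
  cases K with
  | nil => rfl
  | cons p K =>
    cases p with
    | flip => exact (h _ (List.mem_cons_self ..)).elim
    | _ => rfl

theorem run_eq_of_deterministic {c : Cfg} (h : ∀ p ∈ c.ctrl, p.Deterministic) {ω ω' : List Bool}
    (hω : ω.length = ω'.length) : run ω c = run ω' c := by
  induction ω generalizing c ω' with
  | nil => rw [List.length_eq_zero_iff.1 hω.symm]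
  | cons b ω ih =>
    match ω', hω with
    | b' :: ω', hω =>
      simp only [run]
      rw [step_eq_of_deterministic h b b']
      exact ih (step_deterministic h) (by simpa using hω)

theorem Outputs.unique {P : Prog} (hP : P.Deterministic) {x y z : Val} (hy : Outputs P x y)
    (hz : Outputs P x z) : y = z := by
  obtain ⟨ω, hω⟩ := hy
  obtain ⟨ω', hω'⟩ := hz
  have h₁ : run (ω ++ ω') (init P x) = ⟨[], y⟩ := by rw [run_append, hω, run_nil_ctrl]
  have h₂ : run (ω' ++ ω) (init P x) = ⟨[], z⟩ := by rw [run_append, hω', run_nil_ctrl]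
  rw [run_eq_of_deterministic (ω' := ω' ++ ω) (by simpa [init] using hP) (by simp [add_comm]),
    h₂] at h₁
  simpa using h₁.symm

/-! ### Values of histories -/

/-- The minimum of a list of natural numbers, `0` for the empty list. -/
def minList : List ℕ → ℕ
  | [] => 0
  | [a] => a
  | a :: b :: l => min a (minList (b :: l))

variable {k : ℕ}

/-- The value of a history with `m` symbols to come, when only the symbols of `us` may come next.
Histories are written in reverse order. -/
def gameVal (leaf : List (Fin k) → ℕ) : ℕ → List (Fin k) → List (Fin k) → ℕ
  | 0, _, g => leaf g
  | m + 1, us, g =>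
    if Even g.length then (us.map fun u => gameVal leaf m (List.finRange k) (u :: g)).sum
    else minList (us.map fun u => gameVal leaf m (List.finRange k) (u :: g))

/-- The constant program. -/
def F.const : Val → F
  | .nil => .nil
  | .cons a b => .cons (F.const a) (F.const b)

@[simp] theorem F.eval_const (v x : Val) : (F.const v).eval x = v := by
  induction v <;> simp_all [F.const, F.eval]

@[simp] theorem F.loopFree_const (v : Val) : (F.const v).loopFree = true := by
  induction v <;> simp_all [F.const, F.loopFree]

theorem size_unary (n : ℕ) : (Val.unary n).size = 2 * n + 1 := by
  induction n with
  | zero => rfl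
  | succ n ih => simp only [Val.unary, Val.size, ih]; omega

theorem size_encWord_le (w : List (Fin k)) : (encWord w).size ≤ (2 * k + 1) * w.length + 1 := by
  induction w with
  | nil => simp [encWord, Val.ofList, Val.size]
  | cons u w ih =>
    have := u.isLt
    have h := size_unary (u : ℕ)
    simp only [encWord, List.map_cons, Val.ofList, Val.size, List.length_cons] at *
    rw [h, Nat.mul_succ]
    omega

/-! ### Evaluating the game by a program -/

/-- Reversal of lists. -/
def F.rev : F :=
  .tl (.comp (.iter (.cons (.tl (.hd .var)) (.cons (.hd (.hd .var)) (.tl .var)))) (.cons .var .nil))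

theorem rev_ev (l : List Val) :
    Ev F.rev (.ofList l) (.ofList l.reverse) (100 * (Val.ofList l).size) := by
  have main : ∀ (l acc : List Val) (Z : ℕ), 20 * (Val.cons (.ofList l) (.ofList acc)).size ≤ Z →
      Ev (.iter (.cons (.tl (.hd .var)) (.cons (.hd (.hd .var)) (.tl .var))))
        (.cons (.ofList l) (.ofList acc)) (.cons .nil (.ofList (l.reverse ++ acc))) Z := by
    intro l
    induction l with
    | nil => intro acc Z h; exact .iter_done rfl (le_trans (by omega) h)
    | cons a l ih =>
      intro acc Z h
      refine .iter_step (y := .cons (.ofList l) (.ofList (a :: acc))) (by simp [Val.hd, Val.ofList])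
        (Ev.of_loopFree rfl _) ?_ (le_trans ?_ h) le_rfl
      · have := ih (a :: acc) Z (by simp only [Val.ofList, Val.size] at *; omega)
        simpa using this
      · simp only [F.cost]; omega
  have h := main l [] (20 * ((Val.ofList l).size + 2)) (by simp only [Val.size, Val.ofList]; omega)
  rw [List.append_nil] at h
  have h1 := (Val.ofList l).one_le_size
  refine .tl (.comp (Ev.of_loopFree (f := .cons .var .nil) rfl _) h ?_ (by omega))
  simp only [F.cost]; omega

/-- The program `P` decides membership of words of length `n`, and all its data have size at most
`Z`. -/
structure Decides (k Z n : ℕ) (P : Prog) : Prop where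
  deterministic : P.Deterministic
  size_le : P.enc.size ≤ Z
  outputs : ∀ w : List (Fin k), w.length = n → ∃ y, Outputs P (encWord w) y
  space : ∀ w : List (Fin k), w.length = n → SpaceLE P (encWord w) Z

theorem Decides.interp : ∃ s, PB s ∧ ∀ (k Z n : ℕ) (P : Prog), Decides k Z n P →
    ∀ w : List (Fin k), w.length = n → ∃ y, Ev F.interp (.cons P.enc (encWord w)) y (s Z) ∧
      (y ≠ .nil ↔ w ∈ language k P) := by
  obtain ⟨s, hs, h⟩ := interp_ev
  refine ⟨s, hs, fun k Z n P hP w hw => ?_⟩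
  obtain ⟨y, hy⟩ := hP.outputs w hw
  refine ⟨y, h Z P _ y hP.deterministic hy (hP.space w hw) hP.size_le, fun hne => ⟨y, hne, hy⟩, ?_⟩
  rintro ⟨z, hz, hz'⟩
  rwa [Outputs.unique hP.deterministic hy hz']

open Classical in
/-- The value of complete plays with respect to the improvisations. -/
noncomputable def leafI (H : Prog) (N : ℕ) (g : List (Fin k)) : ℕ :=
  if g.reverse ∈ language k H then N else 0

open Classical in
/-- The value of complete plays with respect to the admissible improvisations. -/
noncomputable def leafA (H S : Prog) (N : ℕ) (g : List (Fin k)) : ℕ :=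
  if g.reverse ∈ language k H ∧ g.reverse ∈ language k S then N else 0

/-- The parity of the length of a history. -/
def parity (g : List (Fin k)) : Val := Val.bit (decide (¬ Even g.length))

/-- The programs of an instance, with the weight of plays. -/
def gameCtx (H S : Prog) (N : Val) : Val := .cons H.enc (.cons S.enc N)

/-- The argument of the program for values of histories. -/
def gameArg (m : ℕ) (us g : List (Fin k)) (ctx : Val) : Val :=
  .cons (.unary m) (.cons (encWord us) (.cons (parity g) (.cons (encWord g) ctx)))

/-- The values of a complete play. -/
def F.gameLeaf : F :=
  .ite (.hd .var) .nil
    (.bind .rev (.hd (.tl (.tl (.tl .var))))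
      (.bind .interp (.cons (.hd (.tl (.tl (.tl (.tl (.tl .var)))))) (.hd .var))
        (.bind .interp
          (.cons (.hd (.tl (.tl (.tl (.tl (.tl (.tl (.tl .var)))))))) (.hd (.tl .var)))
          (.ite (.hd (.tl .var)) (.cons
            (.ite (.hd .var) (.tl (.tl (.tl (.tl (.tl (.tl (.tl (.tl (.tl .var))))))))) .nil)
            (.tl (.tl (.tl (.tl (.tl (.tl (.tl (.tl (.tl .var)))))))))) .nil))))

theorem size_gameArg_le (m : ℕ) (us g : List (Fin k)) (ctx : Val) :
    (gameArg m us g ctx).size ≤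
      2 * m + (2 * k + 1) * us.length + (2 * k + 1) * g.length + ctx.size + 10 := by
  have h₁ := size_unary m
  have h₂ := size_encWord_le us
  have h₃ := size_encWord_le g
  have h₄ : (parity g).size ≤ 3 := by
    unfold parity; cases decide (¬ Even g.length) <;> simp [Val.bit, Val.size]
  simp only [gameArg, Val.size]
  omega

theorem size_gameCtx_le {Z n : ℕ} {H S : Prog} {N : Val} (hH : Decides k Z n H)
    (hS : Decides k Z n S) (hN : N.IsBin Z) : (gameCtx H S N).size ≤ 6 * Z + 3 := by
  have := hH.size_le
  have := hS.size_le
  have := hN.size_le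
  simp only [gameCtx, Val.size]; omega

/-- Histories are kept reversed, so that extending one is a `cons`; only here are they turned round
for the two decision programs. Both programs are run on every complete play, and both values are
returned as a pair. -/
theorem gameLeaf_ev (k : ℕ) : ∃ s, PB s ∧ ∀ (Z : ℕ) (H S : Prog) (N : Val) (us g : List (Fin k)),
    Decides k Z g.length H → Decides k Z g.length S → N.IsBin Z → g.length ≤ Z → us.length ≤ Z →
    ∃ v, Ev F.gameLeaf (gameArg 0 us g (gameCtx H S N)) v (s Z) ∧
      v.hd.IsBin Z ∧ v.tl.IsBin Z ∧ v.hd.bval = leafA H S N.bval g ∧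
      v.tl.bval = leafI H N.bval g := by
  obtain ⟨s, hs, h⟩ := Decides.interp
  refine ⟨fun Z => 100000 * ((2 * k + 1) * Z + (2 * k + 1) * Z + (6 * Z + 3) + 10) + 10000 * s Z +
    1000, by fun_prop, fun Z H S N us g hH hS hN hg hus => ?_⟩
  beta_reduce
  obtain ⟨hv, eh, hh⟩ := h k Z g.length H hH g.reverse (by simp)
  obtain ⟨sv, es, hs'⟩ := h k Z g.length S hS g.reverse (by simp)
  have hX := size_gameArg_le 0 us g (gameCtx H S N)
  have hctx := size_gameCtx_le hH hS hN
  have h₁ := Nat.mul_le_mul_left (2 * k + 1) hg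
  have h₂ := Nat.mul_le_mul_left (2 * k + 1) hus
  have hw := size_encWord_le g
  have er : Ev F.rev (encWord g) (encWord g.reverse) (100 * (encWord g).size) := by
    have := rev_ev (g.map fun u : Fin k => Val.unary (u : ℕ))
    rwa [← List.map_reverse] at this
  have lr := er.size_le.2
  have lh := eh.size_le.2
  have ls := es.size_le.2
  have e₀ := Ev.of_loopFree (f := .hd .var) rfl (gameArg 0 us g (gameCtx H S N))
  have e₁ := Ev.bind (k := .ite (.hd (.tl .var)) (.cons
            (.ite (.hd .var) (.tl (.tl (.tl (.tl (.tl (.tl (.tl (.tl (.tl .var))))))))) .nil)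
            (.tl (.tl (.tl (.tl (.tl (.tl (.tl (.tl (.tl .var)))))))))) .nil)
    (a := .cons (.hd (.tl (.tl (.tl (.tl (.tl (.tl (.tl .var)))))))) (.hd (.tl .var)))
    (x := .cons hv (.cons (encWord g.reverse) (gameArg 0 us g (gameCtx H S N)))) rfl es
    (Ev.of_loopFree rfl _)
  have e₂ := Ev.bind (a := .cons (.hd (.tl (.tl (.tl (.tl (.tl .var)))))) (.hd .var))
    (x := .cons (encWord g.reverse) (gameArg 0 us g (gameCtx H S N))) rfl eh e₁
  have e₃ := Ev.bind (a := .hd (.tl (.tl (.tl .var)))) (x := gameArg 0 us g (gameCtx H S N))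
    rfl er e₂
  refine ⟨_, .ite_false e₀ e₃ ?_, ?_⟩
  · simp only [F.cost, Val.size]
    generalize (2 * k + 1) * Z = q at *
    generalize (2 * k + 1) * g.length = q₁ at *
    generalize (2 * k + 1) * us.length = q₂ at *
    omega
  · cases hv with
    | nil =>
      have hH' : g.reverse ∉ language k H := fun hc => (hh.2 hc) rfl
      simp [F.eval, Val.hd, Val.tl, leafA, leafI, hH', Val.IsBin.nil, Val.bval]
    | cons a b =>
      have hH' : g.reverse ∈ language k H := hh.1 (by simp)
      cases sv with
      | nil =>
        have hS' : g.reverse ∉ language k S := fun hc => (hs'.2 hc) rfl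
        simp [F.eval, Val.hd, Val.tl, leafA, leafI, hH', hS', Val.IsBin.nil, Val.bval,
          gameArg, gameCtx, hN]
      | cons a' b' =>
        have hS' : g.reverse ∈ language k S := hs'.1 (by simp)
        simp [F.eval, Val.hd, Val.tl, leafA, leafI, hH', hS', gameArg, gameCtx, hN]

/-- The test for histories without continuations to be considered. -/
def F.gameBase : F := .ite (.hd .var) (.ite (.hd (.tl .var)) .nil .one) .one

/-- The first continuation of a history. -/
def F.gameLeft (k : ℕ) : F :=
  .cons (.tl (.hd .var)) (.cons (F.const (encWord (List.finRange k)))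
    (.cons (.ite (.hd (.tl (.tl .var))) .nil .one)
      (.cons (.cons (.hd (.hd (.tl .var))) (.hd (.tl (.tl (.tl .var)))))
        (.tl (.tl (.tl (.tl .var)))))))

/-- The remaining continuations of a history. -/
def F.gameRight : F := .cons (.hd .var) (.cons (.tl (.hd (.tl .var))) (.tl (.tl .var)))

/-- The minimum of pairs, applied to the second component of the argument. -/
def F.pairMin : F :=
  .cons (.hd (.comp .minSub (.cons (.hd (.hd (.tl .var))) (.hd (.tl (.tl .var))))))
    (.hd (.comp .minSub (.cons (.tl (.hd (.tl .var))) (.tl (.tl (.tl .var))))))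

/-- The sum of pairs, applied to the second component of the argument. -/
def F.pairAdd : F :=
  .cons (.comp .add (.cons .nil (.cons (.hd (.hd (.tl .var))) (.hd (.tl (.tl .var))))))
    (.comp .add (.cons .nil (.cons (.tl (.hd (.tl .var))) (.tl (.tl (.tl .var))))))

/-- The values of a history from those of its continuations. -/
def F.gameComb : F :=
  .ite (.hd (.tl (.tl (.hd .var)))) (.ite (.tl (.hd (.tl (.hd .var)))) .pairMin (.hd (.tl .var)))
    .pairAdd

/-- The program for the values of histories. -/
def F.gameVal (k : ℕ) : F := .recur .gameBase .gameLeaf (.gameLeft k) .gameRight .gameComb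

/-- The pair `v` consists of numbers `a` and `i` of at most `L` digits. -/
def IsPair (L : ℕ) (v : Val) (a i : ℕ) : Prop :=
  v.hd.IsBin L ∧ v.tl.IsBin L ∧ v.hd.bval = a ∧ v.tl.bval = i

theorem IsPair.mono {L L' : ℕ} {v : Val} {a i : ℕ} (h : IsPair L v a i) (hL : L ≤ L') :
    IsPair L' v a i := ⟨h.1.mono hL, h.2.1.mono hL, h.2.2⟩

theorem IsPair.size_le {L : ℕ} {v : Val} {a i : ℕ} (h : IsPair L v a i) :
    v.size ≤ 8 * L + 3 := by
  have h₁ := h.1.size_le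
  have h₂ := h.2.1.size_le
  cases v <;> simp only [Val.hd, Val.tl, Val.size] at * <;> omega

theorem pairMin_ev : ∃ s, PB s ∧ ∀ (L : ℕ) (x v w : Val) (a i a' i' : ℕ), x.size ≤ L →
    IsPair L v a i → IsPair L w a' i' →
    ∃ y, Ev F.pairMin (.cons x (.cons v w)) y (s L) ∧ IsPair L y (min a a') (min i i') := by
  obtain ⟨s, hs, h⟩ := minSub_ev
  refine ⟨fun L => s L + s L + 1000 * (17 * L + 8), by fun_prop, ?_⟩
  rintro L x v w a i a' i' hx ⟨h₁, h₂, rfl, rfl⟩ ⟨h₃, h₄, rfl, rfl⟩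
  obtain ⟨m, d, e, hm, -, hmv, -⟩ := h L _ _ h₁ h₃
  obtain ⟨m', d', e', hm', -, hmv', -⟩ := h L _ _ h₂ h₄
  have hv := IsPair.size_le ⟨h₁, h₂, rfl, rfl⟩
  have hw := IsPair.size_le ⟨h₃, h₄, rfl, rfl⟩
  refine ⟨.cons m m', .cons (.hd (.comp (Ev.of_loopFree (f := .cons (.hd (.hd (.tl .var)))
    (.hd (.tl (.tl .var)))) rfl (.cons x (.cons v w))) e (u := s L + 100 * (17 * L + 8)) ?_ ?_))
    (.hd (.comp (Ev.of_loopFree (f := .cons (.tl (.hd (.tl .var)))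
    (.tl (.tl (.tl .var)))) rfl (.cons x (.cons v w))) e' (u := s L + 100 * (17 * L + 8)) ?_ ?_))
    ?_, hm, hm', hmv, hmv'⟩ <;>
  (try simp only [F.cost]) <;> (try simp only [Val.size]) <;> omega

theorem pairAdd_ev : ∃ s, PB s ∧ ∀ (L : ℕ) (x v w : Val) (a i a' i' : ℕ), x.size ≤ L →
    IsPair L v a i → IsPair L w a' i' →
    ∃ y, Ev F.pairAdd (.cons x (.cons v w)) y (s L) ∧ IsPair (L + 1) y (a + a') (i + i') := by
  obtain ⟨s, hs, h⟩ := add_ev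
  refine ⟨fun L => s L + s L + 1000 * (17 * L + 8), by fun_prop, ?_⟩
  rintro L x v w a i a' i' hx ⟨h₁, h₂, rfl, rfl⟩ ⟨h₃, h₄, rfl, rfl⟩
  obtain ⟨m, e, hm, hmv⟩ := h L _ _ h₁ h₃
  obtain ⟨m', e', hm', hmv'⟩ := h L _ _ h₂ h₄
  have hv := IsPair.size_le ⟨h₁, h₂, rfl, rfl⟩
  have hw := IsPair.size_le ⟨h₃, h₄, rfl, rfl⟩
  refine ⟨.cons m m', .cons (.comp (Ev.of_loopFree (f := .cons .nil (.cons (.hd (.hd (.tl .var)))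
    (.hd (.tl (.tl .var))))) rfl (.cons x (.cons v w))) e (u := s L + 100 * (17 * L + 8)) ?_ ?_)
    (.comp (Ev.of_loopFree (f := .cons .nil (.cons (.tl (.hd (.tl .var)))
    (.tl (.tl (.tl .var))))) rfl (.cons x (.cons v w))) e' (u := s L + 100 * (17 * L + 8)) ?_ ?_)
    ?_, hm, hm', hmv, hmv'⟩ <;>
  (try simp only [F.cost]) <;> (try simp only [Val.size]) <;> omega

theorem parity_cons (u : Fin k) (g : List (Fin k)) :
    parity (u :: g) = if Even g.length then .one else .nil := by
  by_cases h : Even g.length <;> simp [parity, Nat.even_add_one, h, Val.bit]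

/-- An exhausted list of symbols has value 0, which is neutral for sums but not for minima. Hence
the last symbol of the adversary returns its own value without taking a minimum. -/
theorem gameComb_ev : ∃ s, PB s ∧ ∀ (L m : ℕ) (u : Fin k) (us g : List (Fin k)) (ctx v w : Val)
    (a i a' i' : ℕ), (gameArg m (u :: us) g ctx).size ≤ L →
    IsPair L v a i → IsPair L w a' i' →
    ∃ y, Ev F.gameComb (.cons (gameArg m (u :: us) g ctx) (.cons v w)) y (s L) ∧
      IsPair (L + 1) y
        (if Even g.length then a + a' else if us = [] then a else min a a')
        (if Even g.length then i + i' else if us = [] then i else min i i') := by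
  obtain ⟨s, hs, h⟩ := pairMin_ev
  obtain ⟨t, ht, h'⟩ := pairAdd_ev
  refine ⟨fun L => s L + t L + 1000 * (17 * L + 8), by fun_prop, ?_⟩
  intro L m u us g ctx v w a i a' i' hx hv hw
  have sv := hv.size_le
  have sw := hw.size_le
  have hX : (Val.cons (gameArg m (u :: us) g ctx) (.cons v w)).size ≤ 17 * L + 8 := by
    simp only [Val.size]; omega
  generalize hst : Val.cons (gameArg m (u :: us) g ctx) (.cons v w) = st at hX
  have e₀ := Ev.of_loopFree (f := .hd (.tl (.tl (.hd .var)))) rfl st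
  have e₁ := Ev.of_loopFree (f := .tl (.hd (.tl (.hd .var)))) rfl st
  have e₂ := Ev.of_loopFree (f := .hd (.tl .var)) rfl st
  by_cases hg : Even g.length
  · obtain ⟨y, hy, hy'⟩ := h' L _ v w a i a' i' hx hv hw
    rw [hst] at hy
    refine ⟨y, .ite_false (s := 100 * (17 * L + 8)) (Ev.mono (s := F.cost (.hd (.tl (.tl (.hd
      .var)))) * st.size) ?_ ?_) hy ?_, by simpa [hg] using hy'⟩
    · convert e₀ using 1
      rw [← hst]
      simp [F.eval, gameArg, Val.hd, Val.tl, parity, hg, Val.bit]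
    · simp only [F.cost]; omega
    · beta_reduce; omega
  · have hp : F.eval (.hd (.tl (.tl (.hd .var)))) st ≠ .nil := by
      rw [← hst]
      simp [F.eval, gameArg, Val.hd, Val.tl, parity, hg, Val.bit]
    cases us with
    | nil =>
      refine ⟨v, .ite_true e₀ hp (.ite_false (s := 100 * (17 * L + 8)) (Ev.mono
        (s := F.cost (.tl (.hd (.tl (.hd .var)))) * st.size) ?_ ?_) (?_ : Ev _ _ v
          (100 * (17 * L + 8))) le_rfl) ?_, by simpa [hg] using hv.mono (Nat.le_succ L)⟩
      · convert e₁ using 1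
        rw [← hst]; rfl
      · simp only [F.cost]; omega
      · convert e₂.mono ?_ using 1
        · rw [← hst]; rfl
        · simp only [F.cost]; omega
      · simp only [F.cost]; omega
    | cons u' us =>
      obtain ⟨y, hy, hy'⟩ := h L _ v w a i a' i' hx hv hw
      rw [hst] at hy
      refine ⟨y, .ite_true e₀ hp (.ite_true e₁ (by rw [← hst]; simp [F.eval, gameArg, Val.hd,
        Val.tl, encWord, Val.ofList]) hy le_rfl) ?_, by simpa [hg] using hy'.mono (Nat.le_succ L)⟩
      simp only [F.cost]; omega

/-- Branching over k symbols is made binary: one branch plays the first symbol of `us`, the other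
drops it. Playing a symbol restores the full alphabet, so each remaining symbol of the play costs k
+ 1 levels. A level adds at most one digit to the values. -/
theorem gameVal_tree (k : ℕ) : ∃ s, PB s ∧ ∀ (Z : ℕ) (H S : Prog) (N : Val) (m : ℕ)
    (us g : List (Fin k)), Decides k Z (g.length + m) H → Decides k Z (g.length + m) S →
    N.IsBin Z → g.length + m ≤ Z → us.length ≤ k → k ≤ Z →
    ∃ v, RecTree F.gameBase F.gameLeaf (F.gameLeft k) F.gameRight F.gameComb (s Z)
      (m * (k + 1) + us.length) (gameArg m us g (gameCtx H S N)) v ∧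
      IsPair (20 * (k + 1) * (Z + 1) + m * (k + 1) + us.length) v
        (gameVal (leafA H S N.bval) m us g) (gameVal (leafI H N.bval) m us g) := by
  obtain ⟨s, hs, hleaf⟩ := gameLeaf_ev k
  obtain ⟨t, ht, hcomb⟩ := gameComb_ev (k := k)
  refine ⟨fun Z => s Z + t (20 * (k + 1) * (Z + 1) + Z * (k + 1) + k) + 100 * (20 * (k + 1) * (Z + 1)),
    by fun_prop, ?_⟩
  intro Z H S N m
  induction m with
  | zero =>
    intro us g hH hS hN hg hus hk
    obtain ⟨v, hv, h⟩ := hleaf Z H S N us g hH hS hN hg (hus.trans hk)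
    refine ⟨v, .leaf (by simp [F.gameBase, F.eval, gameArg, Val.unary, Val.hd])
      (hv.mono (by beta_reduce; omega)), IsPair.mono (L := Z) ?_ ?_⟩
    · simpa [IsPair, gameVal] using h
    · nlinarith
  | succ m ihm =>
    intro us
    induction us with
    | nil =>
      intro g hH hS hN hg hus hk
      -- With no symbols left the sum and the minimum are both 0, and `nil` reads as the pair (0, 0)
      -- because its two components are `nil`.
      refine ⟨.nil, .leaf (by simp [F.gameBase, F.eval, gameArg, encWord, Val.ofList, Val.unary,
        Val.hd, Val.tl]) (.ite_true (Ev.of_loopFree (f := .hd .var) rfl _)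
        (by simp [F.eval, gameArg, Val.unary, Val.hd]) (.nil le_rfl) ?_),
        .nil _, .nil _, ?_, ?_⟩
      · have := size_gameArg_le (m + 1) [] g (gameCtx H S N)
        have := size_gameCtx_le hH hS hN
        have := (gameArg (m + 1) [] g (gameCtx H S N)).one_le_size
        have h₃ : (2 * k + 1) * g.length ≤ (2 * k + 1) * Z := Nat.mul_le_mul_left _ (by omega)
        have h₄ : (gameArg (m + 1) [] g (gameCtx H S N)).size ≤ 20 * (k + 1) * (Z + 1) := by
          simp only [List.length_nil] at *
          nlinarith
        simp only [F.cost]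
        omega
      · by_cases hg : Even g.length <;> simp [gameVal, hg, minList, Val.hd, Val.bval]
      · by_cases hg : Even g.length <;> simp [gameVal, hg, minList, Val.tl, Val.bval]
    | cons u us ihus =>
      intro g hH hS hN hg hus hk
      simp only [List.length_cons] at hus
      have hlen : (u :: g).length + m = g.length + (m + 1) := by simp only [List.length_cons]; omega
      obtain ⟨v, tv, hv⟩ := ihm (List.finRange k) (u :: g) (hlen ▸ hH) (hlen ▸ hS) hN (by omega)
        (by simp) hk
      obtain ⟨w, tw, hw⟩ := ihus g hH hS hN hg (by omega) hk
      rw [List.length_finRange] at tv hv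
      have hsize : (gameArg (m + 1) (u :: us) g (gameCtx H S N)).size ≤
          20 * (k + 1) * (Z + 1) + (m + 1) * (k + 1) + us.length := by
        have := size_gameArg_le (m + 1) (u :: us) g (gameCtx H S N)
        have := size_gameCtx_le hH hS hN
        have h₃ : (2 * k + 1) * g.length ≤ (2 * k + 1) * Z := Nat.mul_le_mul_left _ (by omega)
        have h₄ : (2 * k + 1) * (us.length + 1) ≤ (2 * k + 1) * Z :=
          Nat.mul_le_mul_left _ (by omega)
        simp only [List.length_cons] at *
        nlinarith
      have hmul : (m + 1) * (k + 1) = m * (k + 1) + (k + 1) := by ring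
      obtain ⟨y, hy, hyp⟩ := hcomb _ (m + 1) u us g (gameCtx H S N) v w _ _ _ _ hsize
        (hv.mono (by omega)) hw
      refine ⟨y, .node (d := (m + 1) * (k + 1) + us.length) (vl := v) (vr := w) rfl ?_ tw (hy.mono ?_), ?_⟩
      · have hl : (F.gameLeft k).eval (gameArg (m + 1) (u :: us) g (gameCtx H S N)) =
            gameArg m (List.finRange k) (u :: g) (gameCtx H S N) := by
          by_cases hg : Even g.length <;>
          simp [F.gameLeft, F.eval, gameArg, Val.hd, Val.tl, parity, Val.bit, hg, Nat.even_add_one,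
            Val.unary, encWord, Val.ofList]
        rw [hl]
        exact tv.mono le_rfl (by omega)
      · have h₁ : t (20 * (k + 1) * (Z + 1) + (m + 1) * (k + 1) + us.length) ≤
            t (20 * (k + 1) * (Z + 1) + Z * (k + 1) + k) := by
          refine ht.mono ?_
          have := Nat.mul_le_mul_right (k + 1) (show m + 1 ≤ Z by omega)
          omega
        beta_reduce
        omega
      · refine IsPair.mono (L := 20 * (k + 1) * (Z + 1) + (m + 1) * (k + 1) + us.length + 1) ?_
          (by simp only [List.length_cons]; omega)
        convert hyp using 1
        · by_cases hg : Even g.length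
          · simp [gameVal, hg]
          · cases us <;> simp [gameVal, hg, minList]
        · by_cases hg : Even g.length
          · simp [gameVal, hg]
          · cases us <;> simp [gameVal, hg, minList]

theorem gameVal_ev (k : ℕ) : ∃ s L, PB s ∧ PB L ∧ ∀ (Z : ℕ) (H S : Prog) (N : Val) (m : ℕ)
    (g : List (Fin k)), Decides k Z (g.length + m) H → Decides k Z (g.length + m) S →
    N.IsBin Z → g.length + m ≤ Z → k ≤ Z →
    ∃ v, Ev (F.gameVal k) (gameArg m (List.finRange k) g (gameCtx H S N)) v (s Z) ∧
      IsPair (L Z) v (gameVal (leafA H S N.bval) m (List.finRange k) g)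
        (gameVal (leafI H N.bval) m (List.finRange k) g) := by
  obtain ⟨s, hs, h⟩ := gameVal_tree k
  refine ⟨fun Z => 18 * (recCost F.gameBase (F.gameLeft k) F.gameRight + 1) *
    ((Z * (k + 1) + k + 1) * s Z), fun Z => 20 * (k + 1) * (Z + 1) + Z * (k + 1) + k, by fun_prop,
    by fun_prop, ?_⟩
  intro Z H S N m g hH hS hN hg hk
  obtain ⟨v, tv, hv⟩ := h Z H S N m (List.finRange k) g hH hS hN hg (by simp) hk
  rw [List.length_finRange] at tv hv
  have hm := Nat.mul_le_mul_right (k + 1) (show m ≤ Z by omega)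
  exact ⟨v, (tv.mono le_rfl (by omega)).ev rfl (by simp [F.gameLeft, F.loopFree]) rfl,
    hv.mono (by beta_reduce; omega)⟩


/-! ### Distribution of weight -/

/-- The weight `m` is distributed greedily over the symbols of a list, where `u` has capacity
`c u`. -/
def fill (m : ℕ) (c : Fin k → ℕ) : List (Fin k) → Fin k → ℕ
  | [], _ => 0
  | v :: t, u => if u = v then min m (c v) else fill (m - c v) c t u

/-- The order in which weight is distributed. -/
def symbols (k : ℕ) : List (Fin k) := (List.finRange k).reverse

/-- The weight `M` is distributed over all symbols, first up to the capacities `a`, with sum `A`,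
and then up to the capacities `i`. -/
def alloc (M A : ℕ) (a i : Fin k → ℕ) (u : Fin k) : ℕ :=
  fill M a (symbols k) u + fill (M - A) (fun v => i v - a v) (symbols k) u

/-- The value of the continuation of `g` by a symbol. -/
def childVal (leaf : List (Fin k) → ℕ) (n : ℕ) (g : List (Fin k)) (u : Fin k) : ℕ :=
  gameVal leaf (n - (g.length + 1)) (List.finRange k) (u :: g)

/-- The weight that the improviser gives to a history (in reverse order), for plays of length `n`
with total weight `D`. -/
def mass (lA lI : List (Fin k) → ℕ) (n D : ℕ) : List (Fin k) → ℕ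
  | [] => D
  | u :: g => if Even g.length then
      alloc (mass lA lI n D g) (gameVal lA (n - g.length) (List.finRange k) g) (childVal lA n g)
        (childVal lI n g) u
    else mass lA lI n D g

/-! ### Programs for the weights of continuations -/

/-- The distribution of weight to one symbol; the argument is
`(symbols, (results, ((m₁, m₂), (remaining length, (history, context)))))`. -/
def F.weightsBody (k : ℕ) : F :=
  .bind (F.gameVal k)
    (.cons (.hd (.tl (.tl (.tl .var)))) (.cons (F.const (encWord (List.finRange k)))
      (.cons .one (.cons (.cons (.hd (.hd .var)) (.hd (.tl (.tl (.tl (.tl .var))))))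
        (.tl (.tl (.tl (.tl (.tl .var)))))))))
  (.bind .minSub (.cons (.tl (.hd .var)) (.hd (.hd .var)))
  (.bind .minSub (.cons (.hd (.hd (.tl (.tl (.tl (.tl .var)))))) (.hd (.hd (.tl .var))))
  (.bind .minSub (.cons (.tl (.hd (.tl (.tl (.tl (.tl (.tl .var))))))) (.tl (.hd (.tl .var))))
  (.bind .add (.cons .nil (.cons (.hd (.hd (.tl .var))) (.hd (.hd .var))))
    (.cons (.tl (.hd (.tl (.tl (.tl (.tl (.tl .var)))))))
      (.cons (.cons (.hd .var) (.hd (.tl (.tl (.tl (.tl (.tl (.tl .var))))))))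
        (.cons (.cons (.tl (.hd (.tl (.tl .var)))) (.tl (.hd (.tl .var))))
          (.tl (.tl (.tl (.tl (.tl (.tl (.tl (.tl .var))))))))))))))) 

/-- The distribution of the weight of a history: on `(M, (remaining length, (history, context)))`
the list of the weights of its continuations. -/
def F.weights (k : ℕ) : F :=
  .bind (F.gameVal k)
    (.cons (.hd (.tl .var)) (.cons (F.const (encWord (List.finRange k))) (.cons .nil
      (.tl (.tl .var)))))
  (.bind .minSub (.cons (.hd (.tl .var)) (.hd (.hd .var)))
  (.hd (.tl (.comp (.iter (F.weightsBody k))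
    (.cons (F.const (encWord (symbols k))) (.cons .nil (.cons
      (.cons (.hd (.tl (.tl .var))) (.tl (.hd .var)))
      (.cons (.tl (.hd (.tl (.tl (.tl .var))))) (.tl (.tl (.tl (.tl .var))))))))))))

/-- The state of the loop of `F.weights`. -/
def weightsState (t : List (Fin k)) (acc : List Val) (m₁ m₂ : Val) (m : ℕ) (g : List (Fin k))
    (ctx : Val) : Val :=
  .cons (encWord t) (.cons (.ofList acc) (.cons (.cons m₁ m₂) (.cons (.unary m)
    (.cons (encWord g) ctx))))

theorem size_ofList_le {B : ℕ} (l : List Val) (h : ∀ v ∈ l, v.size ≤ B) :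
    (Val.ofList l).size ≤ (B + 1) * l.length + 1 := by
  induction l with
  | nil => simp [Val.ofList, Val.size]
  | cons a l ih =>
    simp only [List.mem_cons, forall_eq_or_imp] at h
    have := ih h.2
    simp only [Val.ofList, Val.size, List.length_cons, Nat.mul_succ]
    omega

/-- One step of both greedy fillings at once. The residual weights are truncated differences, which
do not get longer, so the digit bound B survives the whole loop. -/
theorem weightsBody_ev (k : ℕ) : ∃ s L, PB s ∧ PB L ∧ ∀ (Z B Q : ℕ) (H S : Prog) (N : Val) (m : ℕ)
    (u : Fin k) (t g : List (Fin k)) (acc : List Val) (m₁ m₂ : Val),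
    Decides k Z (g.length + 1 + m) H → Decides k Z (g.length + 1 + m) S →
    N.IsBin Z → g.length + 1 + m ≤ Z → k ≤ Z → Even g.length → L Z ≤ B → m₁.IsBin B → m₂.IsBin B →
    B ≤ Q → (weightsState (u :: t) acc m₁ m₂ m g (gameCtx H S N)).size ≤ Q →
    ∃ w m₁' m₂', Ev (F.weightsBody k) (weightsState (u :: t) acc m₁ m₂ m g (gameCtx H S N))
        (weightsState t (w :: acc) m₁' m₂' m g (gameCtx H S N)) (s (Z + Q)) ∧
      w.IsBin (B + 1) ∧ m₁'.IsBin B ∧ m₂'.IsBin B ∧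
      w.bval = min m₁.bval (gameVal (leafA H S N.bval) m (List.finRange k) (u :: g)) +
        min m₂.bval (gameVal (leafI H N.bval) m (List.finRange k) (u :: g) -
          gameVal (leafA H S N.bval) m (List.finRange k) (u :: g)) ∧
      m₁'.bval = m₁.bval - gameVal (leafA H S N.bval) m (List.finRange k) (u :: g) ∧
      m₂'.bval = m₂.bval - (gameVal (leafI H N.bval) m (List.finRange k) (u :: g) -
          gameVal (leafA H S N.bval) m (List.finRange k) (u :: g)) := by
  obtain ⟨s, L, hs, hL, hV⟩ := gameVal_ev k
  obtain ⟨s₁, hs₁, h₁⟩ := minSub_ev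
  obtain ⟨s₂, hs₂, h₂⟩ := add_ev
  have hcost : ∃ c, c = (F.const (encWord (List.finRange k))).cost := ⟨_, rfl⟩
  obtain ⟨c, hc⟩ := hcost
  refine ⟨fun Z => s Z + 3 * s₁ Z + s₂ Z + (c + 10000) * (100 * Z + 100), L, by fun_prop, hL, ?_⟩
  intro Z B Q H S N m u t g acc m₁ m₂ hH hS hN hg hk he hLB hm₁ hm₂ hBQ hX
  obtain ⟨v, ev, hv₁, hv₂, hv₃, hv₄⟩ := hV Z H S N m (u :: g) (by simpa using hH)
    (by simpa using hS) hN (by simpa using hg) hk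
  have hv₁' := hv₁.mono hLB
  have hv₂' := hv₂.mono hLB
  obtain ⟨dm, d, ed, hdm, hd, -, hdv⟩ := h₁ B _ _ hv₂' hv₁'
  obtain ⟨x₁, y₁, e₁, hx₁, hy₁, hxv₁, hyv₁⟩ := h₁ B _ _ hm₁ hv₁'
  obtain ⟨x₂, y₂, e₂, hx₂, hy₂, hxv₂, hyv₂⟩ := h₁ B _ _ hm₂ hd
  obtain ⟨w, ew, hw, hwv⟩ := h₂ B _ _ hx₁ hx₂
  have z₀ := (IsPair.mono ⟨hv₁, hv₂, hv₃, hv₄⟩ hLB).size_le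
  have z₁ := hdm.size_le
  have z₂ := hd.size_le
  have z₃ := hx₁.size_le
  have z₄ := hy₁.size_le
  have z₅ := hx₂.size_le
  have z₆ := hy₂.size_le
  have z₇ := hw.size_le
  have t₀ : s Z ≤ s (Z + Q) := hs.mono (by omega)
  have t₁ : s₁ B ≤ s₁ (Z + Q) := hs₁.mono (by omega)
  have t₂ : s₂ B ≤ s₂ (Z + Q) := hs₂.mono (by omega)
  generalize hst : weightsState (u :: t) acc m₁ m₂ m g (gameCtx H S N) = st at hX
  have harg : (F.cons (.hd (.tl (.tl (.tl .var)))) (.cons (F.const (encWord (List.finRange k)))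
      (.cons .one (.cons (.cons (.hd (.hd .var)) (.hd (.tl (.tl (.tl (.tl .var))))))
        (.tl (.tl (.tl (.tl (.tl .var))))))))).eval st =
      gameArg m (List.finRange k) (u :: g) (gameCtx H S N) := by
    rw [← hst, gameArg, parity_cons]
    simp [F.eval, weightsState, he, Val.hd, Val.tl, encWord, Val.ofList]
  rw [← harg] at ev
  have c₅ := Ev.bind (a := .cons .nil (.cons (.hd (.hd (.tl .var))) (.hd (.hd .var))))
    (k := .cons (.tl (.hd (.tl (.tl (.tl (.tl (.tl .var)))))))
      (.cons (.cons (.hd .var) (.hd (.tl (.tl (.tl (.tl (.tl (.tl .var))))))))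
        (.cons (.cons (.tl (.hd (.tl (.tl .var)))) (.tl (.hd (.tl .var))))
          (.tl (.tl (.tl (.tl (.tl (.tl (.tl (.tl .var)))))))))))
    (x := .cons (.cons x₂ y₂) (.cons (.cons x₁ y₁) (.cons (.cons dm d) (.cons v st)))) rfl ew
    (Ev.of_loopFree rfl _)
  have heval : F.eval (.cons (.tl (.hd (.tl (.tl (.tl (.tl (.tl .var)))))))
      (.cons (.cons (.hd .var) (.hd (.tl (.tl (.tl (.tl (.tl (.tl .var))))))))
        (.cons (.cons (.tl (.hd (.tl (.tl .var)))) (.tl (.hd (.tl .var))))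
          (.tl (.tl (.tl (.tl (.tl (.tl (.tl (.tl .var)))))))))))
      (.cons w (.cons (.cons x₂ y₂) (.cons (.cons x₁ y₁) (.cons (.cons dm d) (.cons v st))))) =
      weightsState t (w :: acc) y₁ y₂ m g (gameCtx H S N) := by
    rw [← hst]; rfl
  rw [heval] at c₅
  have c₄ := Ev.bind
    (a := .cons (.tl (.hd (.tl (.tl (.tl (.tl (.tl .var))))))) (.tl (.hd (.tl .var))))
    (x := .cons (.cons x₁ y₁) (.cons (.cons dm d) (.cons v st))) rfl (by rw [← hst]; exact e₂) c₅
  have c₃ := Ev.bind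
    (a := .cons (.hd (.hd (.tl (.tl (.tl (.tl .var)))))) (.hd (.hd (.tl .var))))
    (x := .cons (.cons dm d) (.cons v st)) rfl (by rw [← hst]; exact e₁) c₄
  have c₂ := Ev.bind (a := .cons (.tl (.hd .var)) (.hd (.hd .var)))
    (x := .cons v st) rfl (by exact ed) c₃
  have c₁ := Ev.bind (by simp [F.loopFree]) ev c₂
  refine ⟨w, y₁, y₂, c₁.mono ?_, hw, hy₁, hy₂, ?_, ?_, ?_⟩
  · simp only [F.cost, Val.size, ← hc]
    have b₁ := Nat.mul_le_mul_left c (show st.size ≤ 100 * (Z + Q) + 100 by omega)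
    simp only [add_mul] at *
    omega
  · rw [hwv, hxv₁, hxv₂, hdv, hv₃, hv₄]
  · rw [hyv₁, hv₃]
  · rw [hyv₂, hdv, hv₃, hv₄]

/-- Results are pushed in front of the accumulator, so they come out in reverse order. This is why
`symbols` lists the alphabet backwards. Distinctness of the symbols lets the results be collected in
a function of the symbol. -/
theorem weights_loop (k : ℕ) : ∃ s L, PB s ∧ PB L ∧ ∀ (Z B : ℕ) (H S : Prog) (N : Val) (m : ℕ)
    (g : List (Fin k)),
    Decides k Z (g.length + 1 + m) H → Decides k Z (g.length + 1 + m) S →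
    N.IsBin Z → g.length + 1 + m ≤ Z → k ≤ Z → Even g.length → L Z ≤ B →
    ∀ (t : List (Fin k)) (acc : List Val) (m₁ m₂ : Val), t.Nodup → acc.length + t.length ≤ k →
    (∀ w ∈ acc, w.IsBin (B + 1)) → m₁.IsBin B → m₂.IsBin B →
    ∃ (w : Fin k → Val) (z : Val),
      Ev (.iter (F.weightsBody k)) (weightsState t acc m₁ m₂ m g (gameCtx H S N))
        (.cons .nil (.cons (.ofList (t.reverse.map w ++ acc)) z)) (s (Z + B)) ∧
      ∀ u ∈ t, (w u).IsBin (B + 1) ∧ (w u).bval =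
        fill m₁.bval (fun v => gameVal (leafA H S N.bval) m (List.finRange k) (v :: g)) t u +
        fill m₂.bval (fun v => gameVal (leafI H N.bval) m (List.finRange k) (v :: g) -
          gameVal (leafA H S N.bval) m (List.finRange k) (v :: g)) t u := by
  obtain ⟨s, L, hs, hL, hb⟩ := weightsBody_ev k
  refine ⟨fun Y => s (Y + ((2 * k + 1) * k + 1 + ((4 * Y + 6) * k + 1) + (2 * k + 1) * Y + 100 * Y
    + 100)) + ((2 * k + 1) * k + 1 + ((4 * Y + 6) * k + 1) + (2 * k + 1) * Y + 100 * Y + 100), L,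
    by fun_prop, hL, ?_⟩
  intro Z B H S N m g hH hS hN hg hk he hLB t
  have hsize : ∀ (t : List (Fin k)) (acc : List Val) (m₁ m₂ : Val), acc.length + t.length ≤ k →
      (∀ w ∈ acc, w.IsBin (B + 1)) → m₁.IsBin B → m₂.IsBin B →
      (weightsState t acc m₁ m₂ m g (gameCtx H S N)).size ≤ (2 * k + 1) * k + 1 +
        ((4 * (Z + B) + 6) * k + 1) + (2 * k + 1) * (Z + B) + 100 * (Z + B) + 100 := by
    intro t acc m₁ m₂ hlen hacc hm₁ hm₂
    have h₁ := size_encWord_le t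
    have h₂ : _ ≤ (4 * (Z + B) + 6) * acc.length + 1 := size_ofList_le (B := 4 * (Z + B) + 5) acc
      (fun w hw => (hacc w hw).size_le.trans (by omega))
    have h₃ := hm₁.size_le
    have h₄ := hm₂.size_le
    have h₅ := size_unary m
    have h₆ := size_encWord_le g
    have h₇ := size_gameCtx_le hH hS hN
    have h₈ := Nat.mul_le_mul_left (2 * k + 1) (show t.length ≤ k by omega)
    have h₉ := Nat.mul_le_mul_left (4 * (Z + B) + 6) (show acc.length ≤ k by omega)
    have h₁₀ := Nat.mul_le_mul_left (2 * k + 1) (show g.length ≤ Z + B by omega)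
    simp only [weightsState, Val.size]
    omega
  induction t with
  | nil =>
    intro acc m₁ m₂ _ hlen hacc hm₁ hm₂
    refine ⟨fun _ => .nil, _, .iter_done rfl ?_, by simp⟩
    exact (hsize [] acc m₁ m₂ hlen hacc hm₁ hm₂).trans (Nat.le_add_left _ _)
  | cons u t ih =>
    intro acc m₁ m₂ ht hlen hacc hm₁ hm₂
    have hX := hsize (u :: t) acc m₁ m₂ hlen hacc hm₁ hm₂
    rw [List.nodup_cons] at ht
    obtain ⟨w, y₁, y₂, ew, hw, hy₁, hy₂, hwv, hyv₁, hyv₂⟩ :=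
      hb Z B _ H S N m u t g acc m₁ m₂ hH hS hN hg hk he hLB hm₁ hm₂ (by omega) hX
    obtain ⟨w', z, e, hw'⟩ := ih (w :: acc) y₁ y₂ ht.2
      (by simp only [List.length_cons] at *; omega)
      (by simpa using ⟨hw, hacc⟩) hy₁ hy₂
    have hne : ∀ v ∈ t, v ≠ u := fun v hv h => ht.1 (h ▸ hv)
    refine ⟨Function.update w' u w, z, .iter_step (by simp [weightsState, encWord, Val.ofList,
      Val.hd]) (ew.mono (t := s (Z + B + ((2 * k + 1) * k + 1 + ((4 * (Z + B) + 6) * k + 1) +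
        (2 * k + 1) * (Z + B) + 100 * (Z + B) + 100))) (hs.mono (by omega))) (?_ : Ev _ _ _ _)
        (Nat.le_add_right _ _) le_rfl, ?_⟩
    · convert e using 4
      rw [List.reverse_cons, List.map_append, List.append_assoc]
      congr 1
      · refine List.map_congr_left fun v hv => ?_
        rw [Function.update_of_ne (hne v (by simpa using hv))]
      · simp
    · intro v hv
      rcases List.mem_cons.1 hv with rfl | hv
      · rw [Function.update_self]
        exact ⟨hw, by simp [hwv, fill]⟩
      · rw [Function.update_of_ne (hne v hv)]
        obtain ⟨h₁, h₂⟩ := hw' v hv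
        refine ⟨h₁, ?_⟩
        rw [h₂, hyv₁, hyv₂]
        simp [fill, hne v hv]

theorem nodup_symbols (k : ℕ) : (symbols k).Nodup := by
  simpa [symbols] using List.nodup_finRange k

theorem mem_symbols (u : Fin k) : u ∈ symbols k := by simp [symbols]

theorem weights_ev (k : ℕ) : ∃ s L, PB s ∧ PB L ∧ ∀ (Z B n : ℕ) (H S : Prog) (N M : Val)
    (g : List (Fin k)), Decides k Z n H → Decides k Z n S →
    N.IsBin Z → n ≤ Z → k ≤ Z → g.length < n → Even g.length → L Z ≤ B → M.IsBin B →
    ∃ w : Fin k → Val,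
      Ev (F.weights k) (.cons M (.cons (.unary (n - g.length)) (.cons (encWord g)
        (gameCtx H S N)))) (.ofList ((List.finRange k).map w)) (s (Z + B)) ∧
      ∀ u, (w u).IsBin (B + 1) ∧ (w u).bval =
        alloc M.bval (gameVal (leafA H S N.bval) (n - g.length) (List.finRange k) g)
          (childVal (leafA H S N.bval) n g) (childVal (leafI H N.bval) n g) u := by
  obtain ⟨s, L, hs, hL, hV⟩ := gameVal_ev k
  obtain ⟨s₁, hs₁, h₁⟩ := minSub_ev
  obtain ⟨s₂, L₂, hs₂, hL₂, h₂⟩ := weights_loop k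
  obtain ⟨c, hc⟩ : ∃ c, c = (F.const (encWord (List.finRange k))).cost := ⟨_, rfl⟩
  obtain ⟨c', hc'⟩ : ∃ c, c = (F.const (encWord (symbols k))).cost := ⟨_, rfl⟩
  refine ⟨fun Z => s Z + s₁ Z + s₂ Z + (c + c' + 10000) * (2 * k * Z + 100 * Z + 100),
    fun Z => L Z + L₂ Z, by fun_prop, by fun_prop, ?_⟩
  intro Z B n H S N M g hH hS hN hn hk hg he hLB hM
  beta_reduce at hLB
  obtain ⟨m, hm⟩ : ∃ m, n - g.length = m + 1 := ⟨n - g.length - 1, by omega⟩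
  have hlen : g.length + (m + 1) = n := by omega
  have hlen' : g.length + 1 + m = n := by omega
  have hchild : n - (g.length + 1) = m := by omega
  obtain ⟨v, ev, hv₁, hv₂, hv₃, hv₄⟩ := hV Z H S N (m + 1) g (by rwa [hlen])
    (by rwa [hlen]) hN (by omega) hk
  have hv := IsPair.mono ⟨hv₁, hv₂, hv₃, hv₄⟩ (show L Z ≤ B by omega)
  -- `y` is the truncated difference of the weight and the A-value, the budget of the second
  -- filling.
  obtain ⟨x, y, e₁, hx, hy, -, hyv⟩ := h₁ B _ _ hM hv.1
  obtain ⟨w, z, e₂, hw⟩ := h₂ Z B H S N m g (by rwa [hlen']) (by rwa [hlen']) hN (by omega) hk he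
    (by omega) (symbols k) [] M y (nodup_symbols k) (by simp [symbols]) (by simp) hM hy
  have z₀ := hv.size_le
  have z₁ := hx.size_le
  have z₂ := hy.size_le
  have z₃ := hM.size_le
  have z₄ := size_unary (m + 1)
  have z₅ := size_encWord_le g
  have z₆ := size_gameCtx_le hH hS hN
  have t₀ : s Z ≤ s (Z + B) := hs.mono (by omega)
  have t₁ : s₁ B ≤ s₁ (Z + B) := hs₁.mono (by omega)
  refine ⟨w, ?_, fun u => ?_⟩
  · rw [hm]
    generalize hst : Val.cons M (.cons (.unary (m + 1)) (.cons (encWord g) (gameCtx H S N))) = st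
    have hX : st.size ≤ 2 * k * Z + 20 * (Z + B) + 20 := by
      have := Nat.mul_le_mul_left (2 * k + 1) (show g.length ≤ Z by omega)
      have h2k : (2 * k + 1) * Z = 2 * k * Z + Z := by ring
      rw [← hst]
      simp only [Val.size]
      omega
    have harg : (F.cons (.hd (.tl .var)) (.cons (F.const (encWord (List.finRange k))) (.cons .nil
        (.tl (.tl .var))))).eval st = gameArg (m + 1) (List.finRange k) g (gameCtx H S N) := by
      rw [← hst, gameArg]
      simp [F.eval, parity, he, Val.bit, Val.hd, Val.tl]
    rw [← harg] at ev
    have harg' : (F.cons (F.const (encWord (symbols k))) (.cons .nil (.cons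
        (.cons (.hd (.tl (.tl .var))) (.tl (.hd .var)))
        (.cons (.tl (.hd (.tl (.tl (.tl .var))))) (.tl (.tl (.tl (.tl .var)))))))).eval
        (.cons (.cons x y) (.cons v st)) =
        weightsState (symbols k) [] M y m g (gameCtx H S N) := by
      rw [← hst]
      simp [F.eval, weightsState, Val.hd, Val.tl, Val.unary, Val.ofList]
    rw [← harg'] at e₂
    have c₃ := Ev.comp (Ev.of_loopFree (by simp [F.loopFree]) _) e₂ (Nat.le_add_left _ _)
      (Nat.le_add_right _ _)
    have c₂ := Ev.bind (a := .cons (.hd (.tl .var)) (.hd (.hd .var))) (x := .cons v st) rfl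
      (by rw [← hst]; exact e₁) (.hd (.tl c₃))
    have c₁ := Ev.bind (by simp [F.loopFree]) ev c₂
    have hres : (Val.cons .nil (.cons (.ofList ((symbols k).reverse.map w ++ [])) z)).tl.hd =
        .ofList ((List.finRange k).map w) := by
      simp [symbols, Val.tl, Val.hd]
    rw [hres] at c₁
    refine Ev.mono c₁ ?_
    simp only [F.cost, Val.size, ← hc, ← hc']
    obtain ⟨Y, hY⟩ : ∃ Y, Y = 2 * k * (Z + B) + 100 * (Z + B) + 100 := ⟨_, rfl⟩
    have hXY : st.size + 20 * (Z + B) + 20 ≤ Y := by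
      have := Nat.mul_le_mul_left (2 * k) (Nat.le_add_right Z B)
      omega
    have b₁ : (c' + (1 + (1 + 1 + 2 + (1 + 1 + 2) + 2) + 2) + 2) *
        (x.size + y.size + 1 + (v.size + st.size + 1) + 1) ≤ (c' + 100) * Y :=
      Nat.mul_le_mul (by omega) (by omega)
    have b₂ : (1 + (c + (1 + 1 + 2) + 2) + 2 + 2) * st.size ≤ (c + 100) * Y :=
      Nat.mul_le_mul (by omega) (by omega)
    have b₃ : (c + c' + 10000) * Y = (c' + 100) * Y + (c + 100) * Y + 9800 * Y := by ring
    rw [← hY]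
    omega
  · obtain ⟨h₁, h₂⟩ := hw u (mem_symbols u)
    refine ⟨h₁, ?_⟩
    rw [h₂, hyv, hv₃, alloc, hm]
    unfold childVal
    rw [hchild]


/-! ### Programs for the weight of a history -/

/-- On `(i, l)` the entry of the list `l` with the unary index `i`. -/
def F.lookup : F := .hd (.tl (.iter (.cons (.tl (.hd .var)) (.tl (.tl .var)))))

theorem lookup_ev {l : List Val} {i : ℕ} (hi : i < l.length) {s : ℕ}
    (hs : 10 * (Val.cons (.unary i) (.ofList l)).size ≤ s) :
    Ev .lookup (.cons (.unary i) (.ofList l)) l[i] s := by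
  suffices h : ∃ r, Ev (.iter (.cons (.tl (.hd .var)) (.tl (.tl .var))))
      (.cons (.unary i) (.ofList l)) (.cons .nil (.cons l[i] r)) s by
    obtain ⟨r, h⟩ := h
    exact .hd (.tl h)
  induction i generalizing l with
  | zero =>
    cases l with
    | nil => simp at hi
    | cons a l => exact ⟨_, .iter_done rfl (by simp only [Val.unary, Val.ofList] at *; omega)⟩
  | succ i ih =>
    cases l with
    | nil => simp at hi
    | cons a l =>
      simp only [List.length_cons, Nat.add_lt_add_iff_right] at hi
      obtain ⟨r, h⟩ := ih hi (by simp only [Val.unary, Val.ofList, Val.size] at *; omega)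
      refine ⟨r, .iter_step (by simp [Val.hd, Val.unary]) (Ev.of_loopFree rfl _) h ?_ le_rfl⟩
      simp only [F.cost]; omega

/-- The combination function for the weight of histories. -/
def F.massComb (k : ℕ) : F :=
  .cons (.ite (.hd (.tl (.tl (.tl .var)))) (.hd (.tl (.tl .var)))
    (.comp .lookup (.cons (.hd (.hd (.hd .var))) (.comp (.weights k)
      (.cons (.hd (.tl (.tl .var))) (.cons (.tl (.tl (.tl (.tl .var))))
        (.cons (.tl (.hd (.hd .var))) (.tl (.tl (.tl (.hd .var)))))))))))
    (.cons (.ite (.hd (.tl (.tl (.tl .var)))) .nil .one) (.tl (.tl (.tl (.tl (.tl .var))))))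

/-- The base case for the weight of histories. -/
def F.massBase : F := .ite (.hd .var) .nil .one

/-- The weight of the empty history. -/
def F.massNil : F := .cons (.hd (.tl (.tl .var))) (.cons .nil (.hd (.tl .var)))

/-- The recursive argument for the weight of histories. -/
def F.massRec : F := .cons (.tl (.hd .var)) (.tl .var)

/-- The weight of a history: on `(history, (length, (total weight, context)))` the weight, the
parity and the number of remaining symbols. -/
def F.mass (k : ℕ) : F := .recur .massBase .massNil .nil .massRec (.massComb k)

/-- At our turn the weights of all continuations are computed and the one for `u` is looked up; at
the adversary's turn the weight is copied. The parity and the number of remaining symbols travel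
with the weight because the next level needs them. -/
theorem massComb_ev (k : ℕ) : ∃ s L, PB s ∧ PB L ∧ ∀ (Z B n : ℕ) (H S : Prog) (N M v : Val)
    (u : Fin k) (g : List (Fin k)) (d : Val), Decides k Z n H → Decides k Z n S →
    N.IsBin Z → n ≤ Z → k ≤ Z → g.length < n → L Z ≤ B → M.IsBin B → d.size ≤ B → v.size ≤ B →
    ∃ M' : Val,
      Ev (F.massComb k) (.cons (.cons (encWord (u :: g)) (.cons (.unary n) (.cons d
        (gameCtx H S N)))) (.cons v (.cons M (.cons (parity g) (.unary (n - g.length))))))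
        (.cons M' (.cons (parity (u :: g)) (.unary (n - (u :: g).length)))) (s (Z + B)) ∧
      M'.IsBin (B + 1) ∧ M'.bval = if Even g.length then
        alloc M.bval (gameVal (leafA H S N.bval) (n - g.length) (List.finRange k) g)
          (childVal (leafA H S N.bval) n g) (childVal (leafI H N.bval) n g) u else M.bval := by
  obtain ⟨s, L, hs, hL, hW⟩ := weights_ev k
  refine ⟨fun Y => 100 * s Y + 10000 * (2 * k * Y + 100 * Y + 100 * k + 100), L,
    by fun_prop, hL, ?_⟩
  intro Z B n H S N M v u g d hH hS hN hn hk hg hLB hM hd hv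
  beta_reduce
  obtain ⟨m, hm⟩ : ∃ m, n - g.length = m + 1 := ⟨n - g.length - 1, by omega⟩
  have hm' : n - (u :: g).length = m := by simp only [List.length_cons]; omega
  obtain ⟨st, hst⟩ : ∃ st, st = Val.cons (.cons (encWord (u :: g)) (.cons (.unary n) (.cons d
        (gameCtx H S N)))) (.cons v (.cons M (.cons (parity g) (.unary (n - g.length))))) :=
    ⟨_, rfl⟩
  have hX : st.size ≤ 2 * k * (Z + B) + 30 * (Z + B) + 50 := by
    have h₁ := size_encWord_le (u :: g)
    have h₂ := size_unary n
    have h₃ := size_unary (n - g.length)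
    have h₄ := size_gameCtx_le hH hS hN
    have h₅ := hM.size_le
    have h₆ : (parity g).size ≤ 3 := by
      unfold parity; cases decide (¬ Even g.length) <;> simp [Val.bit, Val.size]
    have h₇ := Nat.mul_le_mul_left (2 * k + 1) (show (u :: g).length ≤ Z + B by
      simp only [List.length_cons]; omega)
    have h₈ : (2 * k + 1) * (Z + B) = 2 * k * (Z + B) + (Z + B) := by ring
    rw [hst]
    simp only [Val.size]
    omega
  rw [← hst]
  have e₀ := Ev.of_loopFree (f := .hd (.tl (.tl (.tl .var)))) rfl st
  have e₁ := Ev.of_loopFree (f := .hd (.tl (.tl .var))) rfl st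
  have e₂ := Ev.of_loopFree (f := .cons (.ite (.hd (.tl (.tl (.tl .var)))) .nil .one)
    (.tl (.tl (.tl (.tl (.tl .var)))))) rfl st
  have e₃ := Ev.of_loopFree (f := .hd (.hd (.hd .var))) rfl st
  have e₄ := Ev.of_loopFree (f := .cons (.hd (.tl (.tl .var))) (.cons (.tl (.tl (.tl (.tl .var))))
        (.cons (.tl (.hd (.hd .var))) (.tl (.tl (.tl (.hd .var))))))) rfl st
  have v₂ : F.eval (.cons (.ite (.hd (.tl (.tl (.tl .var)))) .nil .one)
      (.tl (.tl (.tl (.tl (.tl .var)))))) st =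
      .cons (parity (u :: g)) (.unary (n - (u :: g).length)) := by
    rw [hm', hst, hm]
    by_cases he : Even g.length <;>
    simp [F.eval, Val.hd, Val.tl, parity, he, Nat.even_add_one, Val.bit, Val.unary]
  rw [v₂] at e₂
  by_cases he : Even g.length
  · obtain ⟨w, ew, hw⟩ := hW Z B n H S N M g hH hS hN hn hk hg he hLB hM
    have hl := lookup_ev (l := (List.finRange k).map w) (i := u) (by simp) le_rfl
    have v₀ : F.eval (.hd (.tl (.tl (.tl .var)))) st = .nil := by
      rw [hst]
      simp [F.eval, Val.hd, Val.tl, parity, he, Val.bit]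
    rw [v₀] at e₀
    have v₃ : F.eval (.hd (.hd (.hd .var))) st = .unary u := by
      rw [hst]; simp [F.eval, Val.hd, encWord, Val.ofList]
    rw [v₃] at e₃
    have v₄ : F.eval (.cons (.hd (.tl (.tl .var))) (.cons (.tl (.tl (.tl (.tl .var))))
        (.cons (.tl (.hd (.hd .var))) (.tl (.tl (.tl (.hd .var))))))) st =
        .cons M (.cons (.unary (n - g.length)) (.cons (encWord g) (gameCtx H S N))) := by
      rw [hst]; simp [F.eval, Val.hd, Val.tl, encWord, Val.ofList]
    rw [v₄] at e₄
    have c₁ := Ev.cons e₃ (Ev.comp e₄ ew (Nat.le_add_left _ _) (Nat.le_add_right _ _)) le_rfl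
    have c₂ := Ev.comp c₁ hl (Nat.le_add_left _ _) (Nat.le_add_right _ _)
    have hws := ew.size_le.2
    refine ⟨_, .cons (.ite_false e₀ c₂ le_rfl) e₂ ?_, ?_⟩
    · have := size_unary (u : ℕ)
      have := u.isLt
      have : 2 * k * (Z + B) ≥ 0 := Nat.zero_le _
      simp only [F.cost, Val.size]
      omega
    · simpa [he] using hw u
  · have v₀ : F.eval (.hd (.tl (.tl (.tl .var)))) st ≠ .nil := by
      rw [hst]
      simp [F.eval, Val.hd, Val.tl, parity, he, Val.bit]
    have v₁ : F.eval (.hd (.tl (.tl .var))) st = M := by rw [hst]; rfl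
    rw [v₁] at e₁
    refine ⟨M, .cons (.ite_true e₀ v₀ e₁ le_rfl) e₂ ?_, hM.mono (Nat.le_succ B), by simp [he]⟩
    simp only [F.cost]
    omega

theorem mass_ev (k : ℕ) : ∃ s L, PB s ∧ PB L ∧ ∀ (Z n : ℕ) (H S : Prog) (N D : Val)
    (g : List (Fin k)), Decides k Z n H → Decides k Z n S →
    N.IsBin Z → D.IsBin Z → n ≤ Z → k ≤ Z → g.length ≤ n →
    ∃ M : Val, Ev (F.mass k) (.cons (encWord g) (.cons (.unary n) (.cons D (gameCtx H S N))))
        (.cons M (.cons (parity g) (.unary (n - g.length)))) (s Z) ∧ M.IsBin (L Z) ∧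
      M.bval = mass (leafA H S N.bval) (leafI H N.bval) n D.bval g := by
  obtain ⟨s, L, hs, hL, hc⟩ := massComb_ev k
  obtain ⟨S₀, hS₀⟩ : ∃ S₀ : ℕ → ℕ, S₀ = fun Z => s (Z + (L Z + 4 * Z + 10 + Z)) +
    100 * (2 * k * Z + 100 * Z + 100) := ⟨_, rfl⟩
  refine ⟨fun Z => 18 * (recCost F.massBase .nil F.massRec + 1) * ((Z + 1) * S₀ Z),
    -- The last Z allows for one new digit per symbol of the history; 4Z + 10 dominates the size of
    -- the total weight and of the dummy value of the left branch.
    fun Z => L Z + 4 * Z + 10 + Z, by subst hS₀; fun_prop, by fun_prop, ?_⟩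
  intro Z n H S N D g hH hS hN hD hn hk hg
  suffices h : ∃ M : Val, RecTree F.massBase F.massNil .nil F.massRec (F.massComb k) (S₀ Z)
      g.length (.cons (encWord g) (.cons (.unary n) (.cons D (gameCtx H S N))))
      (.cons M (.cons (parity g) (.unary (n - g.length)))) ∧
      M.IsBin (L Z + 4 * Z + 10 + g.length) ∧
      M.bval = mass (leafA H S N.bval) (leafI H N.bval) n D.bval g by
    obtain ⟨M, h₁, h₂, h₃⟩ := h
    exact ⟨M, (h₁.mono le_rfl (by omega)).ev rfl rfl rfl, h₂.mono (by beta_reduce; omega), h₃⟩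
  have hD' := hD.size_le
  induction g with
  | nil =>
    refine ⟨D, .leaf (by simp [F.massBase, F.eval, encWord, Val.ofList, Val.hd])
      ((Ev.of_loopFree (f := F.massNil) rfl _).mono ?_), hD.mono (by omega), rfl⟩
    have h₁ := size_gameCtx_le hH hS hN
    have h₂ := size_unary n
    simp only [F.massNil, F.cost, Val.size, encWord, List.map_nil, Val.ofList, hS₀]
    omega
  | cons u g ih =>
    simp only [List.length_cons] at hg
    obtain ⟨M, hM, hM₁, hM₂⟩ := ih (by omega)
    obtain ⟨M', e, h₁, h₂⟩ := hc Z (L Z + 4 * Z + 10 + g.length) n H S N M (.cons .nil (.cons .nil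
      .nil)) u g D hH hS hN hn hk (by omega) (by omega) hM₁ (by omega)
      (by simp only [Val.size]; omega)
    refine ⟨M', .node (vl := .cons .nil (.cons .nil .nil)) (by simp [F.massBase, F.eval, encWord,
      Val.ofList, Val.hd]) (.leaf (by simp [F.massBase, F.eval, Val.hd])
      ((Ev.of_loopFree (f := F.massNil) rfl .nil).mono ?_)) hM (e.mono ?_), h₁, ?_⟩
    · simp only [F.massNil, F.cost, Val.size, hS₀]
      omega
    · simp only [hS₀]
      have := hs.mono (a := Z + (L Z + 4 * Z + 10 + g.length)) (b := Z + (L Z + 4 * Z + 10 + Z))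
        (by omega)
      omega
    · rw [h₂, hM₂, mass]


/-! ### Instances as arguments of programs -/

theorem isBin_ofList_bits (l : List Bool) : (Val.ofList (l.map Val.bit)).IsBin l.length := by
  induction l with
  | nil => trivial
  | cons b l ih => exact ⟨by cases b <;> simp [Val.bit, Val.IsBit], ih⟩

theorem length_lt_size_ofList (l : List Val) : l.length < (Val.ofList l).size := by
  induction l with
  | nil => simp [Val.ofList, Val.size]
  | cons a l ih => simp only [Val.ofList, Val.size, List.length_cons]; omega

theorem isBin_binary {n Z : ℕ} (h : (Val.binary n).size ≤ Z) : (Val.binary n).IsBin Z := by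
  refine (isBin_ofList_bits (Nat.bits n)).mono ?_
  have := length_lt_size_ofList ((Nat.bits n).map Val.bit)
  rw [List.length_map] at this
  exact this.le.trans h

theorem bval_binary (n : ℕ) : (Val.binary n).bval = n := by
  induction n using Nat.binaryRec' with
  | zero => simp [Val.binary, Val.ofList, Val.bval]
  | bit b n h ih =>
    unfold Val.binary at *
    rw [Nat.bits_append_bit n b h, List.map_cons, Val.ofList, Val.bval, ih, Nat.bit_val]
    cases b <;> simp [Val.bit, Val.truth, add_comm]

/-- All data of the instance have size at most `Z`. -/
structure Bounded (k Z : ℕ) (C : Inst) : Prop where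
  hard : Decides k Z C.n C.hard
  soft : Decides k Z C.n C.soft
  size_le : C.enc.size ≤ Z
  card_le : k ≤ Z

/-- The weight of plays in the instance. -/
abbrev Inst.weight (C : Inst) : Val := .binary C.ρ.num.toNat

theorem Bounded.sizes {Z : ℕ} {C : Inst} (h : Bounded k Z C) :
    C.n ≤ Z ∧ C.weight.IsBin Z ∧ (Val.binary C.ρ.den).IsBin Z ∧
      (Val.binary C.ε.num.toNat).IsBin Z ∧ (Val.binary C.ε.den).IsBin Z := by
  have h₁ := h.size_le
  have h₂ := size_unary C.n
  simp only [Inst.enc, Val.ofList, Val.size] at h₁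
  exact ⟨by omega, isBin_binary (by omega), isBin_binary (by omega), isBin_binary (by omega),
    isBin_binary (by omega)⟩

/-- Iterated tails. -/
def F.drop : ℕ → F
  | 0 => .var
  | n + 1 => .tl (F.drop n)

/-- The components of a list. -/
def F.get (n : ℕ) : F := .hd (F.drop n)

/-- The value of the history `h` with respect to the admissible improvisations. -/
noncomputable def Inst.valA (k : ℕ) (C : Inst) : List (Fin k) → ℕ :=
  leafA C.hard C.soft C.ρ.num.toNat

/-- The value of the history `h` with respect to the improvisations. -/
noncomputable def Inst.valI (k : ℕ) (C : Inst) : List (Fin k) → ℕ :=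
  leafI C.hard C.ρ.num.toNat

/-- The weight of a history of the instance. -/
noncomputable def Inst.mass (C : Inst) (g : List (Fin k)) : ℕ :=
  Improv.mass (C.valA k) (C.valI k) C.n C.ρ.den g

/-- The weight of a continuation of a history of the instance at our turn. -/
noncomputable def Inst.alloc (C : Inst) (g : List (Fin k)) : Fin k → ℕ :=
  Improv.alloc (C.mass g) (gameVal (C.valA k) (C.n - g.length) (List.finRange k) g)
    (childVal (C.valA k) C.n g) (childVal (C.valI k) C.n g)

/-- The part of `F.prepare` that computes weights, if the weight of the history is positive. -/
def F.prepareWeights (k : ℕ) : F :=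
  .ite (.hd (.get 0)) (.cons .one (.cons (.comp (.weights k) (.cons (.hd (.get 1))
    (.cons (.tl (.tl (.get 1))) (.cons (.get 2) (.cons (.get 4) (.cons (.get 5) (.get 9)))))))
    (.hd (.get 1)))) .one

/-- The deterministic part of the improviser.  On a history and an instance it computes
`(true, (weights of the continuations, weight of the history))`; this is replaced by `(nil, nil)`
if it is not our turn, or the weight is zero. -/
def F.prepare (k : ℕ) : F :=
  .bind .rev (.get 0)
  (.bind (.mass k) (.cons (.get 0) (.cons (.get 4) (.cons (.get 8)
    (.cons (.get 2) (.cons (.get 3) (.get 7))))))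
  (.ite (.tl (.tl (.get 0))) (.ite (.hd (.tl (.get 0))) .one
    (.bind .sub (.cons .nil (.cons .nil (.hd (.get 0)))) (.prepareWeights k))) .one))

/-- On histories shorter than n the dichotomy is the case distinction of `Inst.strategy`. Weight
zero has to be sorted out beforehand, since rejection sampling from it would never accept. -/
theorem prepare_ev (k : ℕ) : ∃ s, PB s ∧ ∀ (Z : ℕ) (C : Inst), Bounded k Z C →
    ∀ h : List (Fin k), h.length ≤ C.n →
    ((h.length < C.n ∧ Even h.length ∧ 0 < C.mass h.reverse) ∧
      ∃ (w : Fin k → Val) (M : Val), Ev (F.prepare k) (.cons (encWord h) C.enc)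
        (.cons .one (.cons (.ofList ((List.finRange k).map w)) M)) (s Z) ∧
        M.IsBin (s Z) ∧ M.bval = C.mass h.reverse ∧
        ∀ u, (w u).IsBin (s Z) ∧ (w u).bval = C.alloc h.reverse u) ∨
    (¬ (h.length < C.n ∧ Even h.length ∧ 0 < C.mass h.reverse) ∧
      Ev (F.prepare k) (.cons (encWord h) C.enc) .one (s Z)) := by
  obtain ⟨s₁, L₁, hs₁, hL₁, h₁⟩ := mass_ev k
  obtain ⟨s₂, L₂, hs₂, hL₂, h₂⟩ := weights_ev k
  obtain ⟨s₃, hs₃, h₃⟩ := sub_ev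
  refine ⟨fun Z => s₁ Z + s₂ (Z + (L₁ Z + L₂ Z)) + s₃ (L₁ Z) + (L₁ Z + L₂ Z) +
    100000 * (2 * k * Z + 100 * Z + 100 + 10 * L₁ Z + s₃ (L₁ Z)), by fun_prop, ?_⟩
  intro Z C hC h hh
  beta_reduce
  obtain ⟨hn, hN, hD, -, -⟩ := hC.sizes
  obtain ⟨M, eM, hM, hMv⟩ := h₁ Z C.n C.hard C.soft C.weight (.binary C.ρ.den) h.reverse hC.hard
    hC.soft hN hD hn hC.card_le (by simpa using hh)
  -- Positivity of the weight is tested by subtracting it from 0: there is a borrow iff it is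
  -- positive.
  obtain ⟨f, d, ef, hf, hd, hf₁, hf₂⟩ := h₃ (L₁ Z) .nil M (.nil _) hM
  have er := rev_ev (h.map fun u : Fin k => Val.unary (u : ℕ))
  rw [← List.map_reverse] at er
  have z₁ := size_encWord_le h
  have z₂ := size_encWord_le h.reverse
  have z₃ := hC.size_le
  have z₄ := hM.size_le
  have z₅ := hf.size_le
  have z₆ := hd.size_le
  have z₇ : (parity h.reverse).size ≤ 3 := by
    unfold parity; cases decide (¬ Even h.reverse.length) <;> simp [Val.bit, Val.size]
  have z₈ := size_unary (C.n - h.reverse.length)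
  have z₉ : (2 * k + 1) * h.length ≤ 2 * k * Z + Z := by
    have := Nat.mul_le_mul_left (2 * k + 1) (hh.trans hn)
    have h2k : (2 * k + 1) * Z = 2 * k * Z + Z := by ring
    omega
  rw [List.length_reverse] at z₂ z₈
  obtain ⟨R, hR⟩ : ∃ R, R = Val.cons M (.cons (parity h.reverse)
    (.unary (C.n - h.reverse.length))) := ⟨_, rfl⟩
  have hRs : R.size ≤ 4 * L₁ Z + 2 * Z + 10 := by
    rw [hR, List.length_reverse]; simp only [Val.size]; omega
  rw [← hR] at eM
  obtain ⟨st, hst⟩ : ∃ st, st = Val.cons R (.cons (encWord h.reverse)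
    (.cons (encWord h) C.enc)) := ⟨_, rfl⟩
  have hsts : st.size ≤ 2 * (2 * k * Z) + 10 * Z + 30 + 4 * L₁ Z := by
    rw [hst]; simp only [Val.size]; omega
  have finish : ∀ {y : Val} {t : ℕ}, Ev (.ite (.tl (.tl (.get 0))) (.ite (.hd (.tl (.get 0))) .one
      (.bind .sub (.cons .nil (.cons .nil (.hd (.get 0)))) (.prepareWeights k))) .one) st y t →
      Ev (F.prepare k) (.cons (encWord h) C.enc) y
        (t + s₁ Z + 1000 * (2 * (2 * k * Z) + 10 * Z + 30 + 4 * L₁ Z)) := by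
    intro y t e
    rw [hst] at e
    have c₁ := Ev.bind (a := .cons (.get 0) (.cons (.get 4) (.cons (.get 8)
      (.cons (.get 2) (.cons (.get 3) (.get 7))))))
      (x := .cons (encWord h.reverse) (.cons (encWord h) C.enc)) rfl eM e
    have c₂ := Ev.bind (a := .get 0) (x := .cons (encWord h) C.enc) rfl er c₁
    refine Ev.mono c₂ ?_
    simp only [F.get, F.drop, F.cost, Val.size]
    change 100 * (encWord h).size + _ + _ + _ ≤ _
    omega
  have e₀ := Ev.of_loopFree (f := .tl (.tl (.get 0))) rfl st
  have e₁ := Ev.of_loopFree (f := .hd (.tl (.get 0))) rfl st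
  have v₀ : F.eval (.tl (.tl (.get 0))) st = .unary (C.n - h.length) := by
    rw [hst, hR, List.length_reverse]; rfl
  have v₁ : F.eval (.hd (.tl (.get 0))) st = parity h.reverse := by rw [hst, hR]; rfl
  have eo : ∀ x : Val, Ev F.one x .one (4 * x.size) := fun x => Ev.of_loopFree (f := .one) rfl x
  have zst := st.one_le_size
  by_cases hlt : h.length < C.n
  swap
  · refine Or.inr ⟨fun hc => hlt hc.1, (finish (.ite_false (s := F.cost (.tl (.tl (.get 0))) *
      st.size) ?_ (eo st) le_rfl)).mono ?_⟩
    · rw [v₀, show C.n - h.length = 0 by omega] at e₀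
      exact e₀
    · simp only [F.get, F.drop, F.cost]; omega
  have hne : F.eval (.tl (.tl (.get 0))) st ≠ .nil := by
    obtain ⟨m, hm⟩ : ∃ m, C.n - h.length = m + 1 := ⟨C.n - h.length - 1, by omega⟩
    rw [v₀, hm]; simp [Val.unary]
  by_cases he : Even h.length
  swap
  · refine Or.inr ⟨fun hc => he hc.2.1, (finish (.ite_true e₀ hne (.ite_true e₁ ?_ (eo st)
      le_rfl) le_rfl)).mono ?_⟩
    · rw [v₁]; simp [parity, he, Val.bit]
    · simp only [F.get, F.drop, F.cost]; omega
  have hpar : parity h.reverse = .nil := by simp [parity, he, Val.bit]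
  rw [v₁, hpar] at e₁
  have zx : (Val.cons (.cons f d) st).size ≤ 2 * (2 * k * Z) + 10 * Z + 50 + 8 * L₁ Z := by
    simp only [Val.size]; omega
  have e₂ := Ev.of_loopFree (f := .hd (.get 0)) rfl (.cons (.cons f d) st)
  have v₂ : F.eval (.hd (.get 0)) (.cons (.cons f d) st) = f := rfl
  rw [v₂] at e₂
  have fin₂ : ∀ {y : Val} {t : ℕ}, Ev (.prepareWeights k) (.cons (.cons f d) st) y t →
      Ev (F.prepare k) (.cons (encWord h) C.enc) y
        (t + s₁ Z + s₃ (L₁ Z) + 2000 * (2 * (2 * k * Z) + 10 * Z + 50 + 8 * L₁ Z)) := by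
    intro y t e
    refine (finish (.ite_true e₀ hne (.ite_false e₁ (.bind (a := .cons .nil (.cons .nil (.hd (.get
      0)))) rfl (v := .cons f d) (s := s₃ (L₁ Z)) ?_ e) le_rfl) le_rfl)).mono ?_
    · rw [hst, hR]; exact ef
    · simp only [F.get, F.drop, F.cost]; omega
  have hmass : C.mass h.reverse = M.bval := by
    rw [hMv, bval_binary, bval_binary]; rfl
  by_cases hpos : 0 < C.mass h.reverse
  swap
  · refine Or.inr ⟨fun hc => hpos hc.2.2, (fin₂ (.ite_false (s := F.cost (.hd (.get 0)) *
      (Val.cons (.cons f d) st).size) ?_ (eo _) le_rfl)).mono ?_⟩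
    · rcases hf with rfl | rfl
      · exact e₂
      · exact absurd (hf₂ (by simp)) (by rw [← hmass]; simpa [Val.bval] using hpos)
    · simp only [F.get, F.drop, F.cost]; omega
  refine Or.inl ⟨⟨hlt, he, hpos⟩, ?_⟩
  obtain ⟨w, ew, hw⟩ := h₂ Z (L₁ Z + L₂ Z) C.n C.hard C.soft C.weight M h.reverse hC.hard hC.soft hN
    hn hC.card_le (by simpa using hlt) (by simpa using he) (by omega) (hM.mono (by omega))
  refine ⟨w, M, (fin₂ (.ite_true e₂ ?_ (.cons (Ev.of_loopFree (f := .one) rfl _) (.cons (.comp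
    (Ev.of_loopFree (f := (.cons (.hd (.get 1))
    (.cons (.tl (.tl (.get 1))) (.cons (.get 2) (.cons (.get 4) (.cons (.get 5) (.get 9)))))))
      rfl _) ?_ (Nat.le_add_right _ (s₂ (Z + (L₁ Z + L₂ Z)))) (Nat.le_add_left _ _))
      (?_ : Ev _ _ M (F.cost (.hd (.get 1)) * (Val.cons (.cons f d) st).size)) le_rfl) le_rfl)
      le_rfl)).mono ?_, hM.mono (by omega), hmass.symm, fun u => ?_⟩
  · intro hfn
    have := hf₁ hfn
    simp only [Val.bval] at this
    omega
  · rw [hst, hR]; exact ew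
  · convert Ev.of_loopFree (f := .hd (.get 1)) rfl _ using 1
    rw [hst, hR]; rfl
  · simp only [F.get, F.drop, F.cost]; omega
  · refine ⟨(hw u).1.mono (by omega), ?_⟩
    rw [(hw u).2, ← hmass, bval_binary, List.length_reverse, Inst.alloc, List.length_reverse]
    rfl


/-! ### The code of the improviser -/

/-- The constant expression. -/
def Expr.const : Val → Expr
  | .nil => .nil
  | .cons a b => .cons (Expr.const a) (Expr.const b)

@[simp] theorem Expr.eval_const (v x : Val) : (Expr.const v).eval x = v := by
  induction v <;> simp_all [Expr.const, Expr.eval]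

/-- The program that maps a datum to the code of the constant expression. -/
def F.quote : F :=
  .recur (.ite .var .nil .one) (F.const Expr.nil.enc) (.hd .var) (.tl .var)
    (.cons (F.const (.unary 2)) (.tl .var))

theorem size_enc_const_le (v : Val) : (Expr.const v).enc.size ≤ 8 * v.size := by
  induction v with
  | nil => simp [Expr.const, Expr.enc, Val.unary, Val.size]
  | cons a b iha ihb => simp only [Expr.const, Expr.enc, Val.unary, Val.size] at *; omega

theorem quote_tree {S : ℕ} (v : Val) (hS : 1000 * v.size ≤ S) :
    RecTree (.ite .var .nil .one) (F.const Expr.nil.enc) (.hd .var) (.tl .var)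
    (.cons (F.const (.unary 2)) (.tl .var)) S v.size v (Expr.const v).enc := by
  induction v with
  | nil =>
    refine .leaf (by simp [F.eval]) (Ev.mono (s := (F.const Expr.nil.enc).cost * Val.nil.size) ?_ ?_)
    · exact Ev.of_loopFree rfl _
    · simp only [F.const, F.cost, Expr.enc, Val.unary, Val.size] at *; omega
  | cons a b iha ihb =>
    have h₁ := size_enc_const_le a
    have h₂ := size_enc_const_le b
    simp only [Val.size] at hS
    refine .node (vl := (Expr.const a).enc) (vr := (Expr.const b).enc) rfl
      ((iha (by omega)).mono le_rfl (by omega)) ((ihb (by omega)).mono le_rfl (by omega))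
      ((Ev.of_loopFree (f := .cons (F.const (.unary 2)) (.tl .var)) rfl _).mono ?_)
    simp only [F.const, F.cost, Val.unary, Val.size]
    omega

theorem quote_ev : ∃ s, PB s ∧ ∀ (Z : ℕ) (v : Val), v.size ≤ Z →
    Ev F.quote v (Expr.const v).enc (s Z) := by
  refine ⟨fun Z => 18 * (recCost (.ite .var .nil .one) (.hd .var) (.tl .var) + 1) *
    ((Z + 1) * (1000 * Z)), by fun_prop, fun Z v hv => ?_⟩
  exact ((quote_tree v (Nat.mul_le_mul_left _ hv)).mono le_rfl hv).ev rfl rfl rfl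

/-! ### The programs of the improviser and of the scheme -/

/-- One step in the search for the symbol selected by a number; the argument is
`(weights, (number, (symbol, result)))`. -/
def F.selectBody : F :=
  .bind .sub (.cons .nil (.cons (.get 1) (.hd (.get 0))))
    (.ite (.hd (.get 0)) (.cons .nil (.cons .nil (.cons .nil (.cons .one (.get 3)))))
      (.cons (.tl (.get 1)) (.cons (.tl (.get 0)) (.cons (.cons .nil (.get 3)) (.drop 4)))))

/-- On `(number, (true, (weights, M)))` this is `(nil, symbol)` for the symbol selected by the
number, and `(true, (weights, M))` if there is none. -/
def F.select : F :=
  .bind (.iter .selectBody) (.cons (.get 2) (.cons (.get 0) (.cons .nil .nil)))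
    (.ite (.tl (.tl (.tl (.get 0)))) (.cons .nil (.tl (.tl (.tl (.tl (.get 0))))))
      (.drop 2))

/-- One attempt to sample a symbol, on the store `((true, (weights, M)), nil)`. -/
def sampleBody : Prog :=
  .seq (.assign (.cons (.tl (.tl (.hd .var))) (.cons .nil .var)))
  (.seq (.loop (.hd .var) (.seq .flip
    (.assign (.cons (.tl (.hd (.tl .var))) (.cons (.cons (.hd .var) (.hd (.tl (.tl .var))))
      (.tl (.tl (.tl .var))))))))
  (.seq (.assign (.cons (.cons (.hd (.tl .var)) (.hd (.tl (.tl .var)))) .nil))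
  F.select.toProg))

/-- Rejection sampling. -/
def sampler : Prog := .loop (.hd (.hd .var)) sampleBody

/-- The improviser, on a history and an instance. -/
def universalImproviser (k : ℕ) : Prog :=
  .seq (.assign (.cons .var .nil)) (.seq (F.prepare k).toProg (.seq sampler
    (.assign (.tl (.hd .var)))))

/-- The improviser for the instance `C`. -/
def improviser (k : ℕ) (C : Inst) : Prog :=
  .seq (.assign (.cons .var (Expr.const C.enc))) (universalImproviser k)

/-- The code of the improviser from that of the instance as a constant. -/
def F.improviserCode (k : ℕ) : F :=
  .cons (F.const (.unary 2)) (.cons (.cons .nil (.cons (F.const (.unary 2))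
    (.cons .one (.get 0)))) (F.const (universalImproviser k).enc))

/-- The last part of the scheme. -/
def F.schemeOutput (k : ℕ) : F :=
  .ite (.hd (.get 4)) .nil (.ite (.hd (.get 0)) .nil
    (.bind .quote (.drop 6) (.improviserCode k)))

/-- The improvisation scheme. -/
def F.scheme (k : ℕ) : F :=
  .bind (.gameVal k) (.cons (.get 2) (.cons (F.const (encWord (List.finRange k)))
    (.cons .nil (.cons .nil (.cons (.get 0) (.cons (.get 1) (.get 5)))))))
  (.bind .sub (.cons .nil (.cons (.tl (.get 0)) (.get 7)))
  (.bind .minSub (.cons (.get 6) (.get 5))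
  (.bind .mul (.cons (.tl (.get 0)) (.get 9))
  (.bind .mul (.cons (.get 8) (.hd (.get 3)))
  (.bind .sub (.cons .nil (.cons (.get 0) (.get 1))) (.schemeOutput k))))))

/-- The condition that is tested by the scheme. -/
def Inst.Feasible (k : ℕ) (C : Inst) : Prop :=
  C.ρ.den ≤ gameVal (C.valI k) C.n (List.finRange k) [] ∧
  (C.ε.den - C.ε.num.toNat) * C.ρ.den ≤ C.ε.den * gameVal (C.valA k) C.n (List.finRange k) []

theorem schemeOutput_ev (k : ℕ) : ∃ s, PB s ∧ ∀ (Z Q : ℕ) (C : Inst) (f₁ f₂ y₁ y₂ p₁ p₂ d v : Val),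
    C.enc.size ≤ Z →
    (Val.cons (.cons f₂ y₂) (.cons p₂ (.cons p₁ (.cons d (.cons (.cons f₁ y₁)
      (.cons v C.enc)))))).size ≤ Q →
    (f₁ = .nil ∧ f₂ = .nil → Ev (F.schemeOutput k) (.cons (.cons f₂ y₂) (.cons p₂ (.cons p₁ (.cons d
      (.cons (.cons f₁ y₁) (.cons v C.enc)))))) (improviser k C).enc (s (Z + Q))) ∧
    (¬ (f₁ = .nil ∧ f₂ = .nil) → Ev (F.schemeOutput k) (.cons (.cons f₂ y₂) (.cons p₂ (.cons p₁ (.cons d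
      (.cons (.cons f₁ y₁) (.cons v C.enc)))))) .nil (s (Z + Q))) := by
  obtain ⟨s, hs, hq⟩ := quote_ev
  refine ⟨fun Z => s Z + (F.improviserCode k).cost * (8 * Z + Z + 1) + 1000 * Z, by fun_prop, ?_⟩
  intro Z Q C f₁ f₂ y₁ y₂ p₁ p₂ d v hC hQ
  have e := hq Z C.enc hC
  have hcode := size_enc_const_le C.enc
  have hsm : s Z ≤ s (Z + Q) := hs.mono (by omega)
  obtain ⟨st, hst⟩ : ∃ st, st = Val.cons (.cons f₂ y₂) (.cons p₂ (.cons p₁ (.cons d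
    (.cons (.cons f₁ y₁) (.cons v C.enc))))) := ⟨_, rfl⟩
  rw [← hst] at hQ ⊢
  have hpos := st.one_le_size
  have e₁ := Ev.of_loopFree (f := .hd (.get 4)) rfl st
  have e₂ := Ev.of_loopFree (f := .hd (.get 0)) rfl st
  have v₁ : F.eval (.hd (.get 4)) st = f₁ := by rw [hst]; rfl
  have v₂ : F.eval (.hd (.get 0)) st = f₂ := by rw [hst]; rfl
  rw [v₁] at e₁
  rw [v₂] at e₂
  have en : Ev .nil st .nil st.size := .nil le_rfl
  constructor
  · rintro ⟨rfl, rfl⟩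
    -- The improviser depends on the instance only through one quoted constant; the rest of its code
    -- is fixed.
    have hcodeval : (F.improviserCode k).eval (.cons (Expr.const C.enc).enc st) =
        (improviser k C).enc := by
      simp [F.improviserCode, F.eval, F.get, F.drop, improviser, Prog.enc, Expr.enc, Val.hd,
        Val.unary]
    have e₃ := Ev.of_loopFree (f := F.improviserCode k)
      (by simp [F.improviserCode, F.loopFree, F.get, F.drop]) (.cons (Expr.const C.enc).enc st)
    rw [hcodeval] at e₃
    refine (Ev.ite_false e₁ (.ite_false e₂ (.bind (a := .drop 6) rfl (by rw [hst]; exact e) e₃)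
      le_rfl) le_rfl).mono ?_
    have : (F.improviserCode k).cost * (Val.cons (Expr.const C.enc).enc st).size ≤
        (F.improviserCode k).cost * (8 * (Z + Q) + (Z + Q) + 1) :=
      Nat.mul_le_mul_left _ (by simp only [Val.size]; omega)
    simp only [F.get, F.drop, F.cost]
    omega
  · intro hne
    by_cases h₁ : f₁ = .nil
    · subst h₁
      refine (Ev.ite_false e₁ (.ite_true e₂ (fun h => hne ⟨rfl, h⟩) en le_rfl) le_rfl).mono ?_
      simp only [F.get, F.drop, F.cost]
      omega
    · refine (Ev.ite_true e₁ h₁ en le_rfl).mono ?_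
      simp only [F.get, F.drop, F.cost]
      omega

/-- Each of the two inequalities of `Inst.Feasible` is read off from the borrow of one subtraction.
-/
theorem scheme_ev (k : ℕ) : ∃ s, PB s ∧ ∀ (Z : ℕ) (C : Inst), Bounded k Z C →
    (C.Feasible k → Ev (F.scheme k) C.enc (improviser k C).enc (s Z)) ∧
    (¬ C.Feasible k → Ev (F.scheme k) C.enc .nil (s Z)) := by
  obtain ⟨sV, L, hsV, hL, hV⟩ := gameVal_ev k
  obtain ⟨s₁, hs₁, h₁⟩ := sub_ev
  obtain ⟨s₂, hs₂, h₂⟩ := minSub_ev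
  obtain ⟨s₃, hs₃, h₃⟩ := mul_ev
  obtain ⟨s₄, hs₄, h₄⟩ := schemeOutput_ev k
  obtain ⟨c, hc⟩ : ∃ c, c = (F.const (encWord (List.finRange k))).cost := ⟨_, rfl⟩
  obtain ⟨Q, hQ⟩ : ∃ Q : ℕ → ℕ, Q = fun Z => 200 * (L Z + Z) + 100 := ⟨_, rfl⟩
  refine ⟨fun Z => sV Z + s₁ (L Z + Z) + s₂ (L Z + Z) + s₃ (L Z + Z) + s₃ (L Z + Z) +
    s₁ (3 * (L Z + Z)) + s₄ (Z + Q Z) + (c + 10000) * Q Z, by subst hQ; fun_prop, ?_⟩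
  intro Z C hC
  obtain ⟨hn, hN, hD, hNe, hDe⟩ := hC.sizes
  obtain ⟨B, hB⟩ : ∃ B, B = L Z + Z := ⟨_, rfl⟩
  beta_reduce
  rw [← hB]
  obtain ⟨v, ev, hv₁, hv₂, hv₃, hv₄⟩ := hV Z C.hard C.soft C.weight C.n [] (by simpa using hC.hard)
    (by simpa using hC.soft) hN (by simpa using hn) hC.card_le
  have hv := IsPair.mono ⟨hv₁, hv₂, hv₃, hv₄⟩ (show L Z ≤ B by omega)
  obtain ⟨f₁, y₁, e₁, hf₁, hy₁, ht₁, ht₁'⟩ := h₁ B _ _ hv.2.1 (hD.mono (show Z ≤ B by omega))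
  obtain ⟨m, d, e₂, hm, hd, -, hdv⟩ := h₂ B _ _ (hDe.mono (show Z ≤ B by omega))
    (hNe.mono (show Z ≤ B by omega))
  obtain ⟨p₁, e₃, hp₁, hpv₁⟩ := h₃ B _ _ hd (hD.mono (show Z ≤ B by omega))
  obtain ⟨p₂, e₄, hp₂, hpv₂⟩ := h₃ B _ _ (hDe.mono (show Z ≤ B by omega)) hv.1
  obtain ⟨f₂, y₂, e₅, hf₂, hy₂, ht₂, ht₂'⟩ := h₁ (3 * B) _ _ hp₂ hp₁
  have hs : (Val.cons (.cons f₂ y₂) (.cons p₂ (.cons p₁ (.cons (.cons m d) (.cons (.cons f₁ y₁)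
      (.cons v C.enc)))))).size ≤ Q Z := by
    have := hv.size_le
    have := hf₁.size_le
    have := hf₂.size_le
    have := hy₁.size_le
    have := hy₂.size_le
    have := hm.size_le
    have := hd.size_le
    have := hp₁.size_le
    have := hp₂.size_le
    have := hC.size_le
    rw [hQ]
    simp only [Val.size]
    omega
  have out : ∀ {y : Val} {t : ℕ}, Ev (F.schemeOutput k) (.cons (.cons f₂ y₂) (.cons p₂ (.cons p₁
      (.cons (.cons m d) (.cons (.cons f₁ y₁) (.cons v C.enc)))))) y t → Ev (F.scheme k) C.enc y
      (sV Z + s₁ B + s₂ B + s₃ B + s₃ B + s₁ (3 * B) + t + (c + 10000) * Q Z) := by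
    intro y t e
    have c₆ := Ev.bind (a := .cons .nil (.cons (.get 0) (.get 1))) (x := .cons p₂ (.cons p₁
      (.cons (.cons m d) (.cons (.cons f₁ y₁) (.cons v C.enc))))) rfl e₅ e
    have c₅ := Ev.bind (a := .cons (.get 8) (.hd (.get 3))) (x := .cons p₁
      (.cons (.cons m d) (.cons (.cons f₁ y₁) (.cons v C.enc)))) rfl e₄ c₆
    have c₄ := Ev.bind (a := .cons (.tl (.get 0)) (.get 9)) (x :=
      .cons (.cons m d) (.cons (.cons f₁ y₁) (.cons v C.enc))) rfl e₃ c₅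
    have c₃ := Ev.bind (a := .cons (.get 6) (.get 5)) (x :=
      .cons (.cons f₁ y₁) (.cons v C.enc)) rfl e₂ c₄
    have c₂ := Ev.bind (a := .cons .nil (.cons (.tl (.get 0)) (.get 7))) (x :=
      .cons v C.enc) rfl e₁ c₃
    have harg : F.eval (.cons (.get 2) (.cons (F.const (encWord (List.finRange k)))
        (.cons .nil (.cons .nil (.cons (.get 0) (.cons (.get 1) (.get 5))))))) C.enc =
        gameArg C.n (List.finRange k) [] (gameCtx C.hard C.soft C.weight) := by
      simp [F.eval, F.get, F.drop, gameArg, gameCtx, Inst.enc, Val.ofList, Val.hd, Val.tl, parity,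
        Val.bit, encWord]
    rw [← harg] at ev
    have c₁ := Ev.bind (by simp [F.loopFree, F.get, F.drop]) ev c₂
    refine Ev.mono c₁ ?_
    have hx := C.enc.one_le_size
    have b₁ := Nat.mul_le_mul_left c (show C.enc.size ≤ Q Z by
      simp only [Val.size] at hs; omega)
    simp only [F.get, F.drop, F.cost, Val.size, ← hc] at *
    simp only [add_mul]
    omega
  obtain ⟨h₄', h₄''⟩ := h₄ Z (Q Z) C f₁ f₂ y₁ y₂ p₁ p₂ (.cons m d) v hC.size_le hs
  have hI : v.tl.bval = gameVal (C.valI k) C.n (List.finRange k) [] := by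
    rw [hv₄, bval_binary]; rfl
  have hA : v.hd.bval = gameVal (C.valA k) C.n (List.finRange k) [] := by
    rw [hv₃, bval_binary]; rfl
  have hfeas : (f₁ = .nil ∧ f₂ = .nil) ↔ C.Feasible k := by
    rw [hI, bval_binary] at ht₁ ht₁'
    rw [hpv₁, hpv₂, hdv, hA, bval_binary, bval_binary, bval_binary] at ht₂ ht₂'
    constructor
    · rintro ⟨ha, hb⟩
      exact ⟨by have := ht₁ ha; omega, by have := ht₂ hb; omega⟩
    · rintro ⟨ha, hb⟩
      refine ⟨?_, ?_⟩
      · by_contra hne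
        have := ht₁' hne
        omega
      · by_contra hne
        have := ht₂' hne
        omega
  exact ⟨fun hf => out (h₄' (hfeas.2 hf)), fun hf => out (h₄'' (fun h => hf (hfeas.1 h)))⟩


/-! ### Properties of values and weights -/

theorem minList_le {l : List ℕ} {x : ℕ} (h : x ∈ l) : minList l ≤ x := by
  induction l with
  | nil => simp at h
  | cons a l ih =>
    cases l with
    | nil => simp [minList] at h ⊢; omega
    | cons b l =>
      simp only [minList]
      rcases List.mem_cons.1 h with rfl | h
      · exact min_le_left _ _
      · exact (min_le_right _ _).trans (ih h)

theorem minList_mem {l : List ℕ} (h : l ≠ []) : minList l ∈ l := by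
  induction l with
  | nil => exact absurd rfl h
  | cons a l ih =>
    cases l with
    | nil => simp [minList]
    | cons b l =>
      simp only [minList]
      rcases min_choice a (minList (b :: l)) with h | h
      · rw [h]; simp
      · rw [h]; exact List.mem_cons_of_mem _ (ih (by simp))

theorem gameVal_even (leaf : List (Fin k) → ℕ) {n : ℕ} {g : List (Fin k)} (hn : g.length < n)
    (hg : Even g.length) :
    gameVal leaf (n - g.length) (List.finRange k) g = ∑ u, childVal leaf n g u := by
  obtain ⟨m, hm⟩ : ∃ m, n - g.length = m + 1 := ⟨n - g.length - 1, by omega⟩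
  have hm' : n - (g.length + 1) = m := by omega
  unfold childVal
  rw [hm, hm', gameVal, if_pos hg, Fin.sum_univ_def]

theorem gameVal_odd_le (leaf : List (Fin k) → ℕ) {n : ℕ} {g : List (Fin k)} (hn : g.length < n)
    (hg : ¬ Even g.length) (u : Fin k) :
    gameVal leaf (n - g.length) (List.finRange k) g ≤ childVal leaf n g u := by
  obtain ⟨m, hm⟩ : ∃ m, n - g.length = m + 1 := ⟨n - g.length - 1, by omega⟩
  have hm' : n - (g.length + 1) = m := by omega
  rw [childVal, hm, hm', gameVal, if_neg hg]
  exact minList_le (List.mem_map_of_mem (List.mem_finRange u))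

theorem exists_gameVal_odd_eq (leaf : List (Fin k) → ℕ) (hk : 0 < k) {n : ℕ} {g : List (Fin k)}
    (hn : g.length < n) (hg : ¬ Even g.length) :
    ∃ u, gameVal leaf (n - g.length) (List.finRange k) g = childVal leaf n g u := by
  obtain ⟨m, hm⟩ : ∃ m, n - g.length = m + 1 := ⟨n - g.length - 1, by omega⟩
  have hm' : n - (g.length + 1) = m := by omega
  unfold childVal
  rw [hm, hm', gameVal, if_neg hg]
  have hne : (List.finRange k).map (fun u => gameVal leaf m (List.finRange k) (u :: g)) ≠ [] := by
    simpa using hk.ne'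
  obtain ⟨u, -, hu⟩ := List.mem_map.1 (minList_mem hne)
  exact ⟨u, hu.symm⟩

theorem gameVal_mono {lA lI : List (Fin k) → ℕ} (h : ∀ g, lA g ≤ lI g) {n : ℕ} :
    ∀ (m : ℕ) (g : List (Fin k)), g.length + m = n →
      gameVal lA (n - g.length) (List.finRange k) g ≤
        gameVal lI (n - g.length) (List.finRange k) g := by
  intro m
  induction m with
  | zero =>
    intro g hg
    rw [show n - g.length = 0 by omega]
    exact h g
  | succ m ih =>
    intro g hg
    have key : ∀ u, childVal lA n g u ≤ childVal lI n g u := fun u =>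
      ih (u :: g) (by simp only [List.length_cons]; omega)
    by_cases he : Even g.length
    · rw [gameVal_even _ (by omega) he, gameVal_even _ (by omega) he]
      exact Finset.sum_le_sum fun u _ => key u
    -- Over the empty alphabet no child attains the minimum, but then both values are 0.
    · rcases Nat.eq_zero_or_pos k with rfl | hk
      · obtain ⟨m', hm'⟩ : ∃ m, n - g.length = m + 1 := ⟨n - g.length - 1, by omega⟩
        rw [hm']
        simp [gameVal, he, minList]
      · obtain ⟨u, hu⟩ := exists_gameVal_odd_eq lI hk (n := n) (g := g) (by omega) he
        rw [hu]
        exact (gameVal_odd_le lA (by omega) he u).trans (key u)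

theorem fill_le (m : ℕ) (c : Fin k → ℕ) (l : List (Fin k)) (u : Fin k) : fill m c l u ≤ c u := by
  induction l generalizing m with
  | nil => simp [fill]
  | cons v l ih =>
    simp only [fill]
    split
    · subst_vars; exact min_le_right _ _
    · exact ih _

/-- Greedy filling places as much as weight and total capacity permit; distinctness prevents a
capacity from being used twice. -/
theorem sum_fill {l : List (Fin k)} (hl : l.Nodup) (m : ℕ) (c : Fin k → ℕ) :
    (l.map (fill m c l)).sum = min m (l.map c).sum := by
  induction l generalizing m with
  | nil => simp
  | cons v l ih =>
    rw [List.nodup_cons] at hl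
    have h : l.map (fill m c (v :: l)) = l.map (fill (m - c v) c l) := by
      refine List.map_congr_left fun u hu => ?_
      simp only [fill]
      rw [if_neg (fun h : u = v => hl.1 (h ▸ hu))]
    rw [List.map_cons, List.sum_cons, h, ih hl.2, List.map_cons, List.sum_cons]
    simp only [fill, if_true]
    omega

theorem sum_symbols (f : Fin k → ℕ) : ((symbols k).map f).sum = ∑ u, f u := by
  rw [symbols, List.map_reverse, List.sum_reverse, Fin.sum_univ_def]

theorem alloc_le {M A : ℕ} {a i : Fin k → ℕ} (h : ∀ u, a u ≤ i u) (u : Fin k) :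
    alloc M A a i u ≤ i u := by
  have h₁ := fill_le M a (symbols k) u
  have h₂ := fill_le (M - A) (fun v => i v - a v) (symbols k) u
  have := h u
  simp only [alloc]
  omega

/-- The first filling places min(M, ∑ a). The second has M - ∑ a left for room ∑ i - ∑ a, which
suffices by `hM`, so nothing is lost. -/
theorem sum_alloc {M : ℕ} {a i : Fin k → ℕ} (h : ∀ u, a u ≤ i u) (hM : M ≤ ∑ u, i u) :
    ∑ u, alloc M (∑ u, a u) a i u = M := by
  have h₁ : ∑ u, (i u - a u) + ∑ u, a u = ∑ u, i u := by
    rw [← Finset.sum_add_distrib]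
    exact Finset.sum_congr rfl fun u _ => Nat.sub_add_cancel (h u)
  simp only [alloc]
  rw [Finset.sum_add_distrib, ← sum_symbols (fill M a (symbols k)), ← sum_symbols (fill _ _ _),
    sum_fill (nodup_symbols k), sum_fill (nodup_symbols k), sum_symbols, sum_symbols]
  omega

/-- The first filling alone places min(M, ∑ a) within the capacities `a`. This is what makes serving
A first optimal for the soft constraint. -/
theorem le_sum_min_alloc (M A : ℕ) (a i : Fin k → ℕ) :
    min M (∑ u, a u) ≤ ∑ u, min (alloc M A a i u) (a u) := by
  rw [← sum_symbols a, ← sum_fill (nodup_symbols k), sum_symbols]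
  refine Finset.sum_le_sum fun u _ => le_min ?_ (fill_le _ _ _ _)
  simp only [alloc]
  omega

/-! ### Probabilities of plays, recursively -/

/-- The probability that the history `h` is continued by `t`. -/
noncomputable def contProb (σ τ : List (Fin k) → Fin k → ℝ) : List (Fin k) → List (Fin k) → ℝ
  | _, [] => 1
  | h, u :: t => (if Even h.length then σ else τ) h u * contProb σ τ (h ++ [u]) t

open Classical in
/-- The probability that the continuation of `h` by `m` symbols lies in `X`. -/
noncomputable def reachProb (σ τ : List (Fin k) → Fin k → ℝ) (X : Set (List (Fin k))) :
    ℕ → List (Fin k) → ℝ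
  | 0, h => if h ∈ X then 1 else 0
  | m + 1, h => ∑ u, (if Even h.length then σ else τ) h u * reachProb σ τ X m (h ++ [u])

theorem contProb_ofFn (σ τ : List (Fin k) → Fin k → ℝ) {m : ℕ} (h : List (Fin k))
    (π : Fin m → Fin k) :
    contProb σ τ h (List.ofFn π) = ∏ i : Fin m, (if Even (h.length + (i : ℕ)) then σ else τ)
      (h ++ (List.ofFn π).take i) (π i) := by
  induction m generalizing h with
  | zero => simp [contProb]
  | succ m ih =>
    rw [List.ofFn_succ, contProb, ih, Fin.prod_univ_succ]
    simp [add_comm, add_left_comm]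

theorem playProb_eq (σ τ : List (Fin k) → Fin k → ℝ) {n : ℕ} (π : Fin n → Fin k) :
    playProb σ τ π = contProb σ τ [] (List.ofFn π) := by
  rw [contProb_ofFn]
  simp [playProb]

open Classical in
theorem reachProb_eq (σ τ : List (Fin k) → Fin k → ℝ) (X : Set (List (Fin k))) (m : ℕ)
    (h : List (Fin k)) :
    reachProb σ τ X m h =
      ∑ π : Fin m → Fin k, if h ++ List.ofFn π ∈ X then contProb σ τ h (List.ofFn π) else 0 := by
  induction m generalizing h with
  | zero => simp [reachProb, contProb]
  | succ m ih =>
    rw [← (Fin.consEquiv fun _ => Fin k).sum_comp, Fintype.sum_prod_type, reachProb]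
    refine Finset.sum_congr rfl fun u _ => ?_
    rw [ih, Finset.mul_sum]
    refine Finset.sum_congr rfl fun π _ => ?_
    simp [Fin.consEquiv, List.ofFn_succ, contProb]

theorem setProb_eq (σ τ : List (Fin k) → Fin k → ℝ) {n : ℕ} (X : Set (List (Fin k))) :
    setProb σ τ {π : Fin n → Fin k | List.ofFn π ∈ X} = reachProb σ τ X n [] := by
  rw [reachProb_eq, setProb]
  simp [playProb_eq]


/-! ### Realizable instances are feasible -/

theorem exists_ofFn_eq {n : ℕ} {t : List (Fin k)} (h : t.length = n) :
    ∃ π : Fin n → Fin k, List.ofFn π = t := by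
  subst h
  exact ⟨fun i => t[i], List.ofFn_getElem⟩

/-- The values of the two sets of plays as a special case of those of a set of words. -/
theorem valI_eq (C : Inst) (g : List (Fin k)) [Decidable (g.reverse ∈ language k C.hard)] :
    C.valI k g = if g.reverse ∈ language k C.hard then C.ρ.num.toNat else 0 := by
  unfold Inst.valI leafI
  congr

theorem valA_eq (C : Inst) (g : List (Fin k))
    [Decidable (g.reverse ∈ language k C.hard ∩ language k C.soft)] :
    C.valA k g = if g.reverse ∈ language k C.hard ∩ language k C.soft then C.ρ.num.toNat else 0 := by
  unfold Inst.valA leafA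
  congr

theorem valA_le_valI (C : Inst) (g : List (Fin k)) : C.valA k g ≤ C.valI k g := by
  classical
  unfold Inst.valA leafA Inst.valI leafI
  split
  · rename_i h; rw [if_pos h.1]
  · exact Nat.zero_le _

theorem cast_rho (C : Inst) : (C.ρ : ℝ) = (C.ρ.num.toNat : ℝ) / (C.ρ.den : ℝ) := by
  have h : ((C.ρ.num.toNat : ℤ) : ℝ) = (C.ρ.num : ℝ) := by
    rw [Int.toNat_of_nonneg (Rat.num_nonneg.2 C.ρ_nonneg)]
  rw [Rat.cast_def, ← h, Int.cast_natCast]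

theorem cast_eps (C : Inst) : (C.ε : ℝ) = (C.ε.num.toNat : ℝ) / (C.ε.den : ℝ) := by
  have h : ((C.ε.num.toNat : ℤ) : ℝ) = (C.ε.num : ℝ) := by
    rw [Int.toNat_of_nonneg (Rat.num_nonneg.2 C.ε_nonneg)]
  rw [Rat.cast_def, ← h, Int.cast_natCast]

/-- An adversary that minimizes the value of the history. -/
def IsMinimizing (leaf : List (Fin k) → ℕ) (n : ℕ) (τ : List (Fin k) → Fin k → ℝ) : Prop :=
  ∀ h : List (Fin k), h.length < n → ¬ Even h.length → ∃ u, τ h = Pi.single u 1 ∧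
    gameVal leaf (n - h.length) (List.finRange k) h.reverse = childVal leaf n h.reverse u

theorem exists_isMinimizing (leaf : List (Fin k) → ℕ) {n : ℕ} (h : n = 0 ∨ 0 < k) :
    ∃ τ, IsStrategy n τ ∧ IsMinimizing leaf n τ := by
  rcases h with rfl | hk
  · exact ⟨fun _ _ => 0, fun h hh => absurd hh (Nat.not_lt_zero _),
      fun h hh => absurd hh (Nat.not_lt_zero _)⟩
  · have key : ∀ h : List (Fin k), ∃ u : Fin k, h.length < n → ¬ Even h.length →
        gameVal leaf (n - h.length) (List.finRange k) h.reverse = childVal leaf n h.reverse u := by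
      intro h
      by_cases hc : h.length < n ∧ ¬ Even h.length
      · obtain ⟨u, hu⟩ := exists_gameVal_odd_eq leaf hk (n := n) (g := h.reverse)
          (by simpa using hc.1) (by simpa using hc.2)
        rw [List.length_reverse] at hu
        exact ⟨u, fun _ _ => hu⟩
      · exact ⟨⟨0, hk⟩, fun h₁ h₂ => absurd ⟨h₁, h₂⟩ hc⟩
    choose f hf using key
    refine ⟨fun h => Pi.single (f h) 1, fun h _ => ⟨fun u => ?_, ?_⟩, fun h h₁ h₂ => ⟨f h, rfl, hf h h₁ h₂⟩⟩
    · beta_reduce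
      by_cases hu : u = f h
      · rw [hu, Pi.single_eq_same]; exact zero_le_one
      · rw [Pi.single_eq_of_ne hu]
    · simp

-- The factor q stands for the probability of having reached `h`, so that the randomness bound,
-- which concerns whole plays, becomes usable at the leaves. The minimizing adversary moves
-- deterministically and leaves q unchanged; our moves split q, matching the sum in the value.
open Classical in
theorem reachProb_le {X : Set (List (Fin k))} {leaf : List (Fin k) → ℕ} {N n : ℕ} {D : ℝ}
    (hleaf : ∀ g, leaf g = if g.reverse ∈ X then N else 0)
    {σ τ : List (Fin k) → Fin k → ℝ} (hσ : IsStrategy n σ) (hτ : IsMinimizing leaf n τ) (m : ℕ)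
    (h : List (Fin k)) (hm : h.length + m = n) (q : ℝ) (hq : 0 ≤ q)
    (hX : ∀ t : List (Fin k), t.length = m → h ++ t ∈ X → q * contProb σ τ h t ≤ N / D) :
    q * reachProb σ τ X m h ≤ gameVal leaf (n - h.length) (List.finRange k) h.reverse / D := by
  induction m generalizing h q with
  | zero =>
    rw [show n - h.length = 0 by omega, gameVal, hleaf, List.reverse_reverse, reachProb]
    by_cases hh : h ∈ X
    · simpa [hh, contProb] using hX [] rfl (by simpa using hh)
    · simp [hh]
  | succ m ih =>
    have step : ∀ (u : Fin k) (q' : ℝ), 0 ≤ q' →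
        (∀ t : List (Fin k), q * contProb σ τ h (u :: t) = q' * contProb σ τ (h ++ [u]) t) →
        q' * reachProb σ τ X m (h ++ [u]) ≤ childVal leaf n h.reverse u / D := by
      intro u q' hq' heq
      have := ih (h ++ [u]) (by simp only [List.length_append, List.length_singleton]; omega) q'
        hq' (fun t ht hmem => by
          rw [← heq]
          exact hX (u :: t) (by simpa using ht) (by simpa using hmem))
      simpa [childVal] using this
    by_cases he : Even h.length
    · have hv := gameVal_even leaf (n := n) (g := h.reverse)
        (by rw [List.length_reverse]; omega) (by simpa using he)
      rw [List.length_reverse] at hv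
      rw [hv, reachProb, Finset.mul_sum, Nat.cast_sum, Finset.sum_div]
      refine Finset.sum_le_sum fun u _ => ?_
      rw [if_pos he, ← mul_assoc]
      refine step u (q * σ h u) (mul_nonneg hq ((hσ h (by omega)).1 u)) fun t => ?_
      rw [contProb, if_pos he, mul_assoc]
    · obtain ⟨v, hv, hval⟩ := hτ h (by omega) he
      rw [hval, reachProb, if_neg he, hv, Finset.sum_eq_single v]
      · rw [Pi.single_eq_same, one_mul]
        refine step v q hq fun t => ?_
        rw [contProb, if_neg he, hv, Pi.single_eq_same, one_mul]
      · intro u _ hu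
        rw [Pi.single_eq_of_ne hu, zero_mul]
      · simp

theorem IsImprovising.feasible {C : Inst} {σ : List (Fin k) → Fin k → ℝ} (h : IsImprovising C σ) :
    C.Feasible k := by
  classical
  obtain ⟨hσ, h⟩ := h
  -- Over the empty alphabet there is no probability distribution, so a strategy exists only for
  -- plays of length 0.
  have hk : C.n = 0 ∨ 0 < k := by
    by_contra! hc
    obtain ⟨hn, hk⟩ := hc
    obtain rfl : k = 0 := by omega
    have := (hσ [] (by simp only [List.length_nil]; omega)).2
    simp at this
  have hD : (0 : ℝ) < C.ρ.den := by exact_mod_cast C.ρ.den_pos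
  have hE : (0 : ℝ) < C.ε.den := by exact_mod_cast C.ε.den_pos
  have main : ∀ (X : Set (List (Fin k))) (leaf : List (Fin k) → ℕ), X ⊆ language k C.hard →
      (∀ g, leaf g = if g.reverse ∈ X then C.ρ.num.toNat else 0) → ∃ τ, IsStrategy C.n τ ∧
      setProb σ τ {π : Fin C.n → Fin k | List.ofFn π ∈ X} ≤
        gameVal leaf C.n (List.finRange k) [] / C.ρ.den := by
    intro X leaf hX hleaf
    obtain ⟨τ, hτ, hτ'⟩ := exists_isMinimizing leaf hk
    refine ⟨τ, hτ, ?_⟩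
    rw [setProb_eq]
    have := reachProb_le hleaf hσ hτ' C.n [] (by simp) 1 zero_le_one (fun t ht hmem => by
      obtain ⟨π, rfl⟩ := exists_ofFn_eq ht
      have := (h τ hτ).2.2 π (hX hmem)
      rw [one_mul, ← playProb_eq, ← cast_rho]
      exact this)
    simpa using this
  constructor
  · obtain ⟨τ, hτ, hle⟩ := main (language k C.hard) (C.valI k) subset_rfl (fun g => valI_eq C g)
    have h1 := (h τ hτ).1
    rw [Inst.I] at h1
    rw [h1, le_div_iff₀ hD, one_mul] at hle
    exact_mod_cast hle
  · obtain ⟨τ, hτ, hle⟩ := main (language k C.hard ∩ language k C.soft) (C.valA k)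
      Set.inter_subset_left (fun g => by convert valA_eq C g)
    have h1 := (h τ hτ).2.1.trans hle
    have hnum : C.ε.num.toNat ≤ C.ε.den := by
      have := C.ε_le_one
      have h2 : (C.ε : ℝ) ≤ 1 := by exact_mod_cast this
      rw [cast_eps, div_le_one hE] at h2
      exact_mod_cast h2
    -- Both denominators are cleared; ε ≤ 1 turns the truncated subtraction in `Inst.Feasible` into
    -- a genuine one.
    rw [cast_eps, le_div_iff₀ hD, one_sub_div hE.ne', div_mul_eq_mul_div, div_le_iff₀ hE] at h1
    rw [← Nat.cast_le (α := ℝ)]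
    push_cast [Nat.cast_sub hnum]
    linarith

/-! ### Feasible instances are realizable -/

open Classical in
/-- The strategy that follows the weights. -/
noncomputable def Inst.strategy (C : Inst) (h : List (Fin k)) (u : Fin k) : ℝ :=
  if Even h.length ∧ 0 < C.mass h.reverse then C.alloc h.reverse u / C.mass h.reverse
  else if (u : ℕ) = 0 then 1 else 0

theorem mass_cons_even (C : Inst) {g : List (Fin k)} (hg : Even g.length) (u : Fin k) :
    C.mass (u :: g) = C.alloc g u := by
  simp [Inst.mass, mass, hg, Inst.alloc]

theorem mass_cons_odd (C : Inst) {g : List (Fin k)} (hg : ¬ Even g.length) (u : Fin k) :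
    C.mass (u :: g) = C.mass g := by
  simp [Inst.mass, mass, hg]

theorem childA_le_childI (C : Inst) {g : List (Fin k)} (hg : g.length < C.n) (u : Fin k) :
    childVal (C.valA k) C.n g u ≤ childVal (C.valI k) C.n g u :=
  gameVal_mono (valA_le_valI C) (n := C.n) (C.n - (g.length + 1)) (u :: g)
    (by simp only [List.length_cons]; omega)

theorem alloc_le_childI (C : Inst) {g : List (Fin k)} (hg : g.length < C.n) (u : Fin k) :
    C.alloc g u ≤ childVal (C.valI k) C.n g u :=
  alloc_le (childA_le_childI C hg) u

/-- It holds at the root by feasibility. At our turn the I-value is the capacity of the filling, and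
at the adversary's the parent has at most the value of any child. -/
theorem mass_le {C : Inst} (hC : C.Feasible k) {g : List (Fin k)} (hg : g.length ≤ C.n) :
    C.mass g ≤ gameVal (C.valI k) (C.n - g.length) (List.finRange k) g := by
  induction g with
  | nil => exact hC.1
  | cons u g ih =>
    simp only [List.length_cons] at hg
    by_cases he : Even g.length
    · rw [mass_cons_even C he]
      exact alloc_le_childI C (by omega) u
    · rw [mass_cons_odd C he]
      exact (ih (by omega)).trans (gameVal_odd_le _ (by omega) he u)

theorem sum_alloc_eq {C : Inst} (hC : C.Feasible k) {g : List (Fin k)} (hg : g.length < C.n)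
    (he : Even g.length) : ∑ u, C.alloc g u = C.mass g := by
  have h := mass_le hC hg.le
  unfold Inst.alloc
  rw [gameVal_even _ hg he] at h ⊢
  exact sum_alloc (childA_le_childI C hg) h

theorem card_pos_of_feasible {C : Inst} (hC : C.Feasible k) (hn : 0 < C.n) : 0 < k := by
  by_contra! hk
  obtain rfl : k = 0 := by omega
  have h := hC.1
  have h' := gameVal_even (C.valI 0) (n := C.n) (g := []) hn (by simp)
  rw [List.length_nil, Nat.sub_zero] at h'
  rw [h'] at h
  have := C.ρ.den_pos
  simp at h

theorem isStrategy_strategy {C : Inst} (hC : C.Feasible k) : IsStrategy C.n (C.strategy (k := k)) := by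
  intro h hh
  have hk := card_pos_of_feasible hC (by omega)
  unfold Inst.strategy
  split
  · rename_i hc
    refine ⟨fun u => by positivity, ?_⟩
    rw [← Finset.sum_div, ← Nat.cast_sum, sum_alloc_eq hC (by simpa using hh) (by simpa using hc.1)]
    exact div_self (by exact_mod_cast hc.2.ne')
  · refine ⟨fun u => by split <;> norm_num, ?_⟩
    rw [Finset.sum_eq_single ⟨0, hk⟩]
    · simp
    · intro u _ hu
      rw [if_neg (fun h => hu (Fin.ext h))]
    · simp

/-- If the weight of `h` is zero, so are all weights allotted to its continuations; hence the
arbitrary default of the strategy does no harm. -/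
theorem mass_mul_strategy {C : Inst} (hC : C.Feasible k) {h : List (Fin k)} (hh : h.length < C.n)
    (he : Even h.length) (u : Fin k) :
    (C.mass h.reverse : ℝ) * C.strategy h u = C.mass (h ++ [u]).reverse := by
  have hr : (h ++ [u]).reverse = u :: h.reverse := by simp
  rw [hr, mass_cons_even C (by simpa using he)]
  by_cases hm : 0 < C.mass h.reverse
  · have : (C.mass h.reverse : ℝ) ≠ 0 := by exact_mod_cast hm.ne'
    rw [Inst.strategy, if_pos ⟨he, hm⟩]
    field_simp
  · have h0 : C.mass h.reverse = 0 := by omega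
    have := sum_alloc_eq hC (g := h.reverse) (by simpa using hh) (by simpa using he)
    rw [h0, Finset.sum_eq_zero_iff] at this
    rw [h0, this u (Finset.mem_univ u)]
    simp

/-- Multiplying by the weight avoids conditioning on histories of weight zero. At complete plays
`mass_le` forces weight 0 outside I. At our turn weights add up, with `le_sum_min_alloc` for the
soft part; at the adversary's turn each child has the same weight and no smaller A-value, so
averaging over τ keeps the bound. -/
theorem reachProb_strategy {C : Inst} (hC : C.Feasible k) {τ : List (Fin k) → Fin k → ℝ}
    (hτ : IsStrategy C.n τ) (m : ℕ) (h : List (Fin k)) (hm : h.length + m = C.n) :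
    (C.mass h.reverse : ℝ) * reachProb C.strategy τ (language k C.hard) m h = C.mass h.reverse ∧
    (min (C.mass h.reverse)
      (gameVal (C.valA k) (C.n - h.length) (List.finRange k) h.reverse) : ℕ) ≤
      (C.mass h.reverse : ℝ) * reachProb C.strategy τ (language k C.hard ∩ language k C.soft) m h := by
  classical
  induction m generalizing h with
  | zero =>
    have hle := mass_le hC (g := h.reverse) (by rw [List.length_reverse]; omega)
    rw [List.length_reverse, show C.n - h.length = 0 by omega, gameVal, valI_eq,
      List.reverse_reverse] at hle
    rw [show C.n - h.length = 0 by omega, gameVal, valA_eq, List.reverse_reverse, reachProb,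
      reachProb]
    constructor
    · by_cases hI : h ∈ language k C.hard
      · simp [hI]
      · rw [if_neg hI] at hle
        simp [Nat.le_zero.1 hle]
    · split
      · simp
      · simp
  | succ m ih =>
    have ih' := fun u : Fin k => ih (h ++ [u]) (by
      simp only [List.length_append, List.length_singleton]; omega)
    have hr : ∀ u, (h ++ [u]).reverse = u :: h.reverse := fun u => by simp
    have hc : ∀ u, gameVal (C.valA k) (C.n - (h ++ [u]).length) (List.finRange k) (h ++ [u]).reverse
        = childVal (C.valA k) C.n h.reverse u := fun u => by simp [childVal]
    have hlt : h.length < C.n := by omega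
    by_cases he : Even h.length
    · simp only [reachProb, if_pos he, Finset.mul_sum, ← mul_assoc, mass_mul_strategy hC hlt he]
      constructor
      · rw [Finset.sum_congr rfl fun u _ => (ih' u).1, ← Nat.cast_sum,
          ← sum_alloc_eq hC (g := h.reverse) (by simpa using hlt) (by simpa using he)]
        congr 1
        refine Finset.sum_congr rfl fun u _ => ?_
        rw [hr, mass_cons_even C (by simpa using he)]
      · refine le_trans ?_ (Finset.sum_le_sum fun u _ => (ih' u).2)
        rw [← Nat.cast_sum, Nat.cast_le]
        have hv := gameVal_even (C.valA k) (n := C.n) (g := h.reverse) (by simpa using hlt)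
          (by simpa using he)
        rw [List.length_reverse] at hv
        rw [hv]
        refine (le_sum_min_alloc (C.mass h.reverse) (gameVal (C.valA k) (C.n - h.reverse.length)
          (List.finRange k) h.reverse) (childVal (C.valA k) C.n h.reverse)
          (childVal (C.valI k) C.n h.reverse)).trans (le_of_eq ?_)
        refine Finset.sum_congr rfl fun u _ => ?_
        rw [hc, hr, mass_cons_even C (by simpa using he)]
        rfl
    · have hmass : ∀ u, C.mass (h ++ [u]).reverse = C.mass h.reverse := fun u => by
        rw [hr, mass_cons_odd C (by simpa using he)]
      obtain ⟨hτ₀, hτ₁⟩ := hτ h hlt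
      simp only [reachProb, if_neg he, Finset.mul_sum, mul_left_comm _ (τ h _)]
      simp only [hmass] at ih'
      constructor
      · rw [Finset.sum_congr rfl fun u _ => by rw [(ih' u).1], ← Finset.sum_mul, hτ₁, one_mul]
      · have hle : ∀ u, (min (C.mass h.reverse) (gameVal (C.valA k) (C.n - h.length)
            (List.finRange k) h.reverse) : ℕ) ≤ (C.mass h.reverse : ℝ) *
            reachProb C.strategy τ (language k C.hard ∩ language k C.soft) m (h ++ [u]) := by
          intro u
          refine le_trans ?_ (ih' u).2
          rw [Nat.cast_le, hc]
          have := gameVal_odd_le (C.valA k) (n := C.n) (g := h.reverse) (by simpa using hlt)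
            (by simpa using he) u
          rw [List.length_reverse] at this
          exact min_le_min le_rfl this
        calc ((min (C.mass h.reverse) (gameVal (C.valA k) (C.n - h.length) (List.finRange k)
            h.reverse) : ℕ) : ℝ) = ∑ u, τ h u * (min (C.mass h.reverse) (gameVal (C.valA k)
            (C.n - h.length) (List.finRange k) h.reverse) : ℕ) := by
              rw [← Finset.sum_mul, hτ₁, one_mul]
          _ ≤ _ := Finset.sum_le_sum fun u _ => mul_le_mul_of_nonneg_left (hle u) (hτ₀ u)

theorem contProb_nonneg {n : ℕ} {σ τ : List (Fin k) → Fin k → ℝ} (hσ : IsStrategy n σ)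
    (hτ : IsStrategy n τ) (t h : List (Fin k)) (hn : h.length + t.length ≤ n) :
    0 ≤ contProb σ τ h t := by
  induction t generalizing h with
  | nil => simp [contProb]
  | cons u t ih =>
    simp only [List.length_cons] at hn
    rw [contProb]
    refine mul_nonneg ?_ (ih _ (by simp only [List.length_append, List.length_singleton]; omega))
    split
    · exact (hσ h (by omega)).1 u
    · exact (hτ h (by omega)).1 u

/-- A move of ours turns the weight of the history into that of its continuation; a move of the
adversary keeps the weight and contributes a factor at most 1. From the root this reads D · P(π) ≤
weight of π ≤ N. -/
theorem mass_mul_contProb_le {C : Inst} (hC : C.Feasible k) {τ : List (Fin k) → Fin k → ℝ}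
    (hτ : IsStrategy C.n τ) (t h : List (Fin k)) (hn : h.length + t.length ≤ C.n) :
    (C.mass h.reverse : ℝ) * contProb C.strategy τ h t ≤ C.mass (h ++ t).reverse := by
  induction t generalizing h with
  | nil => simp [contProb]
  | cons u t ih =>
    simp only [List.length_cons] at hn
    have ih' := ih (h ++ [u]) (by simp only [List.length_append, List.length_singleton]; omega)
    have hnn := contProb_nonneg (isStrategy_strategy hC) hτ t (h ++ [u])
      (by simp only [List.length_append, List.length_singleton]; omega)
    rw [List.append_assoc, List.singleton_append] at ih'
    refine le_trans ?_ ih'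
    rw [contProb, ← mul_assoc]
    refine mul_le_mul_of_nonneg_right ?_ hnn
    by_cases he : Even h.length
    · rw [if_pos he, mass_mul_strategy hC (by omega) he]
    · have hr : (h ++ [u]).reverse = u :: h.reverse := by simp
      rw [if_neg he, hr, mass_cons_odd C (by simpa using he)]
      obtain ⟨hτ₀, hτ₁⟩ := hτ h (by omega)
      refine mul_le_of_le_one_right (Nat.cast_nonneg _) ?_
      rw [← hτ₁]
      exact Finset.single_le_sum (fun v _ => hτ₀ v) (Finset.mem_univ u)

theorem Inst.Feasible.isImprovising {C : Inst} (hC : C.Feasible k) :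
    IsImprovising C (C.strategy (k := k)) := by
  have hD : (0 : ℝ) < C.ρ.den := by exact_mod_cast C.ρ.den_pos
  have hE : (0 : ℝ) < C.ε.den := by exact_mod_cast C.ε.den_pos
  refine ⟨isStrategy_strategy hC, fun τ hτ => ?_⟩
  obtain ⟨h₁, h₂⟩ := reachProb_strategy hC hτ C.n [] (by simp)
  have hmass : C.mass ([] : List (Fin k)).reverse = C.ρ.den := rfl
  rw [hmass] at h₁ h₂
  refine ⟨?_, ?_, ?_⟩
  · rw [Inst.I, setProb_eq]
    exact mul_left_cancel₀ hD.ne' (h₁.trans (mul_one _).symm)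
  · have hA : setProb C.strategy τ (C.A k) =
        reachProb C.strategy τ (language k C.hard ∩ language k C.soft) C.n [] := by
      rw [← setProb_eq]; rfl
    rw [hA]
    have hnum : C.ε.num.toNat ≤ C.ε.den := by
      have h2 : (C.ε : ℝ) ≤ 1 := by exact_mod_cast C.ε_le_one
      rw [cast_eps, div_le_one hE] at h2
      exact_mod_cast h2
    have h₃ := hC.2
    -- The guaranteed weight in A is min(D, V_A). The term D is harmless because 1 - ε ≤ 1.
    have h₄ : (C.ε.den - C.ε.num.toNat) * C.ρ.den ≤ C.ε.den * min C.ρ.den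
        (gameVal (C.valA k) C.n (List.finRange k) []) := by
      rw [← Nat.mul_min_mul_left]
      exact le_min (Nat.mul_le_mul_right _ (Nat.sub_le _ _)) h₃
    have h₅ := (Nat.cast_le (α := ℝ)).2 h₄
    push_cast [Nat.cast_sub hnum] at h₅
    simp only [List.length_nil, Nat.sub_zero, List.reverse_nil] at h₂
    push_cast at h₂
    have h₆ := h₅.trans (mul_le_mul_of_nonneg_left h₂ hE.le)
    rw [mul_left_comm, mul_comm, mul_le_mul_iff_right₀ hD] at h₆
    rw [cast_eps, one_sub_div hE.ne', div_le_iff₀ hE, mul_comm _ (C.ε.den : ℝ)]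
    exact h₆
  · intro π hπ
    have h₃ := mass_mul_contProb_le hC hτ (List.ofFn π) [] (by simp)
    have h₄ := mass_le hC (g := (List.ofFn π).reverse) (by simp)
    rw [hmass, List.nil_append, ← playProb_eq] at h₃
    classical
    rw [List.length_reverse, List.length_ofFn, Nat.sub_self, gameVal, valI_eq,
      List.reverse_reverse] at h₄
    have h₅ : C.mass (List.ofFn π).reverse ≤ C.ρ.num.toNat := h₄.trans (by split <;> simp)
    rw [cast_rho, le_div_iff₀ hD, mul_comm]
    exact h₃.trans (by exact_mod_cast h₅)


/-! ### The search for the selected symbol -/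

/-- The index selected by the number `r` when index `i` has weight `ms[i]`. -/
def pick : List ℕ → ℕ → Option ℕ
  | [], _ => none
  | m :: ms, r => if r < m then some 0 else (pick ms (r - m)).map (· + 1)

/-- The numbers below N split into consecutive blocks of lengths `ms[i]`, one per index, and a
remainder that selects nothing. For uniform r this is the law of one attempt. -/
theorem sum_pick (ms : List ℕ) (N : ℕ) (hN : ms.sum ≤ N) (φ : Option ℕ → ℝ) :
    ∑ r ∈ Finset.range N, φ (pick ms r) =
      ∑ i ∈ Finset.range ms.length, ms.getD i 0 * φ (some i) + (N - ms.sum) * φ none := by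
  induction ms generalizing N φ with
  | nil => simp [pick]
  | cons m ms ih =>
    rw [List.sum_cons] at hN
    obtain ⟨N', rfl⟩ : ∃ N', N = m + N' := ⟨N - m, by omega⟩
    have h := ih N' (by omega) fun o => φ (o.map (· + 1))
    rw [Finset.sum_range_add, List.length_cons, Finset.sum_range_succ']
    have h₁ : ∑ r ∈ Finset.range m, φ (pick (m :: ms) r) = m * φ (some 0) := by
      rw [Finset.sum_congr rfl fun r hr => by rw [pick, if_pos (Finset.mem_range.1 hr)]]
      simp
    have h₂ : ∀ r, pick (m :: ms) (m + r) = (pick ms r).map (· + 1) := fun r => by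
      rw [pick, if_neg (by omega), Nat.add_sub_cancel_left]
    simp only [h₁, h₂, h]
    simp
    ring

/-- Weights are subtracted from r one after the other; the first borrow marks the block containing
r. The start index i is arbitrary for the induction. -/
theorem select_loop_ev : ∃ s, PB s ∧ ∀ (L : ℕ) (ws : List Val) (r : Val) (i : ℕ),
    (∀ w ∈ ws, w.IsBin L) → r.IsBin L → (Val.ofList ws).size + (Val.unary i).size ≤ L →
    ∃ a b c, Ev (.iter .selectBody) (.cons (.ofList ws) (.cons r (.cons (.unary i) .nil)))
      (.cons a (.cons b (.cons c (match pick (ws.map Val.bval) r.bval with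
        | none => .nil
        | some j => .cons .one (.unary (i + j)))))) (s L) := by
  obtain ⟨s₁, hs₁, h₁⟩ := sub_ev
  obtain ⟨g, hg⟩ : ∃ g : F, g = .ite (.hd (.get 0))
    (.cons .nil (.cons .nil (.cons .nil (.cons .one (.get 3)))))
      (.cons (.tl (.get 1)) (.cons (.tl (.get 0)) (.cons (.cons .nil (.get 3)) (.drop 4)))) :=
    ⟨_, rfl⟩
  refine ⟨fun L => s₁ L + (g.cost + 1000) * (100 * L + 100), by fun_prop, ?_⟩
  intro L ws
  induction ws with
  | nil =>
    intro r i _ hr hsz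
    refine ⟨.nil, r, .unary i, .iter_done rfl ?_⟩
    have := hr.size_le
    simp only [Val.size, Val.ofList] at *
    nlinarith
  | cons w ws ih =>
    intro r i hws hr hsz
    have hw := hws w (by simp)
    obtain ⟨f, d, e₁, hf, hd, ht, ht'⟩ := h₁ L r w hr hw
    obtain ⟨st, hst⟩ : ∃ st, st = Val.cons (.ofList (w :: ws)) (.cons r (.cons (.unary i) .nil)) :=
      ⟨_, rfl⟩
    have body : Ev .selectBody st (g.eval (.cons (.cons f d) st))
        (s₁ L + (g.cost + 1000) * (100 * L + 100)) := by
      have e₂ := Ev.of_loopFree (f := g) (by subst hg; rfl) (.cons (.cons f d) st)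
      have e := Ev.bind (g := .sub) (a := .cons .nil (.cons (.get 1) (.hd (.get 0)))) (x := st) rfl
        (by subst hst; exact e₁) e₂
      have hb : F.selectBody = .bind .sub (.cons .nil (.cons (.get 1) (.hd (.get 0)))) g := by
        subst hg; rfl
      rw [hb]
      refine e.mono ?_
      have hsz₁ : (Val.cons (.cons f d) st).size ≤ 9 * L + 20 := by
        have := hr.size_le
        have := hd.size_le
        have := hf.size_le
        subst hst
        simp only [Val.size] at *
        omega
      have := Nat.mul_le_mul_left g.cost (show (Val.cons (.cons f d) st).size ≤ 100 * L + 100 by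
        omega)
      have h₃ := add_mul g.cost 1000 (100 * L + 100)
      simp only [F.get, F.drop, F.cost, Val.size] at *
      omega
    have hne : st.hd ≠ .nil := by subst hst; simp [Val.hd, Val.ofList]
    rw [← hst]
    have hval : pick ((w :: ws).map Val.bval) r.bval = if r.bval < w.bval then some 0 else
        (pick (ws.map Val.bval) (r.bval - w.bval)).map (· + 1) := rfl
    rw [hval]
    by_cases hfn : f = .nil
    · have hb := ht hfn
      have he : g.eval (.cons (.cons f d) st) =
          .cons (.ofList ws) (.cons d (.cons (.unary (i + 1)) .nil)) := by
        subst hg hst hfn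
        rfl
      rw [he] at body
      obtain ⟨a, b, c, e⟩ := ih d (i + 1) (fun w hw => hws w (by simp [hw])) hd (by
        simp only [Val.ofList, Val.unary, Val.size] at *
        have := w.one_le_size
        omega)
      refine ⟨a, b, c, ?_⟩
      rw [if_neg (by omega), show r.bval - w.bval = d.bval by omega]
      have := Ev.iter_step hne body e le_rfl le_rfl
      cases hp : pick (ws.map Val.bval) d.bval with
      | none => simpa [hp] using this
      | some j => simpa [hp, add_assoc, add_comm 1 j] using this
    · have hb := ht' hfn
      have he : g.eval (.cons (.cons f d) st) =
          .cons .nil (.cons .nil (.cons .nil (.cons .one (.unary i)))) := by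
        subst hg hst
        rcases hf with rfl | rfl
        · exact absurd rfl hfn
        · rfl
      rw [he] at body
      refine ⟨.nil, .nil, .nil, ?_⟩
      rw [if_pos hb]
      exact Ev.iter_step hne body (.iter_done rfl (body.size_le.2)) le_rfl le_rfl

theorem select_ev : ∃ s, PB s ∧ ∀ (L : ℕ) (ws : List Val) (r M : Val),
    (∀ w ∈ ws, w.IsBin L) → r.IsBin L → M.IsBin L → (Val.ofList ws).size + 1 ≤ L →
    Ev .select (.cons r (.cons .one (.cons (.ofList ws) M)))
      (match pick (ws.map Val.bval) r.bval with
        | none => .cons .one (.cons (.ofList ws) M)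
        | some j => .cons .nil (.unary j)) (s L) := by
  obtain ⟨s₁, hs₁, h₁⟩ := select_loop_ev
  obtain ⟨g, hg⟩ : ∃ g : F, g = .ite (.tl (.tl (.tl (.get 0))))
    (.cons .nil (.tl (.tl (.tl (.tl (.get 0)))))) (.drop 2) := ⟨_, rfl⟩
  refine ⟨fun L => s₁ L + g.cost * (s₁ L + 100 * L + 100) + 1000 * (100 * L + 100),
    by fun_prop, ?_⟩
  intro L ws r M hws hr hM hsz
  obtain ⟨a, b, c, e₁⟩ := h₁ L ws r 0 hws hr (by simpa [Val.unary, Val.size] using hsz)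
  obtain ⟨st, hst⟩ : ∃ st, st = Val.cons r (.cons .one (.cons (.ofList ws) M)) := ⟨_, rfl⟩
  have hst₁ : st.size ≤ 10 * L + 10 := by
    have := hr.size_le
    have := hM.size_le
    subst hst
    simp only [Val.size] at *
    omega
  obtain ⟨v, hv⟩ : ∃ v, v = Val.cons a (.cons b (.cons c (match pick (ws.map Val.bval) r.bval with
        | none => Val.nil
        | some j => .cons .one (.unary (0 + j))))) := ⟨_, rfl⟩
  rw [← hv] at e₁
  have e₂ := Ev.of_loopFree (f := g) (by subst hg; rfl) (.cons v st)
  have e := Ev.bind (g := .iter .selectBody) (a := .cons (.get 2) (.cons (.get 0) (.cons .nil .nil)))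
    (x := st) rfl (by subst hst; exact e₁) e₂
  have hb : F.select = .bind (.iter .selectBody) (.cons (.get 2) (.cons (.get 0) (.cons .nil .nil)))
      g := by subst hg; rfl
  have he : g.eval (.cons v st) = (match pick (ws.map Val.bval) r.bval with
        | none => .cons .one (.cons (.ofList ws) M)
        | some j => .cons .nil (.unary j)) := by
    subst hg hst hv
    cases pick (ws.map Val.bval) r.bval with
    | none => rfl
    | some j => simp [F.eval, F.get, F.drop, Val.hd, Val.tl]
  rw [← hst, hb, ← he]
  refine e.mono ?_
  have h₂ := e₁.size_le.2
  have := Nat.mul_le_mul_left g.cost (show (Val.cons v st).size ≤ s₁ L + 100 * L + 100 by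
    simp only [Val.size]; omega)
  simp only [F.get, F.drop, F.cost]
  omega

/-! ### Runs that branch at the coin tosses -/

/-- `Branch s c l`: the run from `c` reaches each entry of the list `l` with the same probability,
with stores of size at most `s` before that. -/
inductive Branch (s : ℕ) : Cfg → List Cfg → Prop
  | leaf (c : Cfg) : Branch s c [c]
  | det {c c' : Cfg} {l : List Cfg} : c.store.size ≤ s → (∀ b, step b c = c') → Branch s c' l →
      Branch s c l
  | flip {c : Cfg} {l₁ l₂ : List Cfg} : c.store.size ≤ s → Branch s (step false c) l₁ →
      Branch s (step true c) l₂ → l₁.length = l₂.length → Branch s c (l₁ ++ l₂)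

theorem Path.branch {s : ℕ} {c c' : Cfg} {l : List Cfg} (h : Path s c c') (h' : Branch s c' l) :
    Branch s c l := by
  induction h with
  | refl => exact h'
  | head a b _ ih => exact .det a b (ih h')

theorem Branch.map {s : ℕ} {c : Cfg} {l : List Cfg} (h : Branch s c l) (f : Cfg → Cfg)
    (hf : ∀ c ∈ l, Path s c (f c)) : Branch s c (l.map f) := by
  induction h with
  | leaf c => exact (hf c (by simp)).branch (.leaf _)
  | det a b _ ih => exact .det a b (ih hf)
  | flip a _ _ h ih₁ ih₂ =>
    rw [List.map_append]
    exact .flip a (ih₁ fun c hc => hf c (by simp [hc])) (ih₂ fun c hc => hf c (by simp [hc]))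
      (by simpa using h)

theorem Branch.safeFor {s t : ℕ} {c : Cfg} {l : List Cfg} (h : Branch s c l)
    (hl : ∀ c ∈ l, SafeFor s t c) : SafeFor s t c := by
  induction h with
  | leaf c => exact hl c (by simp)
  | det a b _ ih => exact .step' a fun d => by rw [b d]; exact ih hl
  | flip a _ _ h ih₁ ih₂ =>
    refine .step' a fun d => ?_
    cases d
    · exact ih₁ fun c hc => hl c (by simp [hc])
    · exact ih₂ fun c hc => hl c (by simp [hc])

/-- `V` is at most `δ` larger at a configuration than on average after the next step. -/
def StepLE (δ : ℝ) (V : Cfg → ℝ) : Prop :=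
  ∀ c, V c ≤ δ + (V (step false c) + V (step true c)) / 2

/-- B can be the expected length of the branches and does not depend on V. With δ = 0 the lemma
gives output probabilities, with δ = 1 a bound on expected time. -/
theorem Branch.exists_le {s : ℕ} {c : Cfg} {l : List Cfg} (h : Branch s c l) :
    ∃ B : ℝ, ∀ δ V, 0 ≤ δ → StepLE δ V → V c ≤ δ * B + (l.map V).sum / l.length := by
  induction h with
  | leaf c => exact ⟨0, fun δ V _ _ => by simp⟩
  | det a b _ ih =>
    obtain ⟨B, hB⟩ := ih
    refine ⟨B + 1, fun δ V hδ hV => ?_⟩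
    have h₁ := hV
    have h₂ := hB δ V hδ hV
    refine (hV _).trans ?_
    rw [b, b]
    linarith
  | flip a _ _ h ih₁ ih₂ =>
    obtain ⟨B₁, hB₁⟩ := ih₁
    obtain ⟨B₂, hB₂⟩ := ih₂
    refine ⟨1 + (B₁ + B₂) / 2, fun δ V hδ hV => ?_⟩
    have h₁ := hB₁ δ V hδ hV
    have h₂ := hB₂ δ V hδ hV
    refine (hV _).trans ?_
    rw [List.map_append, List.sum_append, List.length_append, ← h]
    rw [← h] at h₂
    push_cast
    rw [← two_mul, mul_comm (2 : ℝ), ← div_div, add_div (List.sum _)]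
    linarith

/-! ### Output probabilities and expected time -/

theorem prob_nonneg (E : Set Cfg) (t : ℕ) (c : Cfg) : 0 ≤ prob E t c := by
  induction t generalizing c with
  | zero => rw [prob]; split <;> norm_num
  | succ t ih => rw [prob]; linarith [ih (step false c), ih (step true c)]

theorem prob_le_one (E : Set Cfg) (t : ℕ) (c : Cfg) : prob E t c ≤ 1 := by
  induction t generalizing c with
  | zero => rw [prob]; split <;> norm_num
  | succ t ih => rw [prob]; linarith [ih (step false c), ih (step true c)]

theorem prob_output_halted (y z : Val) [Decidable (z = y)] (t : ℕ) :
    prob {c | c = ⟨[], y⟩} t ⟨[], z⟩ = if z = y then 1 else 0 := by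
  induction t with
  | zero => simp [prob]
  | succ t ih => rw [prob, step, step, ih, add_self_div_two]

theorem prob_output_mono (y : Val) (c : Cfg) : Monotone fun t => prob {c | c = ⟨[], y⟩} t c := by
  classical
  refine monotone_nat_of_le_succ fun t => ?_
  induction t generalizing c with
  | zero =>
    by_cases h : c = ⟨[], y⟩
    · rw [h, prob_output_halted, prob_output_halted]
    · rw [prob, if_neg (by simpa using h)]
      exact prob_nonneg _ _ _
  | succ t ih =>
    have h₁ := ih (step false c)
    have h₂ := ih (step true c)
    simp only [prob] at h₁ h₂ ⊢
    linarith

/-- The probability that the run from `c` halts with output `y`. -/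
noncomputable def outputProb (y : Val) (c : Cfg) : ℝ := ⨆ t, prob {c | c = ⟨[], y⟩} t c

theorem tendsto_outputProb (y : Val) (c : Cfg) :
    Filter.Tendsto (fun t => prob {c | c = ⟨[], y⟩} t c) Filter.atTop (nhds (outputProb y c)) :=
  tendsto_atTop_ciSup (prob_output_mono y c)
    ⟨1, by rintro _ ⟨t, rfl⟩; exact prob_le_one _ _ _⟩

theorem outputProb_step (y : Val) (c : Cfg) :
    outputProb y c = (outputProb y (step false c) + outputProb y (step true c)) / 2 := by
  have h := ((tendsto_outputProb y (step false c)).add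
    (tendsto_outputProb y (step true c))).div_const 2
  exact tendsto_nhds_unique ((Filter.tendsto_add_atTop_iff_nat 1).2 (tendsto_outputProb y c)) h

theorem outputProb_halted (y z : Val) [Decidable (z = y)] :
    outputProb y ⟨[], z⟩ = if z = y then 1 else 0 := by
  refine tendsto_nhds_unique (tendsto_outputProb y _) ?_
  simp only [prob_output_halted]
  exact tendsto_const_nhds

/-- `outputProb` equals its average after one step, so `Branch.exists_le` with δ = 0 applies to it
and to its negative. -/
theorem Branch.outputProb_eq {s : ℕ} {c : Cfg} {l : List Cfg} (h : Branch s c l) (y : Val) :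
    outputProb y c = (l.map (outputProb y)).sum / l.length := by
  obtain ⟨B, hB⟩ := h.exists_le
  have h₁ := hB 0 (outputProb y) le_rfl fun c => by rw [zero_add, ← outputProb_step]
  have h₂ := hB 0 (fun c => -outputProb y c) le_rfl fun c => by
    have := outputProb_step y c
    linarith
  have h₃ : (l.map fun c => -outputProb y c).sum = -(l.map (outputProb y)).sum := by
    clear h hB h₁ h₂
    induction l with
    | nil => simp
    | cons a l ih => simp_all [add_comm]
  rw [h₃, neg_div] at h₂
  linarith

/-- The expected number of steps from `c` among the first `t`. -/
noncomputable def timeUpTo (t : ℕ) (c : Cfg) : ℝ :=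
  ∑ i ∈ Finset.range t, prob {c | c.ctrl ≠ []} i c

theorem timeUpTo_halted (t : ℕ) (y : Val) : timeUpTo t ⟨[], y⟩ = 0 := by
  refine Finset.sum_eq_zero fun i hi => ?_
  clear hi
  induction i with
  | zero => simp [prob]
  | succ i ih => rw [prob, step, step, ih, add_self_div_two]

/-- Truncation at t keeps the quantity finite before convergence is known. The first step counts at
most 1, and the remaining terms are averages over its successors. -/
theorem stepLE_timeUpTo (t : ℕ) : StepLE 1 (timeUpTo t) := by
  intro c
  have h₁ : timeUpTo t c ≤ timeUpTo (t + 1) c := by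
    rw [timeUpTo, timeUpTo, Finset.sum_range_succ]
    linarith [prob_nonneg {c | c.ctrl ≠ []} t c]
  refine h₁.trans ?_
  rw [timeUpTo, Finset.sum_range_succ', add_comm]
  refine add_le_add (prob_le_one _ _ _) (le_of_eq ?_)
  simp only [prob]
  rw [← Finset.sum_div, Finset.sum_add_distrib]
  rfl

theorem finiteExpectedTime_of_le {P : Prog} {x : Val} {B : ℝ}
    (h : ∀ t, timeUpTo t (init P x) ≤ B) : FiniteExpectedTime P x :=
  summable_of_sum_range_le (fun _ => prob_nonneg _ _ _) h


/-! ### The improviser -/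

theorem unary_injective : Function.Injective Val.unary := by
  intro m n h
  induction m generalizing n with
  | zero => cases n with
    | zero => rfl
    | succ n => simp [Val.unary] at h
  | succ m ih => cases n with
    | zero => simp [Val.unary] at h
    | succ n => rw [ih (Val.cons.inj h).2]

theorem pick_lt {ms : List ℕ} {r j : ℕ} (h : pick ms r = some j) : j < ms.length := by
  induction ms generalizing r j with
  | nil => simp [pick] at h
  | cons m ms ih =>
    rw [pick] at h
    split at h
    · simp only [Option.some.injEq] at h
      subst h
      simp
    · obtain ⟨i, hi, rfl⟩ := Option.map_eq_some_iff.1 h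
      simpa using ih hi

/-- The length of a list. -/
def Val.depth : Val → ℕ
  | .nil => 0
  | .cons _ b => b.depth + 1

theorem Val.IsBin.depth_le {L : ℕ} {a : Val} (h : a.IsBin L) : a.depth ≤ L ∧ a.IsBin a.depth := by
  induction L generalizing a with
  | zero => rw [h.eq_nil]; exact ⟨le_rfl, .nil _⟩
  | succ L ih =>
    cases a with
    | nil => exact ⟨Nat.zero_le _, .nil _⟩
    | cons b t => exact ⟨Nat.succ_le_succ (ih h.2).1, h.1, (ih h.2).2⟩

/-- The results of pushing `L` bits onto `a`. -/
def pushBits : ℕ → Val → List Val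
  | 0, a => [a]
  | L + 1, a => pushBits L (.cons (.bit false) a) ++ pushBits L (.cons (.bit true) a)

theorem length_pushBits (L : ℕ) (a : Val) : (pushBits L a).length = 2 ^ L := by
  induction L generalizing a with
  | zero => rfl
  | succ L ih => rw [pushBits, List.length_append, ih, ih, pow_succ, mul_two]

/-- The bit pushed first becomes the most significant one, so the outcomes appear in increasing
order. -/
theorem map_bval_pushBits (L : ℕ) (a : Val) :
    (pushBits L a).map Val.bval = (List.range (2 ^ L)).map (2 ^ L * a.bval + ·) := by
  induction L generalizing a with
  | zero => simp [pushBits]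
  | succ L ih =>
    rw [pushBits, List.map_append, ih, ih, pow_succ, mul_two, List.range_add, List.map_append,
      List.map_map]
    congr 1
    · refine List.map_congr_left fun j _ => ?_
      simp [Val.bval, Val.bit, Val.truth]
      ring
    · refine List.map_congr_left fun j _ => ?_
      simp [Val.bval, Val.bit, Val.truth]
      ring

theorem Val.IsBin.pushBits {m : ℕ} {a : Val} (h : a.IsBin m) (L : ℕ) :
    ∀ b ∈ pushBits L a, b.IsBin (m + L) := by
  induction L generalizing a m with
  | zero => simpa [Improv.pushBits] using h
  | succ L ih =>
    intro b hb
    rw [Improv.pushBits, List.mem_append] at hb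
    rw [show m + (L + 1) = m + 1 + L by omega]
    rcases hb with hb | hb
    · exact ih (m := m + 1) (a := .cons (.bit false) a) ⟨Or.inl rfl, h⟩ b hb
    · exact ih (m := m + 1) (a := .cons (.bit true) a) ⟨Or.inr rfl, h⟩ b hb

/-- The loop that tosses the coins. -/
def flipLoop : Prog :=
  .loop (.hd .var) (.seq .flip
    (.assign (.cons (.tl (.hd (.tl .var))) (.cons (.cons (.hd .var) (.hd (.tl (.tl .var))))
      (.tl (.tl (.tl .var)))))))

/-- The digit list `cnt` serves only as a counter. A dropped entry frees at least two nodes and a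
pushed bit costs at most four, hence the factor 2. -/
theorem flipLoop_branch {S : ℕ} (cnt acc r : Val) (K : List Prog)
    (hS : 2 * cnt.size + acc.size + r.size + 10 ≤ S) :
    Branch S ⟨flipLoop :: K, .cons cnt (.cons acc r)⟩
      ((pushBits cnt.depth acc).map fun a => ⟨K, .cons .nil (.cons a r)⟩) := by
  induction cnt generalizing acc with
  | nil =>
    exact .det (by simp only [Val.size] at *; omega) (fun _ => rfl) (.leaf _)
  | cons x t _ ih =>
    have hx := x.one_le_size
    have key : ∀ b, Branch S ⟨(.assign (.cons (.tl (.hd (.tl .var))) (.cons (.cons (.hd .var)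
        (.hd (.tl (.tl .var)))) (.tl (.tl (.tl .var)))))) :: flipLoop :: K,
        .cons (.bit b) (.cons (.cons x t) (.cons acc r))⟩
        ((pushBits t.depth (.cons (.bit b) acc)).map fun a => ⟨K, .cons .nil (.cons a r)⟩) := by
      intro b
      have hb : (Val.bit b).size ≤ 3 := by cases b <;> simp [Val.bit, Val.size]
      refine .det (by simp only [Val.size] at *; omega) (fun _ => rfl) (ih _ ?_)
      simp only [Expr.eval, Val.hd, Val.tl, Val.size] at *
      omega
    rw [Val.depth, pushBits, List.map_append]
    refine .det (by simp only [Val.size] at *; omega) (fun _ => rfl) ?_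
    refine .det (by simp only [Val.size] at *; omega) (fun _ => rfl) ?_
    refine .flip (by simp only [Val.size] at *; omega) (key false) (key true) ?_
    simp [length_pushBits]

/-- The last instruction of the improviser. -/
def outputInstr : Prog := .assign (.tl (.hd .var))

/-- The configuration before an attempt to sample a symbol. -/
def attemptCfg (ws : List Val) (M : Val) : Cfg :=
  ⟨[sampler, outputInstr], .cons (.cons .one (.cons (.ofList ws) M)) .nil⟩

/-- The configuration after the choice of the symbol with the given index, if any. -/
def attemptResult (ws : List Val) (M : Val) : Option ℕ → Cfg
  | none => attemptCfg ws M
  | some j => ⟨[], .unary j⟩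

/-- An attempt either outputs a symbol or returns to the very configuration it started from. The
branching is stated after the first step, so that each attempt uses up at least one step in
`attempt_safeFor`. -/
theorem attempt_branch : ∃ s, PB s ∧ ∀ (L : ℕ) (ws : List Val) (M : Val),
    (∀ w ∈ ws, w.IsBin L) → M.IsBin L → (Val.ofList ws).size + 1 ≤ L →
    (attemptCfg ws M).store.size ≤ s L ∧
    (∀ b, Branch (s L) (step b (attemptCfg ws M)) ((List.range (2 ^ M.depth)).map fun r =>
      attemptResult ws M (pick (ws.map Val.bval) r))) := by
  obtain ⟨s, hs, h⟩ := select_ev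
  refine ⟨fun L => s L + 100 * L + 100, by fun_prop, ?_⟩
  intro L ws M hws hM hsz
  have hMs := hM.size_le
  have h₀ : (attemptCfg ws M).store.size ≤ s L + 100 * L + 100 := by
    simp only [attemptCfg, Val.one, Val.size] at *
    omega
  refine ⟨h₀, fun b => ?_⟩
  obtain ⟨st, hst⟩ : ∃ st, st = Val.cons .one (.cons (.ofList ws) M) := ⟨_, rfl⟩
  have hst₁ : st.size ≤ 10 * L + 10 := by
    subst hst
    simp only [Val.one, Val.size] at *
    omega
  have hstep : step b (attemptCfg ws M) =
      ⟨[sampleBody, sampler, outputInstr], .cons st .nil⟩ := by subst hst; rfl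
  rw [hstep]
  refine .det (c' := ⟨[.assign (.cons (.tl (.tl (.hd .var))) (.cons .nil .var)), .seq flipLoop
    (.seq (.assign (.cons (.cons (.hd (.tl .var)) (.hd (.tl (.tl .var)))) .nil))
      F.select.toProg), sampler, outputInstr], .cons st .nil⟩)
    (by simp only [Val.size]; omega) (fun _ => rfl) ?_
  refine .det (c' := ⟨[.seq flipLoop (.seq (.assign (.cons (.cons (.hd (.tl .var))
    (.hd (.tl (.tl .var)))) .nil)) F.select.toProg), sampler, outputInstr],
    .cons M (.cons .nil (.cons st .nil))⟩) (by simp only [Val.size]; omega)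
    (fun _ => by subst hst; rfl) ?_
  refine .det (c' := ⟨[flipLoop, .seq (.assign (.cons (.cons (.hd (.tl .var))
    (.hd (.tl (.tl .var)))) .nil)) F.select.toProg, sampler, outputInstr],
    .cons M (.cons .nil (.cons st .nil))⟩) (by simp only [Val.size]; omega) (fun _ => rfl) ?_
  have hfl := flipLoop_branch (S := s L + 100 * L + 100) M .nil (.cons st .nil)
    [.seq (.assign (.cons (.cons (.hd (.tl .var)) (.hd (.tl (.tl .var)))) .nil)) F.select.toProg,
      sampler, outputInstr] (by simp only [Val.size]; omega)
  have hmap := hfl.map (fun c => attemptResult ws M (pick (ws.map Val.bval) c.store.tl.hd.bval)) ?_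
  · rw [List.map_map] at hmap
    have hl : (pushBits M.depth .nil).map (fun a => attemptResult ws M (pick (ws.map Val.bval)
        a.bval)) = (List.range (2 ^ M.depth)).map fun r =>
        attemptResult ws M (pick (ws.map Val.bval) r) := by
      have := congrArg (List.map fun r => attemptResult ws M (pick (ws.map Val.bval) r))
        (map_bval_pushBits M.depth .nil)
      rw [List.map_map, List.map_map] at this
      simpa [Function.comp_def, Val.bval] using this
    rw [← hl]
    exact hmap
  · intro c hc
    obtain ⟨a, ha, rfl⟩ := List.mem_map.1 hc
    have hab : a.IsBin L := by
      have := (Val.IsBin.nil 0).pushBits M.depth a ha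
      exact this.mono (by have := hM.depth_le.1; omega)
    have has := hab.size_le
    have e := h L ws a M hws hab hM hsz
    have es := e.size_le.2
    rw [← hst] at e
    refine .head (by simp only [Val.size]; omega) (fun _ => rfl) ?_
    refine .head (by simp only [Val.size]; omega) (fun _ => rfl) ?_
    refine ((e.path .nil [sampler, outputInstr]).mono
      (by simp only [Val.size]; omega)).trans ?_
    simp only [Val.tl, Val.hd]
    cases hp : pick (ws.map Val.bval) a.bval with
    | none =>
      subst hst
      exact .refl _
    | some j =>
      rw [hp] at es
      refine .head (c₁ := ⟨[outputInstr], .cons (.cons .nil (.unary j)) .nil⟩)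
        (by simp only [Val.size] at *; omega) (fun _ => rfl) ?_
      exact .head (by simp only [Val.size] at *; omega) (fun _ => rfl) (.refl _)

theorem le_size_ofList (l : List Val) : 2 * l.length + 1 ≤ (Val.ofList l).size := by
  induction l with
  | nil => simp [Val.ofList, Val.size]
  | cons a l ih =>
    have := a.one_le_size
    simp only [Val.ofList, Val.size, List.length_cons]
    omega

/-- Induction on the number of steps: a failed attempt leads back to the same store with fewer steps
to go, so the unbounded number of attempts does not matter. -/
theorem attempt_safeFor {S : ℕ} {ws : List Val} {M : Val}
    (h₁ : (attemptCfg ws M).store.size ≤ S)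
    (h₂ : ∀ b, Branch S (step b (attemptCfg ws M)) ((List.range (2 ^ M.depth)).map fun r =>
      attemptResult ws M (pick (ws.map Val.bval) r))) (t : ℕ) :
    SafeFor S t (attemptCfg ws M) := by
  have hS : 2 * ws.length + 1 ≤ S := by
    have := le_size_ofList ws
    simp only [attemptCfg, Val.size] at h₁
    omega
  induction t with
  | zero =>
    intro ω hω
    rw [List.length_eq_zero_iff.1 (Nat.le_zero.1 hω)]
    exact h₁
  | succ t ih =>
    refine .step h₁ fun b => (h₂ b).safeFor fun c hc => ?_
    obtain ⟨r, -, rfl⟩ := List.mem_map.1 hc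
    cases hp : pick (ws.map Val.bval) r with
    | none => exact ih
    | some j =>
      have := pick_lt hp
      rw [List.length_map] at this
      exact .halted (by rw [size_unary]; omega)

theorem sum_attempt {ws : List Val} {M : Val} (hsum : (ws.map Val.bval).sum ≤ 2 ^ M.depth)
    (V : Cfg → ℝ) :
    (((List.range (2 ^ M.depth)).map fun r => attemptResult ws M (pick (ws.map Val.bval) r)).map
      V).sum = ∑ i ∈ Finset.range ws.length, (ws.map Val.bval).getD i 0 * V ⟨[], .unary i⟩ +
        (2 ^ M.depth - (ws.map Val.bval).sum) * V (attemptCfg ws M) := by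
  have h := sum_pick (ws.map Val.bval) (2 ^ M.depth) hsum fun o => V (attemptResult ws M o)
  rw [List.length_map, Nat.cast_pow, Nat.cast_ofNat] at h
  rw [List.map_map]
  exact h

/-- With m the value of M and K = 2 ^ `M.depth`, the probability P of output i satisfies P = (wᵢ +
(K - m) P) / K. As m > 0, this gives P = wᵢ / m. -/
theorem outputProb_attempt {S : ℕ} {ws : List Val} {M : Val}
    (h : ∀ b, Branch S (step b (attemptCfg ws M)) ((List.range (2 ^ M.depth)).map fun r =>
      attemptResult ws M (pick (ws.map Val.bval) r)))
    (hsum : (ws.map Val.bval).sum = M.bval) (hM : M.bval ≤ 2 ^ M.depth) (hpos : 0 < M.bval)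
    {i : ℕ} (hi : i < ws.length) :
    outputProb (.unary i) (attemptCfg ws M) = ((ws.map Val.bval).getD i 0 : ℝ) / M.bval := by
  classical
  have h₁ := fun b => (h b).outputProb_eq (.unary i)
  have h₂ := outputProb_step (.unary i) (attemptCfg ws M)
  rw [h₁, h₁, sum_attempt (hsum.le.trans hM), add_self_div_two, hsum,
    Finset.sum_eq_single i] at h₂
  · rw [outputProb_halted, if_pos rfl, mul_one] at h₂
    simp only [List.length_map, List.length_range, Nat.cast_pow, Nat.cast_ofNat] at h₂
    have hN : (0 : ℝ) < 2 ^ M.depth := by positivity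
    have hM' : (0 : ℝ) < M.bval := by exact_mod_cast hpos
    rw [eq_div_iff hN.ne'] at h₂
    rw [eq_div_iff hM'.ne']
    linarith
  · intro j _ hj
    classical
    rw [outputProb_halted, if_neg fun h => hj (unary_injective h), mul_zero]
  · intro hn
    exact absurd (Finset.mem_range.2 hi) hn

/-- The truncated expected time T satisfies T ≤ c + (1 - m/K) T, with m the value of M, K = 2 ^
`M.depth` and c independent of t. Hence T ≤ c K / m uniformly in t. -/
theorem timeUpTo_attempt {S : ℕ} {ws : List Val} {M : Val}
    (h : ∀ b, Branch S (step b (attemptCfg ws M)) ((List.range (2 ^ M.depth)).map fun r =>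
      attemptResult ws M (pick (ws.map Val.bval) r)))
    (hsum : (ws.map Val.bval).sum = M.bval) (hM : M.bval ≤ 2 ^ M.depth) (hpos : 0 < M.bval) :
    ∃ B, ∀ t, timeUpTo t (attemptCfg ws M) ≤ B := by
  obtain ⟨B₁, h₁⟩ := (h false).exists_le
  obtain ⟨B₂, h₂⟩ := (h true).exists_le
  refine ⟨(1 + (B₁ + B₂) / 2) * 2 ^ M.depth / M.bval, fun t => ?_⟩
  have e₁ := h₁ 1 _ zero_le_one (stepLE_timeUpTo t)
  have e₂ := h₂ 1 _ zero_le_one (stepLE_timeUpTo t)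
  have e := stepLE_timeUpTo t (attemptCfg ws M)
  rw [sum_attempt (hsum.le.trans hM), hsum] at e₁ e₂
  simp only [timeUpTo_halted, mul_zero, Finset.sum_const_zero, zero_add, List.length_map,
    List.length_range, Nat.cast_pow, Nat.cast_ofNat, one_mul] at e₁ e₂
  have hN : (0 : ℝ) < 2 ^ M.depth := by positivity
  have hM' : (0 : ℝ) < M.bval := by exact_mod_cast hpos
  rw [le_div_iff₀ hM']
  have e₃ : timeUpTo t (attemptCfg ws M) ≤ (1 + (B₁ + B₂) / 2) +
      (2 ^ M.depth - M.bval) * timeUpTo t (attemptCfg ws M) / 2 ^ M.depth := by linarith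
  have e₄ := mul_le_mul_of_nonneg_right e₃ hN.le
  rw [add_mul, div_mul_cancel₀ _ hN.ne'] at e₄
  linarith

theorem improviser_path {k : ℕ} {C : Inst} {h : List (Fin k)} {v : Val} {s : ℕ}
    (e : Ev (F.prepare k) (.cons (encWord h) C.enc) v s) :
    Path (s + 2) (init (improviser k C) (encWord h)) ⟨[sampler, outputInstr], .cons v .nil⟩ := by
  have h₁ := e.size_le
  simp only [Val.size] at h₁
  refine .head (by simp only [init]; omega) (fun _ => rfl) ?_
  refine .head (c₁ := ⟨[universalImproviser k], .cons (encWord h) C.enc⟩)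
    (by dsimp only; omega) (fun _ => by simp [step, Expr.eval]) ?_
  refine .head (by simp only [Val.size]; omega) (fun _ => rfl) ?_
  refine .head (by simp only [Val.size]; omega) (fun _ => rfl) ?_
  refine .head (by simp only [Expr.eval, Val.size]; omega) (fun _ => rfl) ?_
  refine (e.path .nil _).trans ?_
  exact .single (by simp only [Val.size]; omega) (fun _ => rfl)

theorem improviser_spec (k : ℕ) : ∃ S, PB S ∧ ∀ (Z : ℕ) (C : Inst), Bounded k Z C →
    C.Feasible k → ∀ h : List (Fin k), h.length ≤ C.n →
    SpaceLE (improviser k C) (encWord h) (S Z) ∧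
    FiniteExpectedTime (improviser k C) (encWord h) ∧
    (h.length < C.n → ∀ u : Fin k,
      OutputsWithProb (improviser k C) (encWord h) (.unary u) (C.strategy h u)) := by
  obtain ⟨s₁, hs₁, h₁⟩ := prepare_ev k
  obtain ⟨s₂, hs₂, h₂⟩ := attempt_branch
  -- This bounds both the digits of each weight and the size of the list of k ≤ Z weights.
  obtain ⟨L, hL⟩ : ∃ L : ℕ → ℕ, L = fun Z => (4 * s₁ Z + 2) * Z + s₁ Z + 2 := ⟨_, rfl⟩
  refine ⟨fun Z => s₁ Z + s₂ (L Z) + 2 * Z + 10, by subst hL; fun_prop, ?_⟩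
  intro Z C hC hfeas h hn
  rcases h₁ Z C hC h hn with ⟨⟨hlt, he, hpos⟩, w, M, e, hM, hMv, hw⟩ | ⟨hnot, e⟩
  · obtain ⟨ws, hws⟩ : ∃ ws, ws = (List.finRange k).map w := ⟨_, rfl⟩
    rw [← hws] at e
    have hlen : ws.length = k := by simp [hws]
    have hwsb : ∀ v ∈ ws, v.IsBin (s₁ Z) := by
      rw [hws]
      intro v hv
      obtain ⟨u, -, rfl⟩ := List.mem_map.1 hv
      exact (hw u).1
    have hsz : (Val.ofList ws).size + 1 ≤ L Z := by
      have h₃ := size_ofList_le (B := 4 * s₁ Z + 1) ws fun v hv => (hwsb v hv).size_le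
      rw [hlen] at h₃
      have h₄ := Nat.mul_le_mul_left (4 * s₁ Z + 2) hC.card_le
      rw [hL]
      simp only [add_assoc, Nat.reduceAdd] at *
      omega
    have hsL : s₁ Z ≤ L Z := by rw [hL]; simp only; omega
    obtain ⟨hst, hbr⟩ := h₂ (L Z) ws M (fun v hv => (hwsb v hv).mono hsL) (hM.mono hsL) hsz
    have hval : ws.map Val.bval = (List.finRange k).map (C.alloc h.reverse) := by
      rw [hws, List.map_map]
      exact List.map_congr_left fun u _ => (hw u).2
    have hsum : (ws.map Val.bval).sum = M.bval := by
      rw [hval, hMv, ← sum_alloc_eq hfeas (g := h.reverse) (by simpa using hlt) (by simpa using he)]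
      rw [← List.ofFn_eq_map, List.sum_ofFn]
    have hMd := hM.depth_le.2.bval_lt.le
    rw [← hMv] at hpos
    have path := improviser_path e
    refine ⟨?_, ?_, ?_⟩
    · intro ω
      beta_reduce
      refine (path.mono ?_).safeFor (t := ω.length) (fun ω' hω' => ?_) ω le_rfl
      · omega
      · exact (attempt_safeFor hst hbr _ ω' hω').trans (by omega)
    · obtain ⟨B, hB⟩ := timeUpTo_attempt hbr hsum hMd hpos
      obtain ⟨B', hB'⟩ := (path.branch (.leaf _)).exists_le
      refine finiteExpectedTime_of_le (B := B' + B) fun t => ?_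
      have := hB' 1 _ zero_le_one (stepLE_timeUpTo t)
      have h₃ := hB t
      simp only [List.map_cons, List.map_nil, List.sum_cons, List.sum_nil, add_zero,
        List.length_singleton, Nat.cast_one, div_one, one_mul] at this
      exact this.trans (add_le_add_right h₃ _)
    · intro _ u
      have h₃ := outputProb_attempt hbr hsum hMd hpos (i := u) (by rw [hlen]; exact u.2)
      have h₄ := (path.branch (.leaf _)).outputProb_eq (.unary u)
      have h₅ : C.strategy h u = outputProb (.unary u) (init (improviser k C) (encWord h)) := by
        rw [h₄]
        simp only [List.map_cons, List.map_nil, List.sum_cons, List.sum_nil, add_zero,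
          List.length_singleton, Nat.cast_one, div_one]
        refine Eq.trans ?_ h₃.symm
        rw [Inst.strategy, if_pos ⟨he, hMv ▸ hpos⟩, hMv, hval]
        simp
      rw [h₅]
      exact tendsto_outputProb _ _
  · have es := e.size_le.2
    simp only [Val.size] at es
    beta_reduce
    -- Without sampling the output is `nil`, the unary code of symbol 0, in agreement with the
    -- default of `Inst.strategy`.
    have path : Path (s₁ Z + 2) (init (improviser k C) (encWord h)) ⟨[], .nil⟩ := by
      refine (improviser_path e).trans ?_
      refine .head (c₁ := ⟨[outputInstr], .cons .one .nil⟩) ?_ (fun _ => rfl) ?_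
      · simp only [Val.size]; omega
      · exact .single (by simp only [Val.size]; omega) (fun _ => rfl)
    refine ⟨(path.mono (by omega)).spaceLE (by simp only [Val.size]; omega), ?_, ?_⟩
    · obtain ⟨B', hB'⟩ := (path.branch (.leaf _)).exists_le
      refine finiteExpectedTime_of_le (B := B') fun t => ?_
      have := hB' 1 _ zero_le_one (stepLE_timeUpTo t)
      simpa [timeUpTo_halted] using this
    · intro hlt u
      classical
      have h₄ := (path.branch (.leaf _)).outputProb_eq (.unary u)
      have h₅ : C.strategy h u = outputProb (.unary u) (init (improviser k C) (encWord h)) := by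
        rw [h₄]
        simp only [List.map_cons, List.map_nil, List.sum_cons, List.sum_nil, add_zero,
          List.length_singleton, Nat.cast_one, div_one]
        rw [outputProb_halted, Inst.strategy, if_neg fun hc => hnot ⟨hlt, hc⟩]
        by_cases hu : (u : ℕ) = 0
        · simp [hu, Val.unary]
        · rw [if_neg hu, if_neg fun h0 => hu (unary_injective (a₂ := 0) h0.symm)]
      rw [h₅]
      exact tendsto_outputProb _ _


/-! ### The improvisation scheme -/

theorem Expr.enc_injective : Function.Injective Expr.enc := by
  intro e f h
  induction e generalizing f with
  | var => cases f <;> simp_all [Expr.enc, Val.unary]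
  | nil => cases f <;> simp_all [Expr.enc, Val.unary]
  | cons a b iha ihb =>
    cases f <;> simp [Expr.enc, Val.unary] at h
    rw [iha h.1, ihb h.2]
  | hd a ih =>
    cases f <;> simp [Expr.enc, Val.unary] at h
    rw [ih h]
  | tl a ih =>
    cases f <;> simp [Expr.enc, Val.unary] at h
    rw [ih h]

/-- Needed because the space bound speaks of every program whose code the scheme outputs; that
program must be the constructed improviser. -/
theorem Prog.enc_injective : Function.Injective Prog.enc := by
  intro P Q h
  induction P generalizing Q with
  | assign e =>
    cases Q <;> simp [Prog.enc, Val.unary] at h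
    rw [Expr.enc_injective h]
  | flip => cases Q <;> simp_all [Prog.enc, Val.unary]
  | seq P₁ P₂ ih₁ ih₂ =>
    cases Q <;> simp [Prog.enc, Val.unary] at h
    rw [ih₁ h.1, ih₂ h.2]
  | cond e P₁ P₂ ih₁ ih₂ =>
    cases Q <;> simp [Prog.enc, Val.unary] at h
    rw [Expr.enc_injective h.1, ih₁ h.2.1, ih₂ h.2.2]
  | loop e P ih =>
    cases Q <;> simp [Prog.enc, Val.unary] at h
    rw [Expr.enc_injective h.1, ih h.2]

theorem Prog.enc_ne_nil (P : Prog) : P.enc ≠ .nil := by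
  cases P <;> simp [Prog.enc]

/-- The program that computes `f` on its whole store. -/
def F.main (f : F) : Prog :=
  .seq (.assign (.cons .var .nil)) (.seq f.toProg (.assign (.hd .var)))

theorem F.deterministic_main (f : F) : f.main.Deterministic :=
  ⟨trivial, f.deterministic_toProg, trivial⟩

theorem Ev.path_main {f : F} {x y : Val} {s : ℕ} (h : Ev f x y s) :
    Path (s + 2) (init f.main x) ⟨[], y⟩ := by
  have e := h.size_le
  refine .head (by simp only [init]; omega) (fun _ => rfl) ?_
  refine .head (by simp only; omega) (fun _ => rfl) ?_
  refine .head (by simp only [Expr.eval, Val.size]; omega) (fun _ => rfl) ?_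
  refine (h.path .nil _).trans ?_
  exact .single (by simp only [Val.size]; omega) (fun _ => rfl)

/-- The length n is written in unary, so program size plus word length is at most |C|, and p at |C|
bounds the space of both decision programs. -/
theorem bounded_of_mem {p : Polynomial ℕ} {C : Inst} (hC : C ∈ RCI (PSA k p) (PSA k p)) :
    Bounded k (k + C.size + p.eval C.size) C := by
  have hs : C.hard.size + C.soft.size + C.n ≤ C.size := by
    simp only [Inst.size, Inst.enc, Val.ofList, Val.size, size_unary, Prog.size]
    omega
  have key : ∀ P ∈ PSA k p, P.size + C.n ≤ C.size →
      Decides k (k + C.size + p.eval C.size) C.n P := by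
    rintro P ⟨hdet, hP⟩ hle
    refine ⟨hdet, ?_, fun w _ => (hP w).1, fun w hw ω => ((hP w).2 ω).trans ?_⟩
    · have : P.size = P.enc.size := rfl
      omega
    · have := Polynomial.eval_mono_nat (p := p) (show P.size + w.length ≤ C.size by omega)
      omega
  exact ⟨key _ hC.1 (by omega), key _ hC.2 (by omega), by
    have : C.size = C.enc.size := rfl
    omega, by omega⟩

theorem realizable_iff_feasible {C : Inst} : C.Realizable k ↔ C.Feasible k :=
  ⟨fun ⟨_, h⟩ => h.feasible, fun h => ⟨_, h.isImprovising⟩⟩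

end Improv

/-! ### One scheme for every polynomial -/

theorem theorem3 (k : ℕ) :
    ∃ S : Improv.Prog, ∀ p : Polynomial ℕ,
      Improv.IsPolySpaceScheme k S (Improv.RCI (Improv.PSA k p) (Improv.PSA k p)) := by
  obtain ⟨s₁, hs₁, h₁⟩ := Improv.scheme_ev k
  obtain ⟨s₂, hs₂, h₂⟩ := Improv.improviser_spec k
  refine ⟨(Improv.F.scheme k).main, fun p => ?_⟩
  -- The program has been fixed already; p enters only through this bound Z.
  obtain ⟨Z, hZ⟩ : ∃ Z : ℕ → ℕ, Z = fun m => k + m + p.eval m := ⟨_, rfl⟩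
  have hZp : Improv.PB Z := by
    have hp : Improv.PB p.eval := ⟨p, fun _ => rfl⟩
    rw [hZ]
    fun_prop
  have hB : ∀ C ∈ Improv.RCI (Improv.PSA k p) (Improv.PSA k p),
      Improv.Bounded k (Z C.size) C := fun C hC => by
    rw [hZ]; exact Improv.bounded_of_mem hC
  have hpath : ∀ C ∈ Improv.RCI (Improv.PSA k p) (Improv.PSA k p), ∃ y,
      Improv.Ev (Improv.F.scheme k) C.enc y (s₁ (Z C.size)) ∧
      (C.Feasible k → y = (Improv.improviser k C).enc) ∧ (¬ C.Feasible k → y = .nil) := by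
    intro C hC
    obtain ⟨ha, hb⟩ := h₁ _ C (hB C hC)
    by_cases hf : C.Feasible k
    · exact ⟨_, ha hf, fun _ => rfl, fun h => absurd hf h⟩
    · exact ⟨_, hb hf, fun h => absurd h hf, fun _ => rfl⟩
  refine ⟨Improv.F.deterministic_main _, fun C hC hr => ?_, fun C hC hr => ?_, ?_, ?_⟩
  · have hf := Improv.realizable_iff_feasible.1 hr
    obtain ⟨y, e, hy, -⟩ := hpath C hC
    rw [hy hf] at e
    have h := h₂ _ C (hB C hC) hf
    exact ⟨Improv.improviser k C, e.path_main.outputs, fun w hw => (h w hw).2.1, C.strategy,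
      hf.isImprovising, fun w hw => (h w hw.le).2.2 hw⟩
  · obtain ⟨y, e, -, hy⟩ := hpath C hC
    rw [hy fun hf => hr (Improv.realizable_iff_feasible.2 hf)] at e
    exact e.path_main.outputs
  · obtain ⟨q, hq⟩ : Improv.PB fun m => s₁ (Z m) + 2 := by fun_prop
    refine ⟨q, fun C hC => ?_⟩
    obtain ⟨y, e, -⟩ := hpath C hC
    rw [hq]
    exact e.path_main.spaceLE (e.size_le.2.trans (Nat.le_add_right _ _))
  · obtain ⟨q, hq⟩ : Improv.PB fun m => s₂ (Z m) := by fun_prop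
    refine ⟨q, fun C hC G hG w hw => ?_⟩
    obtain ⟨y, e, hy, hy'⟩ := hpath C hC
    obtain ⟨ω, hω⟩ := hG
    -- The output of the scheme is unique, so `G` is the constructed improviser, or else its code
    -- would be `nil`, which no program has.
    have hGy := e.path_main.run_unique hω
    by_cases hf : C.Feasible k
    · rw [hy hf] at hGy
      rw [Improv.Prog.enc_injective hGy, hq]
      exact (h₂ _ C (hB C hC) hf w hw).1
    · rw [hy' hf] at hGy
      exact absurd hGy G.enc_ne_nil
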